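/- Let $0<q<1$. Write $(a;r)_\infty=\prod_{k\ge 0}(1-ar^k)$, $(a;r)_n=\prod_{0\le k<n}(1-ar^k)$ for $n\in\mathbb N$, $(a;r)_\nu=(a;r)_\infty/(ar^\nu;r)_\infty$ for real $\nu$, $(a_1,\dots,a_m;r)_n=\prod_i(a_i;r)_n$, $[\nu]_r=(1-r^\nu)/(1-r)$, and use Jackson integrals $\int_0^b\phi\,d_rx=(1-r)\sum_{n\ge0}br^n\phi(br^n)$, $\int_a^b=\int_0^b-\int_0^a$, $\int_0^\infty\phi\,d_rx=(1-r)\sum_{n\in\mathbb Z}r^n\phi(r^n)$. The support $\mathcal C$ is a segment from $a\le 0$ to $b>0$ or the half line $(0,\infty)$. Its integer lattice is $\{aq^n,bq^n:n\ge 0\}\setminus\{0\}$, respectively $q^{\mathbb Z}$, its half-integer lattice is $q^{1/2}$ times this, and its lattice $L$ is the union of the two. A classical $q$-weight on $\mathcal C$ consists of real functions $\rho(x)=\rho(x;q^{1/2})$, $\omega(x)=\omega(x;q)$ and real polynomials $f,g$ with $\deg f\le2$, $\deg g\le 1$ such that on $L$ the numbers $\rho(x),\omega(x),f(q^{1/2}x)$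 are nonzero and $$\frac{\rho(q^{1/2}x)}{\rho(x)}=\frac{f(x)-(1-q^{1/2})xg(x)}{f(q^{1/2}x)},\qquad \omega(x)\,\omega(q^{1/2}x)=\frac{\rho(x)}{f(q^{1/2}x)},$$ $f$ vanishes at the finite end points of $\mathcal C$, $\omega$ has a limit at $0$ along $L$ if $\mathcal C$ is a segment with $a<0$, and all moments of $\rho$ and $\omega$ with respect to $d_{q^{1/2}}x$ converge absolutely. Put $$\langle\phi,\psi\rangle_{2}=\int_{\mathcal C}\phi\psi\rho\,d_{q^{1/2}}x,\qquad \langle\phi,\psi\rangle_{1}=\int_{a}^{b}\int_{a}^{q^{1/2}y}\bigl(\phi(x)\psi(y)-\phi(y)\psi(x)\bigr)\omega(x)\omega(y)\,d_qx\,d_qy$$ (with $a=0$, $b=\infty$ for the half line). Let $s(x,y)=(1+q^{1/2})^2\operatorname{sgn}(y-x)$ if $x,y\in L$ have the same sign, one of them is an integer point, the other a half-integer point, and the half-integer point has the smaller absolute value, or if $x,y$ are integer points of opposite sign; let $s(x,y)=0$ otherwise. Let $(s_x\phi)(x)=\int_{\mathcal C}s(z,x)\phi(z)\omega(z)\,d_{q^{1/2}}z$.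 Let $(p_k)$ be monic orthogonal polynomials, $\deg p_k=k$, $\langle p_k,p_l\rangle_2=h_k\delta_{kl}$, $h_k\ne0$. Let $D_r\phi(x)=\frac{\phi(x)-\phi(rx)}{(1-r)x}$, $(\mathcal A_q\phi)(x)=g(x)\phi(q^{1/2}x)+q^{-1/2}f(x)D_{q^{-1/2}}\phi(x)+f(x)D_{q^{1/2}}\phi(x)$, and $$\gamma_j=\frac{-\langle p_{j+1},\mathcal A_qp_j\rangle_2}{(1+q^{1/2})^2h_jh_{j+1}},\qquad S_N(x,y)=\sum_{l=0}^{N-1}\frac{p_l(x)p_l(y)}{h_l}.$$ A monic skew orthogonal system is $(Q_k)$, $(u_k)$ with $Q_k$ monic of degree $k$, $\langle Q_{2m},Q_{2n}\rangle_1=\langle Q_{2m+1},Q_{2n+1}\rangle_1=0$, $\langle Q_{2m},Q_{2n+1}\rangle_1=u_m\delta_{mn}$, $u_m\ne0$. The skew $J$-Christoffel–Darboux kernel is $J_{2n}(x,y)=s_xK_{2n}(x,y)$, where $K_{2n}(x,y)=\sum_{i=0}^{n-1}\frac1{u_i}\bigl(Q_{2i}(x)Q_{2i+1}(y)-Q_{2i}(y)Q_{2i+1}(x)\bigr)$.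 **Theorem.** For every classical $q$-weight with monic orthogonal polynomials $(p_k)$, a monic skew orthogonal system exists, and for each such system, all $n\ge1$, $x\in L$ and $y\in\mathbb R$, $$J_{2n}(x,y)=\frac{\rho(x;q^{1/2})}{\omega(x;q)}S_{2n-1}(x,y)+\gamma_{2n-2}\,\bigl(s_xp_{2n-2}(x)\bigr)\,p_{2n-1}(y).$$ Moreover each of the following four families is a classical $q$-weight, has monic orthogonal polynomials, and satisfies $J_{2n}(x,y)=R(x)\,S_{2n-1}(x,y)+\Gamma_n\,(s_xp_{2n-2}(x))\,p_{2n-1}(y)$ for all $n\ge 1$, $x\in L$, $y\in\mathbb R$, with explicit $R$ and $\Gamma_n$: 1. *Little $q$-Jacobi*, $\alpha,\beta>-1$, support $(0,1]$: $\rho=x^\alpha(q^{1/2}x;q^{1/2})_\beta$, $\omega=q^{-\frac{\alpha+1}8}x^{\frac{\alpha-1}2}(qx;q)_{\frac{\beta-1}2}$, $f=x(1-x)$, $g=-([\alpha+\beta+2]_{q^{1/2}}x-[\alpha+1]_{q^{1/2}})$; $R=q^{\frac{\alpha+1}8}x^{\frac{\alpha+1}2}(q^{1/2}x;q)_{\frac{\beta+1}2}$,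 $$\Gamma_n=\frac{q^{-2n^2+3n-1-\alpha(n-1)}(q^{\frac{\alpha+\beta-1}2+n};q^{1/2})_{2n-2}\,(q^{1/2};q^{1/2})_{4n-2+\alpha+\beta}}{(1-q)^2(q^{1/2};q^{1/2})_{2n-2+\alpha}(q^{1/2};q^{1/2})_{2n-2+\beta}(q^{1/2};q^{1/2})_{2n-2}}.$$ 2. *Al-Salam–Carlitz*, $\alpha<0$, support from $\alpha$ to $1$: $\rho=(q^{1/2}x,q^{1/2}x/\alpha;q^{1/2})_\infty$, $\omega=(-\alpha)^{-1/2}(qx,qx/\alpha;q)_\infty$, $f=(1-x)(x-\alpha)$, $g=\frac{x-(1+\alpha)}{q^{1/2}-1}$; $R=(-\alpha)^{1/2}(q^{1/2}x,q^{1/2}x/\alpha;q)_\infty$, $$\Gamma_n=\frac{(-\alpha)^{2-2n}q^{\frac{-2n^2+3n-1}2}}{(1-q)^2(q^{1/2};q^{1/2})_{2n-2}(q^{1/2},\alpha,\alpha^{-1}q^{1/2};q^{1/2})_\infty}.$$ 3. *$q$-Laguerre*, $\alpha>-1$, support $(0,\infty)$: $\rho=x^\alpha/(-x;q^{1/2})_\infty$,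 $\omega=q^{-\frac{\alpha+1}8}x^{\frac{\alpha-1}2}/(-x;q)_\infty$, $f=x$, $g=\frac{1-q^{(\alpha+1)/2}-q^{(\alpha+1)/2}x}{1-q^{1/2}}$; $R=q^{\frac{\alpha+1}8}x^{\frac{\alpha+1}2}/(-q^{1/2}x;q)_\infty$, $$\Gamma_n=\frac{2q^{4n^2+2(\alpha-3)n+\frac{5-3\alpha}2}(q^{\frac{\alpha+1}2},-q^{1/2},-q^{1/2};q^{1/2})_\infty}{(1-q)^2(q^{\frac{\alpha+1}2},q^{1/2};q^{1/2})_{2n-2}(q^{1/2},-q^{\frac{\alpha+1}2},-q^{-\frac\alpha2};q^{1/2})_\infty}.$$ 4. *Big $q$-Jacobi*, $0<aq^{1/2}<1$, $0\le bq^{1/2}<1$, $c<0$, support from $cq^{1/2}$ to $aq^{1/2}$: $\rho=\frac{(a^{-1}x,c^{-1}x;q^{1/2})_\infty}{(x,bc^{-1}x;q^{1/2})_\infty}$, $\omega=\frac{(a^{-1}q^{1/2}x,c^{-1}q^{1/2}x;q)_\infty}{(x,bc^{-1}x;q)_\infty}$, $f=(1-\frac x{aq^{1/2}})(1-\frac x{cq^{1/2}})$,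 $g=\frac1{1-q^{1/2}}\bigl((\frac1{acq}-\frac bc)x+\frac bc+1-\frac1{aq^{1/2}}-\frac1{cq^{1/2}}\bigr)$; $R=\frac{(a^{-1}x,c^{-1}x;q)_\infty}{(q^{1/2}x,bc^{-1}q^{1/2}x;q)_\infty}$, $$\Gamma_n=-\frac{q^{-n^2-\frac n2}(aq^{1/2},bq^{1/2},cq^{1/2},abc^{-1}q^{1/2};q^{1/2})_\infty(abq^{\frac{2n-1}2};q^{1/2})_{2n-2}}{a^{2n}c^{2n-1}(1-q)^2(q^{1/2},a^{-1}c,ac^{-1}q^{1/2},abq^{2n-\frac12};q^{1/2})_\infty(q^{1/2},aq^{1/2},bq^{1/2},cq^{1/2},abc^{-1}q^{1/2};q^{1/2})_{2n-2}}.$$ -/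

import Mathlib

noncomputable section

namespace QEnsemble

/-! ### `q`-shifted factorials -/

/-- The infinite `r`-shifted factorial `(a; r)_∞ = ∏_{k ≥ 0} (1 - a r^k)`. -/
def pochInf (a r : ℝ) : ℝ := ∏' k : ℕ, (1 - a * r ^ k)

/-- The finite `r`-shifted factorial `(a; r)_n = ∏_{0 ≤ k < n} (1 - a r^k)`. -/
def pochFin (a r : ℝ) (n : ℕ) : ℝ := ∏ k ∈ Finset.range n, (1 - a * r ^ k)

/-- The `r`-shifted factorial of real order, `(a; r)_ν = (a; r)_∞ / (a r^ν; r)_∞`. -/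
def pochReal (a r ν : ℝ) : ℝ := pochInf a r / pochInf (a * r ^ ν) r

/-- The `r`-number `[ν]_r = (1 - r^ν) / (1 - r)`. -/
def qNumber (r ν : ℝ) : ℝ := (1 - r ^ ν) / (1 - r)

/-! ### Jackson integrals -/

/-- The Jackson integral `∫_0^b φ(x) d_r x = (1 - r) ∑_{n ≥ 0} b r^n φ(b r^n)`. -/
def jackson (r b : ℝ) (φ : ℝ → ℝ) : ℝ := (1 - r) * ∑' n : ℕ, b * r ^ n * φ (b * r ^ n)

/-- The supports of the weights: a segment from `a ≤ 0` to `b > 0` (for `a = 0` this is the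
one-sided case `(0, b]`), or the half line `(0, ∞)`. -/
inductive Support where
  | segment (a b : ℝ) : Support
  | halfLine : Support

namespace Support

/-- The Jackson integral over the whole support with base `r`:
`∫_a^b = ∫_0^b - ∫_0^a`, respectively `∫_0^∞ φ d_r x = (1 - r) ∑_{n ∈ ℤ} r^n φ(r^n)`. -/
def integral (r : ℝ) (φ : ℝ → ℝ) : Support → ℝ
  | segment a b => jackson r b φ - jackson r a φ
  | halfLine => (1 - r) * ∑' n : ℤ, r ^ n * φ (r ^ n)

/-- The Jackson integral from the left end of the support up to `c`. -/
def integralTo (r c : ℝ) (φ : ℝ → ℝ) : Support → ℝ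
  | segment a _ => jackson r c φ - jackson r a φ
  | halfLine => jackson r c φ

/-- Convergence of the Jackson integral over the support. -/
def Integrable (r : ℝ) (φ : ℝ → ℝ) : Support → Prop
  | segment a b => (Summable fun n : ℕ => b * r ^ n * φ (b * r ^ n)) ∧
      Summable fun n : ℕ => a * r ^ n * φ (a * r ^ n)
  | halfLine => Summable fun n : ℤ => r ^ n * φ (r ^ n)

/-- The integer `q`-lattice of the support: `{a q^n} ∪ {b q^n}` with `n ∈ ℕ` (without `0`, which
would occur if `a = 0`), respectively `q^ℤ`. -/
def integerLattice (q : ℝ) : Support → Set ℝ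
  | segment a b => {x | x ≠ 0 ∧ ∃ n : ℕ, x = a * q ^ n ∨ x = b * q ^ n}
  | halfLine => {x | ∃ n : ℤ, x = q ^ n}

/-- The half-integer `q`-lattice of the support, `q^{1/2}` times the integer one. -/
def halfIntegerLattice (q : ℝ) (D : Support) : Set ℝ :=
  {x | ∃ z ∈ D.integerLattice q, x = √q * z}

/-- The configuration space of one particle. -/
def lattice (q : ℝ) (D : Support) : Set ℝ := D.integerLattice q ∪ D.halfIntegerLattice q

/-- The pairs on which the skew kernel does not vanish: on one side of the origin, an integer and
a half-integer point, the half-integer point lying closer to the origin; across the origin, two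
integer points. On `q^{ℤ/2}` these are the pairs `q^{m+1/2}`, `q^n` with `m ≥ n`. -/
def Linked (q : ℝ) (D : Support) (x y : ℝ) : Prop :=
  (0 < x * y ∧ x ∈ D.halfIntegerLattice q ∧ y ∈ D.integerLattice q ∧ |x| < |y|) ∨
  (0 < x * y ∧ x ∈ D.integerLattice q ∧ y ∈ D.halfIntegerLattice q ∧ |y| < |x|) ∨
  (x * y < 0 ∧ x ∈ D.integerLattice q ∧ y ∈ D.integerLattice q)

open Classical in
/-- The skew symmetric kernel `s(x, y)`: it is `(1 + q^{1/2})² sgn(y - x)` on linked pairs and `0`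
elsewhere. It is the kernel for which
`∫∫ φ(x) ψ(y) s(x,y) ω(x) ω(y) d_{√q}x d_{√q}y
  = ∫_a^b ∫_a^{√q y} (φ(x) ψ(y) - φ(y) ψ(x)) ω(x) ω(y) d_q x d_q y`. -/
def skewKernel (q : ℝ) (D : Support) (x y : ℝ) : ℝ :=
  if D.Linked q x y then (1 + √q) ^ 2 * (if x < y then 1 else -1) else 0

end Support

/-! ### Weights -/

/-- The data of a weight: its support, the weight `ρ(x) = ρ(x; q^{1/2})` of the orthogonal
polynomials, the weight `ω(x) = ω(x; q)` of the skew orthogonal polynomials, and the Pearson pair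
`f = f(·; q^{1/2})`, `g = g(·; q^{1/2})`. -/
structure Weight where
  supp : Support
  ρ : ℝ → ℝ
  ω : ℝ → ℝ
  f : Polynomial ℝ
  g : Polynomial ℝ

namespace Weight

/-- The boundary conditions: `f` vanishes at the finite end points of the support (so that
`f(√q x) ρ(√q x)` vanishes at the end points), and if the lattice accumulates at `0` from both
sides then `ω` has a limit there. -/
def BoundaryConditions (W : Weight) (q : ℝ) : Prop :=
  match W.supp with
  | .segment a b => a ≤ 0 ∧ 0 < b ∧ W.f.eval a = 0 ∧ W.f.eval b = 0 ∧
      (a < 0 → ∃ l : ℝ, Filter.Tendsto W.ω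
        (nhdsWithin 0 ((Support.segment a b).lattice q)) (nhds l))
  | .halfLine => W.f.eval 0 = 0

/-- Classical `q`-weights: `ρ` satisfies the Pearson equation
`ρ(√q x) / ρ(x) = (f(x) - (1 - √q) x g(x)) / f(√q x)` with `deg f ≤ 2`, `deg g ≤ 1`, the weight `ω`
is a solution of `ω(x) ω(√q x) = ρ(x) / f(√q x)`, the boundary conditions hold, and all moments
are well defined. -/
structure IsClassical (W : Weight) (q : ℝ) : Prop where
  natDegree_f : W.f.natDegree ≤ 2
  natDegree_g : W.g.natDegree ≤ 1
  rho_ne_zero : ∀ x ∈ W.supp.lattice q, W.ρ x ≠ 0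
  omega_ne_zero : ∀ x ∈ W.supp.lattice q, W.ω x ≠ 0
  f_ne_zero : ∀ x ∈ W.supp.lattice q, W.f.eval (√q * x) ≠ 0
  pearson : ∀ x ∈ W.supp.lattice q, W.ρ (√q * x) / W.ρ x =
    (W.f.eval x - (1 - √q) * x * W.g.eval x) / W.f.eval (√q * x)
  omega_mul : ∀ x ∈ W.supp.lattice q, W.ω x * W.ω (√q * x) = W.ρ x / W.f.eval (√q * x)
  boundary : W.BoundaryConditions q
  moments_rho : ∀ k : ℕ, W.supp.Integrable (√q) fun x => x ^ k * W.ρ x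
  moments_omega : ∀ k : ℕ, W.supp.Integrable (√q) fun x => x ^ k * W.ω x

/-- The inner product `⟨φ, ψ⟩_{2,ρ} = ∫ φ(x) ψ(x) ρ(x; q^{1/2}) d_{√q} x`. -/
def inner2 (W : Weight) (q : ℝ) (φ ψ : ℝ → ℝ) : ℝ :=
  W.supp.integral (√q) fun x => φ x * ψ x * W.ρ x

/-- The skew inner product
`⟨φ, ψ⟩_{1,ω} = ∫_a^b ∫_a^{√q y} (φ(x) ψ(y) - φ(y) ψ(x)) ω(x; q) ω(y; q) d_q x d_q y`. -/
def inner1 (W : Weight) (q : ℝ) (φ ψ : ℝ → ℝ) : ℝ :=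
  W.supp.integral q fun y =>
    W.supp.integralTo q (√q * y) fun x => (φ x * ψ y - φ y * ψ x) * W.ω x * W.ω y

/-- `p 0, p 1, …` are the monic orthogonal polynomials for `⟨·,·⟩_{2,ρ}`. -/
structure IsMonicOP (W : Weight) (q : ℝ) (p : ℕ → Polynomial ℝ) : Prop where
  monic : ∀ n, (p n).Monic
  natDegree : ∀ n, (p n).natDegree = n
  orthogonal : ∀ m n, m ≠ n → W.inner2 q (fun x => (p m).eval x) (fun x => (p n).eval x) = 0
  norm_ne_zero : ∀ n, W.inner2 q (fun x => (p n).eval x) (fun x => (p n).eval x) ≠ 0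

/-- `Q 0, Q 1, …` are monic skew orthogonal polynomials for `⟨·,·⟩_{1,ω}`, with normalizations
`u 0, u 1, …`. -/
structure IsMonicSOP (W : Weight) (q : ℝ) (Q : ℕ → Polynomial ℝ) (u : ℕ → ℝ) : Prop where
  monic : ∀ n, (Q n).Monic
  natDegree : ∀ n, (Q n).natDegree = n
  even_even : ∀ m n,
    W.inner1 q (fun x => (Q (2 * m)).eval x) (fun x => (Q (2 * n)).eval x) = 0
  odd_odd : ∀ m n,
    W.inner1 q (fun x => (Q (2 * m + 1)).eval x) (fun x => (Q (2 * n + 1)).eval x) = 0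
  even_odd : ∀ m n,
    W.inner1 q (fun x => (Q (2 * m)).eval x) (fun x => (Q (2 * n + 1)).eval x) =
      if m = n then u m else 0
  norm_ne_zero : ∀ n, u n ≠ 0

/-- The `r`-difference operator `(D_r φ)(x) = (φ(x) - φ(r x)) / ((1 - r) x)`. -/
def qDiff (r : ℝ) (φ : ℝ → ℝ) (x : ℝ) : ℝ := (φ x - φ (r * x)) / ((1 - r) * x)

/-- The operator `𝒜_q = g T_{√q} + q^{-1/2} f D_{q^{-1/2}} + f D_{√q}`, `T_{√q} φ(x) = φ(√q x)`. -/
def opA (W : Weight) (q : ℝ) (φ : ℝ → ℝ) (x : ℝ) : ℝ :=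
  W.g.eval x * φ (√q * x) + (√q)⁻¹ * W.f.eval x * qDiff (√q)⁻¹ φ x + W.f.eval x * qDiff (√q) φ x

/-- `h_j = ⟨p_j, p_j⟩_{2,ρ}`. -/
def h (W : Weight) (q : ℝ) (p : ℕ → Polynomial ℝ) (j : ℕ) : ℝ :=
  W.inner2 q (fun x => (p j).eval x) (fun x => (p j).eval x)

/-- `c_j = -⟨p_{j+1}, 𝒜_q p_j⟩_{2,ρ}`. -/
def c (W : Weight) (q : ℝ) (p : ℕ → Polynomial ℝ) (j : ℕ) : ℝ :=
  -W.inner2 q (fun x => (p (j + 1)).eval x) (W.opA q fun x => (p j).eval x)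

/-- `γ_j = c_j / ((1 + q^{1/2})² h_j h_{j+1})`. -/
def gamma (W : Weight) (q : ℝ) (p : ℕ → Polynomial ℝ) (j : ℕ) : ℝ :=
  W.c q p j / ((1 + √q) ^ 2 * W.h q p j * W.h q p (j + 1))

/-- The operator `(s_x φ)(x) = ∫ s(z, x) φ(z) ω(z; q) d_{√q} z`. -/
def opS (W : Weight) (q : ℝ) (φ : ℝ → ℝ) (x : ℝ) : ℝ :=
  W.supp.integral (√q) fun z => W.supp.skewKernel q z x * φ z * W.ω z

/-- The skew `K`-Christoffel–Darboux kernel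
`K_{2n}(x,y) = ∑_{i<n} (Q_{2i}(x) Q_{2i+1}(y) - Q_{2i}(y) Q_{2i+1}(x)) / u_i`. -/
def kernelK (Q : ℕ → Polynomial ℝ) (u : ℕ → ℝ) (n : ℕ) (x y : ℝ) : ℝ :=
  ∑ i ∈ Finset.range n, 1 / u i * ((Q (2 * i)).eval x * (Q (2 * i + 1)).eval y -
    (Q (2 * i)).eval y * (Q (2 * i + 1)).eval x)

/-- The skew `J`-Christoffel–Darboux kernel `J_{2n}(x,y) = s_x K_{2n}(x,y)`. -/
def kernelJ (W : Weight) (q : ℝ) (Q : ℕ → Polynomial ℝ) (u : ℕ → ℝ) (n : ℕ) (x y : ℝ) : ℝ :=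
  W.opS q (fun z => kernelK Q u n z y) x

/-- The Christoffel–Darboux kernel `S_N(x,y) = ∑_{l=0}^{N-1} p_l(x) p_l(y) / ⟨p_l, p_l⟩_{2,ρ}`. -/
def kernelS (W : Weight) (q : ℝ) (p : ℕ → Polynomial ℝ) (N : ℕ) (x y : ℝ) : ℝ :=
  ∑ l ∈ Finset.range N, (p l).eval x * (p l).eval y / W.h q p l

/-! ### The four classical families -/

open Polynomial in
/-- The little `q`-Jacobi weight. -/
def littleJacobi (q α β : ℝ) : Weight where
  supp := .segment 0 1
  ρ x := x ^ α * pochReal (√q * x) (√q) β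
  ω x := q ^ (-(α + 1) / 8) * x ^ ((α - 1) / 2) * pochReal (q * x) q ((β - 1) / 2)
  f := X * (1 - X)
  g := -(C (qNumber (√q) (α + β + 2)) * X - C (qNumber (√q) (α + 1)))

open Polynomial in
/-- The Al-Salam–Carlitz weight. -/
def alSalamCarlitz (q α : ℝ) : Weight where
  supp := .segment α 1
  ρ x := pochInf (√q * x) (√q) * pochInf (√q * x / α) (√q)
  ω x := (-α) ^ (-(1 : ℝ) / 2) * pochInf (q * x) q * pochInf (q * x / α) q
  f := (1 - X) * (X - C α)
  g := C (1 / (√q - 1)) * (X - C (1 + α))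

open Polynomial in
/-- The `q`-Laguerre weight. -/
def laguerre (q α : ℝ) : Weight where
  supp := .halfLine
  ρ x := x ^ α / pochInf (-x) (√q)
  ω x := q ^ (-(α + 1) / 8) * x ^ ((α - 1) / 2) / pochInf (-x) q
  f := X
  g := C (1 / (1 - √q)) * (C (1 - (√q) ^ (α + 1)) - C ((√q) ^ (α + 1)) * X)

open Polynomial in
/-- The big `q`-Jacobi weight. -/
def bigJacobi (q a b c : ℝ) : Weight where
  supp := .segment (c * √q) (a * √q)
  ρ x := pochInf (x / a) (√q) * pochInf (x / c) (√q) /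
    (pochInf x (√q) * pochInf (b / c * x) (√q))
  ω x := pochInf (√q * x / a) q * pochInf (√q * x / c) q / (pochInf x q * pochInf (b / c * x) q)
  f := (1 - C (1 / (a * √q)) * X) * (1 - C (1 / (c * √q)) * X)
  g := C (1 / (1 - √q)) * (C (1 / (a * c * q) - b / c) * X +
    C (b / c + 1 - 1 / (a * √q) - 1 / (c * √q)))

end Weight

/-! ### The constants `γ_{2n-2}` of the four families -/

/-- The rank-one coefficient of the little `q`-Jacobi kernel. -/
def littleJacobiConst (q α β : ℝ) (n : ℕ) : ℝ :=
  q ^ (-2 * (n : ℝ) ^ 2 + 3 * n - 1 - α * (n - 1)) *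
      pochFin (q ^ ((α + β - 1) / 2 + n)) (√q) (2 * n - 2) *
      pochReal (√q) (√q) (4 * n - 2 + α + β) /
    ((1 - q) ^ 2 * pochReal (√q) (√q) (2 * n - 2 + α) * pochReal (√q) (√q) (2 * n - 2 + β) *
      pochFin (√q) (√q) (2 * n - 2))

/-- The rank-one coefficient of the Al-Salam–Carlitz kernel. -/
def alSalamCarlitzConst (q α : ℝ) (n : ℕ) : ℝ :=
  (-α) ^ (2 - 2 * (n : ℝ)) * q ^ ((-2 * (n : ℝ) ^ 2 + 3 * n - 1) / 2) /
    ((1 - q) ^ 2 * pochFin (√q) (√q) (2 * n - 2) *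
      (pochInf (√q) (√q) * pochInf α (√q) * pochInf (√q / α) (√q)))

/-- The rank-one coefficient of the `q`-Laguerre kernel. -/
def laguerreConst (q α : ℝ) (n : ℕ) : ℝ :=
  2 * q ^ (4 * (n : ℝ) ^ 2 + 2 * (α - 3) * n + (5 - 3 * α) / 2) *
      (pochInf (q ^ ((α + 1) / 2)) (√q) * pochInf (-√q) (√q) * pochInf (-√q) (√q)) /
    ((1 - q) ^ 2 * (pochFin (q ^ ((α + 1) / 2)) (√q) (2 * n - 2) *
        pochFin (√q) (√q) (2 * n - 2)) *
      (pochInf (√q) (√q) * pochInf (-q ^ ((α + 1) / 2)) (√q) * pochInf (-q ^ (-α / 2)) (√q)))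

/-- The rank-one coefficient of the big `q`-Jacobi kernel. -/
def bigJacobiConst (q a b c : ℝ) (n : ℕ) : ℝ :=
  -(q ^ (-(n : ℝ) ^ 2 - n / 2) *
      (pochInf (a * √q) (√q) * pochInf (b * √q) (√q) * pochInf (c * √q) (√q) *
        pochInf (a * b / c * √q) (√q)) *
      pochFin (a * b * q ^ ((2 * (n : ℝ) - 1) / 2)) (√q) (2 * n - 2)) /
    (a ^ (2 * n) * c ^ (2 * n - 1) * (1 - q) ^ 2 *
      (pochInf (√q) (√q) * pochInf (c / a) (√q) * pochInf (a / c * √q) (√q) *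
        pochInf (a * b * q ^ (2 * (n : ℝ) - 1 / 2)) (√q)) *
      (pochFin (√q) (√q) (2 * n - 2) * pochFin (a * √q) (√q) (2 * n - 2) *
        pochFin (b * √q) (√q) (2 * n - 2) * pochFin (c * √q) (√q) (2 * n - 2) *
        pochFin (a * b / c * √q) (√q) (2 * n - 2)))

end QEnsemble

end

noncomputable section

namespace QEnsemble

open Filter Topology

/-! ### Sums over one arm of the lattice -/

/-! Write `r = √q`, `κ = (1 + r)²`, and `A` for the operator `𝒜_q`. On polynomials, `A φ` equals
`(f(x) φ(x/r) - (f - (1-r) x g)(x) φ(r x)) / ((1-r) x)`. The Pearson equation and `ω(x) ω(r x) =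
ρ(x) / f(r x)` turn this into an exact difference along the lattice: if `x_n` is the `n`-th point of
an arm and `F(n) = (ρ φ / ω)(x_n)`, then `(1-r) x_n (A φ)(x_n) ω(x_n) = F(n-1) - F(n+1)`
(`IsClassical.arm_opA`). On one arm the kernel `s` links even with odd indices, so it sums precisely
such differences. Telescoping gives `⟨A φ, ψ⟩₁ = κ ⟨φ, ψ⟩₂` (`IsClassical.skewForm_opA`) and `s_x (A
φ) = κ (ρ/ω)(x) φ(x)` (`IsClassical.opS_opA`). Where two arms meet at `0`, `F` has a limit there,
the same on both arms; the part of `s` across the origin is what cancels it.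

The rest of the general formula is algebra (`IsSkewPair`). Evaluating `⟨A φ, A ψ⟩₁` in two ways
shows that `A` is skew for `⟨·,·⟩₂`. Since `A` raises degrees by at most one, `A p_n = a_n p_{n+1} -
(a_{n-1} h_n / h_{n-1}) p_{n-1}`, and `γ_n = -a_n / (κ h_n)`. If no `a_n` vanishes, this forces
`p_{2m}` to be skew orthogonal to all polynomials of degree at most `2m`, and `p_{2m}`, `a_{2m}⁻¹ A
p_{2m}` form a skew orthogonal system. For any such system `K_{2n}(·, y)` reproduces values at `y`
on degrees below `2n`, where the skew form is nondegenerate. The combination `κ⁻¹ A S_{2n-1}(·, y) +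
γ_{2n-2} p_{2n-1}(y) p_{2n-2}` has the same property, so the two agree
(`IsClassical.kernelKPoly_eq`), and applying `s_x` gives the theorem.

That `a_n ≠ 0` is a consequence of regularity (`pearsonLead_ne_zero`). The moment functional `u`
annihilates the range of the one-sided Pearson operator `T`. If `T` lost its leading coefficient in
some degree `k`, it would preserve the polynomials of degree at most `k`; it cannot be onto there
because `u 1 ≠ 0`, so it has a kernel element `θ`, and then `u (f θ w) = 0` for every `w`, which
orthogonal polynomials with nonzero norms exclude.

For the four families only the norms `h_n` remain. Multiplying `ρ` by `f` or by `f - (1-r) x g`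
gives, up to a constant, a weight of the same family with shifted parameters, and a difference
quotient of `p_{n+1}` is orthogonal for the new weight (`IsOrth.exists_lower`). This reduces `h_n`
to a total mass, supplied by the `q`-binomial theorem (little `q`-Jacobi), Ramanujan's bilateral sum
(`q`-Laguerre), and the Andrews–Askey integral with its limiting case (big `q`-Jacobi,
Al-Salam–Carlitz). -/

lemma tendsto_two_mul_natCast : Tendsto (fun N : ℕ => 2 * (N : ℤ)) atTop atTop :=
  tendsto_atTop_mono (fun N => by omega) (tendsto_natCast_atTop_atTop (R := ℤ))

lemma hasSum_int_even_add_odd {f : ℤ → ℝ} {a b : ℝ} (he : HasSum (fun n => f (2 * n)) a)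
    (ho : HasSum (fun n => f (2 * n + 1)) b) : HasSum f (a + b) := by
  have hi : Function.Injective fun n : ℤ => 2 * n := fun a b h => by simpa using h
  have hj : Function.Injective fun n : ℤ => 2 * n + 1 := fun a b h => by simpa using h
  refine HasSum.add_isCompl (s := Set.range fun n : ℤ => 2 * n)
    (t := Set.range fun n : ℤ => 2 * n + 1) ?_ (hi.hasSum_range_iff.2 he) (hj.hasSum_range_iff.2 ho)
  rw [isCompl_iff, Set.disjoint_left, codisjoint_iff]
  refine ⟨?_, Set.eq_univ_of_forall fun n => ?_⟩
  · rintro _ ⟨m, rfl⟩ ⟨k, h⟩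
    simp only at h; omega
  · rcases Int.even_or_odd' n with ⟨k, rfl | rfl⟩
    · exact Or.inl ⟨k, rfl⟩
    · exact Or.inr ⟨k, rfl⟩

/-- The sum of the odd terms of `E` after the index `2 n`. -/
def oddTail (E : ℤ → ℝ) (n : ℤ) : ℝ := ∑' k : ℕ, E (2 * n + 2 * k + 1)

/-- The skew form `∑_{m > n} (E_{odd m} E'_{even n} - E_{even n} E'_{odd m})`. -/
def skewSum (E E' : ℤ → ℝ) : ℝ :=
  ∑' n : ℤ, (oddTail E n * E' (2 * n) - E (2 * n) * oddTail E' n)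

lemma summable_even {E : ℤ → ℝ} (hE : Summable E) : Summable fun n : ℤ => E (2 * n) :=
  hE.comp_injective (i := fun n : ℤ => 2 * n) fun a b h => by simpa using h

lemma summable_oddTail {E : ℤ → ℝ} (hE : Summable E) (n : ℤ) :
    Summable fun k : ℕ => E (2 * n + 2 * k + 1) :=
  hE.comp_injective (i := fun k : ℕ => 2 * n + 2 * (k : ℤ) + 1) fun a b h => by
    simpa using h

/-- The bound does not depend on `n`, so products of tails with a summable sequence remain summable.
-/
lemma abs_oddTail_le {E : ℤ → ℝ} (hE : Summable E) (n : ℤ) : |oddTail E n| ≤ ∑' m, |E m| := by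
  have h := summable_oddTail hE n
  have h1 : ‖∑' k : ℕ, E (2 * n + 2 * k + 1)‖ ≤ ∑' k : ℕ, ‖E (2 * n + 2 * k + 1)‖ :=
    norm_tsum_le_tsum_norm h.norm
  refine h1.trans ?_
  exact tsum_comp_le_tsum_of_inj hE.norm (fun _ => norm_nonneg _)
    (i := fun k : ℕ => 2 * n + 2 * (k : ℤ) + 1) fun a b h => by simpa using h

lemma summable_oddTail_mul {E E' : ℤ → ℝ} (hE : Summable E) (hE' : Summable E') :
    Summable fun n : ℤ => oddTail E n * E' (2 * n) := by
  refine Summable.of_norm_bounded (g := fun n => (∑' m, |E m|) * |E' (2 * n)|)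
    ((summable_even hE').norm.mul_left _) fun n => ?_
  rw [norm_mul]
  exact mul_le_mul_of_nonneg_right (abs_oddTail_le hE n) (norm_nonneg _)

lemma oddTail_add {E F : ℤ → ℝ} (hE : Summable E) (hF : Summable F) (n : ℤ) :
    oddTail (fun m => E m + F m) n = oddTail E n + oddTail F n :=
  (summable_oddTail hE n).tsum_add (summable_oddTail hF n)

lemma oddTail_smul (c : ℝ) (E : ℤ → ℝ) (n : ℤ) :
    oddTail (fun m => c * E m) n = c * oddTail E n := tsum_mul_left

lemma skewSum_add {E F E' : ℤ → ℝ} (hE : Summable E) (hF : Summable F) (hE' : Summable E') :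
    skewSum (fun m => E m + F m) E' = skewSum E E' + skewSum F E' := by
  unfold skewSum
  rw [← Summable.tsum_add]
  · refine tsum_congr fun n => ?_
    rw [oddTail_add hE hF]; ring
  · exact (summable_oddTail_mul hE hE').sub
      (((summable_oddTail_mul hE' hE)).congr fun n => mul_comm _ _)
  · exact (summable_oddTail_mul hF hE').sub
      (((summable_oddTail_mul hE' hF)).congr fun n => mul_comm _ _)

lemma skewSum_smul (c : ℝ) (E E' : ℤ → ℝ) :
    skewSum (fun m => c * E m) E' = c * skewSum E E' := by
  unfold skewSum
  rw [← tsum_mul_left]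
  refine tsum_congr fun n => ?_
  rw [oddTail_smul]; ring

/-- Differences at odd indices telescope through the even values of `F`; the limit `l` survives as
boundary term. -/
lemma oddTail_eq_of_telescope {E F : ℤ → ℝ} {l : ℝ} (hE : Summable E)
    (hF : Tendsto F atTop (𝓝 l)) {n : ℤ}
    (h : ∀ k : ℕ, E (2 * n + 2 * k + 1) = F (2 * n + 2 * k) - F (2 * n + 2 * k + 2)) :
    oddTail E n = F (2 * n) - l := by
  have h1 := (summable_oddTail hE n).hasSum.tendsto_sum_nat
  have h2 : Tendsto (fun N : ℕ => F (2 * n) - F (2 * n + 2 * N)) atTop (𝓝 (F (2 * n) - l)) := by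
    refine tendsto_const_nhds.sub (hF.comp ?_)
    refine tendsto_atTop_add_const_left _ _ ?_
    exact tendsto_two_mul_natCast
  refine tendsto_nhds_unique h1 (h2.congr fun N => ?_)
  induction N with
  | zero => simp
  | succ N ih =>
    rw [Finset.sum_range_succ, ← ih, h]
    have : 2 * n + 2 * (N : ℤ) + 2 = 2 * n + 2 * ((N + 1 : ℕ) : ℤ) := by push_cast; ring
    rw [this]; ring

/-- The mirror image: even indices, summed towards `-∞`, telescope through the odd values of `F`.
There is no boundary term since `F` vanishes at `-∞`. -/
lemma tsum_evenInit_eq_of_telescope {E F : ℤ → ℝ} (hE : Summable E)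
    (hF : Tendsto F atBot (𝓝 0)) (h : ∀ n : ℤ, E (2 * n) = F (2 * n - 1) - F (2 * n + 1)) (j : ℤ) :
    ∑' k : ℕ, E (2 * (j - k)) = -F (2 * j + 1) := by
  have hs : Summable fun k : ℕ => E (2 * (j - k)) :=
    hE.comp_injective (i := fun k : ℕ => 2 * (j - (k : ℤ))) fun a b h => by simpa using h
  have h2 : Tendsto (fun N : ℕ => F (2 * j + 1 - 2 * N) - F (2 * j + 1)) atTop
      (𝓝 (0 - F (2 * j + 1))) := by
    refine Tendsto.sub (hF.comp ?_) tendsto_const_nhds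
    simp only [sub_eq_add_neg]
    refine tendsto_atBot_add_const_left _ _ (tendsto_neg_atTop_atBot.comp ?_)
    exact tendsto_two_mul_natCast
  rw [zero_sub] at h2
  refine tendsto_nhds_unique hs.hasSum.tendsto_sum_nat (h2.congr fun N => ?_)
  induction N with
  | zero => simp
  | succ N ih =>
    rw [Finset.sum_range_succ, ← ih, h]
    have e1 : 2 * (j - (N : ℤ)) + 1 = 2 * j + 1 - 2 * N := by ring
    have e2 : 2 * (j - (N : ℤ)) - 1 = 2 * j + 1 - 2 * ((N + 1 : ℕ) : ℤ) := by push_cast; ring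
    rw [e1, e2]; ring

lemma tsum_even_eq_of_telescope {E F : ℤ → ℝ} {l : ℝ} (hE : Summable E)
    (hF : Tendsto F atBot (𝓝 0)) (hF' : Tendsto F atTop (𝓝 l))
    (h : ∀ n : ℤ, E (2 * n) = F (2 * n - 1) - F (2 * n + 1)) :
    ∑' n : ℤ, E (2 * n) = -l := by
  have h0 := tsum_evenInit_eq_of_telescope hE hF h (-1)
  have hs := summable_even hE
  -- Shifting the sequence by one makes the even indices `≥ 0` the odd tail that starts after the
  -- index `-2`.
  have h1 : ∑' k : ℕ, E (2 * (k : ℤ)) = F (-1) - l := by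
    have hE1 : Summable fun m => E (m + 1) :=
      hE.comp_injective (i := fun m : ℤ => m + 1) (add_left_injective 1)
    have hF1 : Tendsto (fun m => F (m + 1)) atTop (𝓝 l) :=
      hF'.comp (tendsto_atTop_add_const_right _ _ tendsto_id)
    have := oddTail_eq_of_telescope (n := -1) hE1 hF1 fun k => by
      have e1 : 2 * (-1) + 2 * (k : ℤ) + 1 + 1 = 2 * k := by ring
      have e2 : 2 * (-1) + 2 * (k : ℤ) + 1 = 2 * k - 1 := by ring
      have e3 : 2 * (-1) + 2 * (k : ℤ) + 2 + 1 = 2 * k + 1 := by ring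
      rw [e1, e2, e3, h]
    have e4 : 2 * (-1 : ℤ) + 1 = -1 := by norm_num
    rw [e4] at this
    rw [← this]
    refine tsum_congr fun k => ?_
    congr 1; ring
  have hs1 : Summable fun k : ℕ => E (2 * (k : ℤ)) :=
    hs.comp_injective (i := fun k : ℕ => (k : ℤ)) Nat.cast_injective
  have hs2 : Summable fun k : ℕ => E (2 * (-((k : ℤ) + 1))) :=
    hs.comp_injective (i := fun k : ℕ => -((k : ℤ) + 1)) fun a b h => by simpa using h
  rw [tsum_of_nat_of_neg_add_one (f := fun n : ℤ => E (2 * n)) hs1 hs2, h1]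
  have : ∑' k : ℕ, E (2 * (-((k : ℤ) + 1))) = ∑' k : ℕ, E (2 * (-1 - (k : ℤ))) :=
    tsum_congr fun k => by congr 1; ring
  rw [this, h0]
  have e3 : 2 * (-1 : ℤ) + 1 = -1 := by norm_num
  rw [e3]; ring

/-- Fubini for the pairs of an even index `2n` and a larger odd index `2n + 2k + 1`, regrouped by
the odd one: `j = n + k`. Both arrangements are subfamilies of the absolutely summable product
family. -/
lemma tsum_even_mul_oddTail {E E' : ℤ → ℝ} (hE : Summable E) (hE' : Summable E') :
    ∑' n : ℤ, E (2 * n) * oddTail E' n =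
      ∑' j : ℤ, (∑' k : ℕ, E (2 * (j - k))) * E' (2 * j + 1) := by
  have hs : Summable fun p : ℤ × ℕ => E (2 * p.1) * E' (2 * p.1 + 2 * p.2 + 1) := by
    have := (summable_mul_of_summable_norm hE.norm hE'.norm).comp_injective
      (i := fun p : ℤ × ℕ => (2 * p.1, 2 * p.1 + 2 * (p.2 : ℤ) + 1)) fun a b h => by
        simp only [Prod.mk.injEq] at h
        ext
        · linarith [h.1]
        · have := h.2; have := h.1; omega
    exact this
  have hs' : Summable fun p : ℤ × ℕ => E (2 * (p.1 - p.2)) * E' (2 * p.1 + 1) := by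
    have := (summable_mul_of_summable_norm hE.norm hE'.norm).comp_injective
      (i := fun p : ℤ × ℕ => (2 * (p.1 - (p.2 : ℤ)), 2 * p.1 + 1)) fun a b h => by
        simp only [Prod.mk.injEq] at h
        have h1 := h.1
        have h2 := h.2
        ext
        · omega
        · omega
    exact this
  have e1 : ∑' n : ℤ, E (2 * n) * oddTail E' n =
      ∑' n : ℤ, ∑' k : ℕ, E (2 * n) * E' (2 * n + 2 * k + 1) :=
    tsum_congr fun n => by rw [oddTail, tsum_mul_left]
  have e2 : ∑' j : ℤ, (∑' k : ℕ, E (2 * (j - k))) * E' (2 * j + 1) =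
      ∑' j : ℤ, ∑' k : ℕ, E (2 * (j - k)) * E' (2 * j + 1) :=
    tsum_congr fun n => by rw [tsum_mul_right]
  rw [e1, e2, ← Summable.tsum_comm (f := fun (n : ℤ) (k : ℕ) => E (2 * n) * E' (2 * n + 2 * k + 1)) hs,
    ← Summable.tsum_comm (f := fun (j : ℤ) (k : ℕ) => E (2 * (j - k)) * E' (2 * j + 1)) hs']
  refine tsum_congr fun k => ?_
  rw [← (Equiv.subRight (k : ℤ)).tsum_eq]
  refine tsum_congr fun j => ?_
  simp only [Equiv.subRight_apply]
  congr 2; ring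

/-- Summation by parts. The relation at odd indices is demanded only beyond an even index where `E'`
does not vanish: at the end point of a bounded arm it fails at the index `-1`, where `E` is `0` but
`F(-2) - F(0) = -F(0)` need not be. The relation at even indices has no such exception. -/
lemma skewSum_eq_of_telescope {E E' F : ℤ → ℝ} {l : ℝ} (hE : Summable E) (hE' : Summable E')
    (hF : Tendsto F atBot (𝓝 0)) (hF' : Tendsto F atTop (𝓝 l))
    (h : ∀ n : ℤ, E (2 * n) = F (2 * n - 1) - F (2 * n + 1))
    (h' : ∀ n : ℤ, E' (2 * n) ≠ 0 → ∀ k : ℕ,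
      E (2 * n + 2 * k + 1) = F (2 * n + 2 * k) - F (2 * n + 2 * k + 2))
    (hFE : Summable fun n => F n * E' n) :
    skewSum E E' = ∑' n, F n * E' n - l * ∑' n, E' (2 * n) := by
  have h1 : ∀ n, oddTail E n * E' (2 * n) = F (2 * n) * E' (2 * n) - l * E' (2 * n) := by
    intro n
    by_cases hn : E' (2 * n) = 0
    · simp [hn]
    · rw [oddTail_eq_of_telescope hE hF' (h' n hn)]; ring
  have hev : Summable fun n : ℤ => F (2 * n) * E' (2 * n) := summable_even hFE
  have hod : Summable fun n : ℤ => F (2 * n + 1) * E' (2 * n + 1) :=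
    hFE.comp_injective (i := fun n : ℤ => 2 * n + 1) fun a b h => by simpa using h
  have hsplit : ∑' n, F n * E' n =
      ∑' n : ℤ, F (2 * n) * E' (2 * n) + ∑' n : ℤ, F (2 * n + 1) * E' (2 * n + 1) := by
    exact (hasSum_int_even_add_odd (f := fun n : ℤ => F n * E' n) hev.hasSum hod.hasSum).tsum_eq
  have hs2 : Summable fun n : ℤ => E (2 * n) * oddTail E' n :=
    (summable_oddTail_mul hE' hE).congr fun n => mul_comm _ _
  unfold skewSum
  rw [(summable_oddTail_mul hE hE').tsum_sub hs2, tsum_even_mul_oddTail hE hE', hsplit]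
  simp only [tsum_evenInit_eq_of_telescope hE hF h, h1, neg_mul]
  rw [hev.tsum_sub ((summable_even hE').mul_left l), tsum_mul_left, tsum_neg]
  ring

end QEnsemble

end

/-! ### The arms of the support, indexed by the integers -/

noncomputable section

namespace QEnsemble

open Filter Topology

lemma sqrt_facts {q : ℝ} (hq0 : 0 < q) (hq1 : q < 1) : 0 < √q ∧ √q < 1 ∧ √q * √q = q :=
  ⟨Real.sqrt_pos.2 hq0, by rw [Real.sqrt_lt' one_pos]; simpa using hq1, Real.mul_self_sqrt hq0.le⟩

namespace Support

/-- The end point of the positive (`true`) or negative (`false`) arm of the support. -/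
def base : Support → Bool → ℝ
  | segment a b, s => if s then b else a
  | halfLine, s => if s then 1 else 0

/-- Whether the support is a segment. -/
def Bounded : Support → Prop
  | segment _ _ => True
  | halfLine => False

lemma bounded_segment (a b : ℝ) : (segment a b).Bounded := trivial

lemma not_bounded_halfLine : ¬ halfLine.Bounded := id

/-- The indices of the lattice points on an arm. -/
def On (D : Support) (s : Bool) (n : ℤ) : Prop := D.base s ≠ 0 ∧ (D.Bounded → 0 ≤ n)

/-- The points of an arm. -/
def pt (D : Support) (r : ℝ) (s : Bool) (n : ℤ) : ℝ := D.base s * r ^ n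

/-- The end points lie on the proper sides of the origin. -/
def Valid : Support → Prop
  | segment a b => a ≤ 0 ∧ 0 < b
  | halfLine => True

open Classical in
/-- The terms of the (signed) Jackson integral over an arm. -/
def arm (D : Support) (r : ℝ) (s : Bool) (w : ℝ → ℝ) (n : ℤ) : ℝ :=
  if D.On s n then (1 - r) * (D.pt r s n * w (D.pt r s n)) else 0

variable {D : Support} {r q : ℝ} {s : Bool} {n : ℤ}

lemma On.mono {m : ℤ} (h : D.On s n) (hnm : n ≤ m) : D.On s m :=
  ⟨h.1, fun hb => (h.2 hb).trans hnm⟩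

lemma arm_of_on (h : D.On s n) (w : ℝ → ℝ) :
    D.arm r s w n = (1 - r) * (D.pt r s n * w (D.pt r s n)) := if_pos h

lemma arm_of_not_on (h : ¬ D.On s n) (w : ℝ → ℝ) : D.arm r s w n = 0 := if_neg h

lemma arm_add (w w' : ℝ → ℝ) (n : ℤ) :
    D.arm r s (fun x => w x + w' x) n = D.arm r s w n + D.arm r s w' n := by
  by_cases h : D.On s n
  · simp only [arm_of_on h]; ring
  · simp [arm_of_not_on h]

lemma arm_smul (c : ℝ) (w : ℝ → ℝ) (n : ℤ) :
    D.arm r s (fun x => c * w x) n = c * D.arm r s w n := by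
  by_cases h : D.On s n
  · simp only [arm_of_on h]; ring
  · simp [arm_of_not_on h]

lemma arm_congr {w w' : ℝ → ℝ} (h : D.On s n → w (D.pt r s n) = w' (D.pt r s n)) :
    D.arm r s w n = D.arm r s w' n := by
  by_cases hn : D.On s n
  · simp only [arm_of_on hn, h hn]
  · simp [arm_of_not_on hn]

lemma pt_add (hr : r ≠ 0) (n m : ℤ) : D.pt r s (n + m) = D.pt r s n * r ^ m := by
  simp only [pt, zpow_add₀ hr, mul_assoc]

lemma pt_succ (hr : r ≠ 0) (n : ℤ) : D.pt r s (n + 1) = r * D.pt r s n := by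
  rw [pt_add hr]; simp [mul_comm]

lemma segment_pt_natCast (a b r : ℝ) (s : Bool) (n : ℕ) :
    (segment a b).pt r s n = (if s then b else a) * r ^ n := by
  simp [pt, base]

lemma segment_arm_natCast (a b r : ℝ) (s : Bool) (w : ℝ → ℝ) (n : ℕ) :
    (segment a b).arm r s w n = (1 - r) *
      ((if s then b else a) * r ^ n * w ((if s then b else a) * r ^ n)) := by
  by_cases h : (if s then b else a) = 0
  · rw [arm_of_not_on (D := segment a b) fun h' => h'.1 h]; simp [h]
  · rw [arm_of_on (D := segment a b) ⟨h, fun _ => Int.natCast_nonneg n⟩, segment_pt_natCast]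

lemma segment_arm_of_neg (a b r : ℝ) (s : Bool) (w : ℝ → ℝ) {n : ℤ} (hn : n < 0) :
    (segment a b).arm r s w n = 0 :=
  arm_of_not_on (fun h => absurd (h.2 (bounded_segment a b)) (not_le.2 hn)) w

lemma halfLine_arm_true (r : ℝ) (w : ℝ → ℝ) (n : ℤ) :
    halfLine.arm r true w n = (1 - r) * (r ^ n * w (r ^ n)) := by
  have hp : halfLine.pt r true n = r ^ n := by simp [pt, base]
  rw [arm_of_on (D := halfLine) ⟨by simp [base], fun h => (not_bounded_halfLine h).elim⟩, hp]

lemma halfLine_arm_false (r : ℝ) (w : ℝ → ℝ) (n : ℤ) : halfLine.arm r false w n = 0 :=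
  arm_of_not_on (fun h => h.1 (by simp [base])) w

lemma segment_arm_support (a b r : ℝ) (s : Bool) (w : ℝ → ℝ) :
    Function.support ((segment a b).arm r s w) ⊆ Set.range ((↑) : ℕ → ℤ) := by
  intro n hn
  by_contra hcon
  refine hn (segment_arm_of_neg a b r s w ?_)
  by_contra h
  exact hcon ⟨n.toNat, Int.toNat_of_nonneg (not_lt.1 h)⟩

lemma tsum_segment_arm (a b r : ℝ) (s : Bool) (w : ℝ → ℝ) :
    ∑' n, (segment a b).arm r s w n = jackson r (if s then b else a) w := by
  rw [← Function.Injective.tsum_eq Nat.cast_injective (segment_arm_support a b r s w), jackson,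
    ← tsum_mul_left]
  exact tsum_congr fun n => segment_arm_natCast a b r s w n

lemma integral_eq_arm (D : Support) (r : ℝ) (w : ℝ → ℝ) :
    D.integral r w = ∑' n, D.arm r true w n - ∑' n, D.arm r false w n := by
  cases D with
  | segment a b => simp [integral, tsum_segment_arm]
  | halfLine =>
    simp [integral, halfLine_arm_true, halfLine_arm_false, tsum_mul_left]

lemma Integrable.summable_arm {w : ℝ → ℝ} (h : D.Integrable r w) (s : Bool) :
    Summable (D.arm r s w) := by
  cases D with
  | segment a b =>
    rw [← Function.Injective.summable_iff (g := ((↑) : ℕ → ℤ)) Nat.cast_injective]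
    · cases s
      · exact (h.2.mul_left (1 - r)).congr fun n => by simp [segment_arm_natCast]
      · exact (h.1.mul_left (1 - r)).congr fun n => by simp [segment_arm_natCast]
    · intro n hn
      by_contra h'
      exact hn (segment_arm_support a b r s w h')
  | halfLine =>
    cases s
    · exact summable_zero.congr fun n => by simp [halfLine_arm_false]
    · exact (Summable.mul_left (1 - r) h).congr fun n => by simp [halfLine_arm_true]

lemma on_two_mul : (D.On s (2 * n)) ↔ D.On s n := by
  unfold On; constructor <;> rintro ⟨h, h'⟩ <;> exact ⟨h, fun hb => by have := h' hb; omega⟩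

lemma pt_two_mul (hq0 : 0 < q) (n : ℤ) : D.pt √q s (2 * n) = D.pt q s n := by
  rw [pt, pt, zpow_mul]
  congr 2
  rw [zpow_ofNat, Real.sq_sqrt hq0.le]

/-- The `q`-lattice is the set of even indices of the `√q`-lattice, and `1 - q = (1 + √q)(1 - √q)`.
Each Jackson integral with base `q` thus contributes one factor `1 + √q`; the double integral gives
the `(1 + √q)²` in the skew kernel. -/
lemma arm_sq (hq0 : 0 < q) (w : ℝ → ℝ) (n : ℤ) :
    D.arm q s w n = (1 + √q) * D.arm √q s w (2 * n) := by
  by_cases h : D.On s n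
  · rw [arm_of_on h, arm_of_on (on_two_mul.2 h), pt_two_mul hq0]
    have : 1 - q = (1 + √q) * (1 - √q) := by ring_nf; rw [Real.sq_sqrt hq0.le]
    rw [this]; ring
  · rw [arm_of_not_on h, arm_of_not_on (mt on_two_mul.1 h), mul_zero]

lemma integral_sq (hq0 : 0 < q) (D : Support) (w : ℝ → ℝ) :
    D.integral q w = (1 + √q) *
      (∑' n : ℤ, D.arm √q true w (2 * n) - ∑' n : ℤ, D.arm √q false w (2 * n)) := by
  rw [integral_eq_arm, mul_sub, ← tsum_mul_left, ← tsum_mul_left]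
  simp only [arm_sq hq0]

/-- The upper limit `√q y` sits at the next, odd index, and a factor `q` moves by two indices, so
the integral runs over an odd tail. -/
lemma jackson_pt (hq0 : 0 < q) (w : ℝ → ℝ) (h : D.On s (2 * n)) :
    jackson q (√q * D.pt √q s (2 * n)) w =
      (1 + √q) * oddTail (D.arm √q s w) n := by
  have hr : √q ≠ 0 := (Real.sqrt_pos.2 hq0).ne'
  rw [jackson, oddTail, ← tsum_mul_left, ← tsum_mul_left]
  refine tsum_congr fun k => ?_
  have e : √q * D.pt √q s (2 * n) * q ^ k = D.pt √q s (2 * n + 2 * k + 1) := by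
    rw [pt_succ hr, pt_add hr, mul_assoc]
    congr 2
    rw [zpow_mul, zpow_ofNat, Real.sq_sqrt hq0.le, zpow_natCast]
  rw [arm_of_on (h.mono (by omega)), e]
  have : 1 - q = (1 + √q) * (1 - √q) := by ring_nf; rw [Real.sq_sqrt hq0.le]
  rw [this]; ring

lemma integralTo_pt (hq0 : 0 < q) (w : ℝ → ℝ) (h : D.On s (2 * n)) :
    D.integralTo q (√q * D.pt √q s (2 * n)) w =
      (1 + √q) * (oddTail (D.arm √q s w) n - ∑' j : ℤ, D.arm √q false w (2 * j)) := by
  cases D with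
  | segment a b =>
    rw [integralTo, jackson_pt hq0 w h]
    have := tsum_segment_arm a b q false w
    simp only [arm_sq hq0, tsum_mul_left] at this
    simp only [Bool.false_eq_true, if_false] at this
    rw [← this]; ring
  | halfLine =>
    rw [integralTo, jackson_pt hq0 w h]
    simp [halfLine_arm_false]

lemma base_pos (hv : D.Valid) : 0 < D.base true := by
  cases D with
  | segment a b => exact hv.2
  | halfLine => exact one_pos

lemma base_false_nonpos (hv : D.Valid) : D.base false ≤ 0 := by
  cases D with
  | segment a b => exact hv.1
  | halfLine => exact le_refl _

lemma pt_true_pos (hv : D.Valid) (hr : 0 < r) (n : ℤ) : 0 < D.pt r true n :=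
  mul_pos (base_pos hv) (zpow_pos hr n)

lemma pt_false_neg (hv : D.Valid) (hr : 0 < r) (h : D.On false n) : D.pt r false n < 0 :=
  mul_neg_of_neg_of_pos (lt_of_le_of_ne (base_false_nonpos hv) h.1) (zpow_pos hr n)

lemma pt_ne_zero (hr : 0 < r) (h : D.On s n) : D.pt r s n ≠ 0 :=
  mul_ne_zero h.1 (zpow_pos hr n).ne'

/-- The sign of a point determines its arm, and powers of `r` are injective along an arm. Parity of
the index is therefore well defined on lattice points. -/
lemma pt_inj (hv : D.Valid) (hr : 0 < r) (hr1 : r < 1) {s' : Bool} {m : ℤ} (h : D.On s n)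
    (h' : D.On s' m) (e : D.pt r s n = D.pt r s' m) : s = s' ∧ n = m := by
  have hs : s = s' := by
    cases s <;> cases s'
    · rfl
    · exact absurd e ((pt_false_neg hv hr h).trans (pt_true_pos hv hr m)).ne
    · exact absurd e ((pt_false_neg hv hr h').trans (pt_true_pos hv hr n)).ne'
    · rfl
  subst hs
  exact ⟨rfl, zpow_right_injective₀ hr hr1.ne (mul_left_cancel₀ h.1 e)⟩

lemma mem_integerLattice (hq0 : 0 < q) (x : ℝ) :
    x ∈ D.integerLattice q ↔ ∃ s n, D.On s (2 * n) ∧ x = D.pt √q s (2 * n) := by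
  simp only [pt_two_mul hq0, on_two_mul]
  cases D with
  | segment a b =>
    constructor
    · rintro ⟨h0, n, h | h⟩
      · refine ⟨false, n, ⟨?_, fun _ => by positivity⟩, by simpa [pt, base] using h⟩
        rintro h'; apply h0; rw [h]; simp only [base, Bool.false_eq_true, if_false] at h'; simp [h']
      · refine ⟨true, n, ⟨?_, fun _ => by positivity⟩, by simpa [pt, base] using h⟩
        rintro h'; apply h0; rw [h]; simp only [base, if_true] at h'; simp [h']
    · rintro ⟨s, n, hon, rfl⟩
      refine ⟨pt_ne_zero hq0 hon, ?_⟩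
      lift n to ℕ using hon.2 trivial
      rw [segment_pt_natCast]
      cases s
      · exact ⟨n, Or.inl (by simp)⟩
      · exact ⟨n, Or.inr (by simp)⟩
  | halfLine =>
    constructor
    · rintro ⟨n, rfl⟩
      exact ⟨true, n, ⟨by simp [base], fun h => h.elim⟩, by simp [pt, base]⟩
    · rintro ⟨s, n, hon, rfl⟩
      cases s
      · exact absurd rfl hon.1
      · exact ⟨n, by simp [pt, base]⟩

lemma mem_halfIntegerLattice (hq0 : 0 < q) (x : ℝ) :
    x ∈ D.halfIntegerLattice q ↔ ∃ s n, D.On s (2 * n) ∧ x = D.pt √q s (2 * n + 1) := by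
  have hr : √q ≠ 0 := (Real.sqrt_pos.2 hq0).ne'
  constructor
  · rintro ⟨z, hz, rfl⟩
    obtain ⟨s, n, h, rfl⟩ := (mem_integerLattice hq0 z).1 hz
    exact ⟨s, n, h, (pt_succ hr _).symm⟩
  · rintro ⟨s, n, h, rfl⟩
    exact ⟨_, (mem_integerLattice hq0 _).2 ⟨s, n, h, rfl⟩, pt_succ hr _⟩

lemma mem_lattice (hq0 : 0 < q) (x : ℝ) :
    x ∈ D.lattice q ↔ ∃ s n, D.On s n ∧ x = D.pt √q s n := by
  rw [lattice, Set.mem_union, mem_integerLattice hq0, mem_halfIntegerLattice hq0]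
  constructor
  · rintro (⟨s, n, h, rfl⟩ | ⟨s, n, h, rfl⟩)
    · exact ⟨s, _, h, rfl⟩
    · exact ⟨s, _, h.mono (by omega), rfl⟩
  · rintro ⟨s, n, h, rfl⟩
    obtain ⟨k, rfl | rfl⟩ := Int.even_or_odd' n
    · exact Or.inl ⟨s, k, h, rfl⟩
    · exact Or.inr ⟨s, k, ⟨h.1, fun hb => by have := h.2 hb; omega⟩, rfl⟩

lemma pt_mem_lattice (hq0 : 0 < q) (h : D.On s n) : D.pt √q s n ∈ D.lattice q :=
  (mem_lattice hq0 _).2 ⟨s, n, h, rfl⟩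

lemma pt_mem_integerLattice (hq0 : 0 < q) (hq1 : q < 1) (hv : D.Valid) (h : D.On s n) :
    D.pt √q s n ∈ D.integerLattice q ↔ Even n := by
  obtain ⟨hr0, hr1, -⟩ := sqrt_facts hq0 hq1
  rw [mem_integerLattice hq0]
  constructor
  · rintro ⟨s', m, h', e⟩
    rw [(pt_inj hv hr0 hr1 h h' e).2]; exact even_two_mul m
  · intro he
    obtain ⟨k, rfl⟩ := he.two_dvd
    exact ⟨s, k, h, rfl⟩

lemma pt_mem_halfIntegerLattice (hq0 : 0 < q) (hq1 : q < 1) (hv : D.Valid) (h : D.On s n) :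
    D.pt √q s n ∈ D.halfIntegerLattice q ↔ Odd n := by
  obtain ⟨hr0, hr1, -⟩ := sqrt_facts hq0 hq1
  rw [mem_halfIntegerLattice hq0]
  constructor
  · rintro ⟨s', m, h', e⟩
    rw [(pt_inj hv hr0 hr1 h (h'.mono (by omega)) e).2]; exact odd_two_mul_add_one m
  · rintro ⟨k, rfl⟩
    exact ⟨s, k, ⟨h.1, fun hb => by have := h.2 hb; omega⟩, rfl⟩

open Classical in
/-- The skew kernel on one arm, as a function of the indices, up to the orientation. -/
def linkSame (m k : ℤ) : ℝ :=
  if Odd m ∧ Even k ∧ k < m then 1 else if Even m ∧ Odd k ∧ m < k then -1 else 0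

open Classical in
/-- The skew kernel across the origin. -/
def linkCross (m k : ℤ) : ℝ := if Even m ∧ Even k then 1 else 0

/-- The orientation of an arm. -/
def orient (s : Bool) : ℝ := if s then 1 else -1

lemma abs_pt_lt_iff (hr : 0 < r) (hr1 : r < 1) (h : D.base s ≠ 0) (m k : ℤ) :
    |D.pt r s m| < |D.pt r s k| ↔ k < m := by
  rw [pt, pt, abs_mul, abs_mul, mul_lt_mul_iff_of_pos_left (abs_pos.2 h),
    abs_of_pos (zpow_pos hr _), abs_of_pos (zpow_pos hr _)]
  exact zpow_lt_zpow_iff_right_of_lt_one₀ hr hr1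

lemma pt_mul_pos (hr : 0 < r) (h : D.base s ≠ 0) (m k : ℤ) : 0 < D.pt r s m * D.pt r s k := by
  rw [pt, pt, mul_mul_mul_comm]
  exact mul_pos (mul_self_pos.2 h) (mul_pos (zpow_pos hr _) (zpow_pos hr _))

/-- Indices increase towards the origin, so `x < y` reverses the order of the indices on the
positive arm and keeps it on the negative one. The factor `orient s` records this. -/
lemma skewKernel_same (hq0 : 0 < q) (hq1 : q < 1) (hv : D.Valid) {m k : ℤ} (hm : D.On s m)
    (hk : D.On s k) : D.skewKernel q (D.pt √q s m) (D.pt √q s k) =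
      (1 + √q) ^ 2 * (orient s * linkSame m k) := by
  obtain ⟨hr0, hr1, -⟩ := sqrt_facts hq0 hq1
  have hpos := pt_mul_pos (D := D) hr0 hm.1 m k
  have hL : D.Linked q (D.pt √q s m) (D.pt √q s k) ↔
      (Odd m ∧ Even k ∧ k < m) ∨ (Even m ∧ Odd k ∧ m < k) := by
    unfold Linked
    rw [pt_mem_integerLattice hq0 hq1 hv hm, pt_mem_integerLattice hq0 hq1 hv hk,
      pt_mem_halfIntegerLattice hq0 hq1 hv hm, pt_mem_halfIntegerLattice hq0 hq1 hv hk,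
      abs_pt_lt_iff hr0 hr1 hm.1, abs_pt_lt_iff hr0 hr1 hm.1]
    simp only [hpos, true_and, not_lt.2 hpos.le, false_and, or_false]
  have hlt : D.pt √q s m < D.pt √q s k ↔ (if s then k < m else m < k) := by
    have h1 := abs_pt_lt_iff (D := D) (s := s) hr0 hr1 hm.1 m k
    have h2 := abs_pt_lt_iff (D := D) (s := s) hr0 hr1 hm.1 k m
    cases s
    · rw [abs_of_neg (pt_false_neg hv hr0 hm), abs_of_neg (pt_false_neg hv hr0 hk)] at h1 h2
      simp only [Bool.false_eq_true, if_false]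
      rw [← h2]; exact neg_lt_neg_iff.symm
    · rw [abs_of_pos (pt_true_pos hv hr0 m), abs_of_pos (pt_true_pos hv hr0 k)] at h1
      simpa using h1
  unfold skewKernel linkSame
  simp only [hL, hlt, orient]
  by_cases h1 : Odd m ∧ Even k ∧ k < m
  · have : ¬ m < k := not_lt.2 h1.2.2.le
    cases s <;> simp [h1, this]
  · by_cases h2 : Even m ∧ Odd k ∧ m < k
    · have : ¬ k < m := not_lt.2 h2.2.2.le
      cases s <;> simp [h2, this]
    · simp only [h1, h2, or_self, if_false, mul_zero]

/-- Across the origin the sign of `y - x` depends only on the arm that contains `y`. -/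
lemma skewKernel_cross (hq0 : 0 < q) (hq1 : q < 1) (hv : D.Valid) {m k : ℤ} (hm : D.On (!s) m)
    (hk : D.On s k) : D.skewKernel q (D.pt √q (!s) m) (D.pt √q s k) =
      (1 + √q) ^ 2 * (orient s * linkCross m k) := by
  obtain ⟨hr0, hr1, -⟩ := sqrt_facts hq0 hq1
  have hneg : D.pt √q (!s) m * D.pt √q s k < 0 := by
    cases s
    · exact mul_neg_of_pos_of_neg (pt_true_pos hv hr0 m) (pt_false_neg hv hr0 hk)
    · exact mul_neg_of_neg_of_pos (pt_false_neg hv hr0 hm) (pt_true_pos hv hr0 k)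
  have hL : D.Linked q (D.pt √q (!s) m) (D.pt √q s k) ↔ (Even m ∧ Even k) := by
    unfold Linked
    rw [pt_mem_integerLattice hq0 hq1 hv hm, pt_mem_integerLattice hq0 hq1 hv hk]
    simp only [hneg, true_and, not_lt.2 hneg.le, false_and, false_or]
  have hlt : D.pt √q (!s) m < D.pt √q s k ↔ s = true := by
    cases s
    · simpa using ((pt_false_neg hv hr0 hk).trans (pt_true_pos hv hr0 m)).le
    · simpa using (pt_false_neg hv hr0 hm).trans (pt_true_pos hv hr0 k)
  unfold skewKernel linkCross
  simp only [hL, hlt, orient]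
  by_cases h : Even m ∧ Even k
  · simp only [h]; norm_num
  · simp only [h, if_false, mul_zero]

end Support

/-! ### The operator `s_x` and the skew inner product as sums over the two arms -/

open Support

namespace Weight

variable {W : Weight} {q : ℝ}

/-- The operator `s_x` at a lattice point, in terms of sums over the two arms. -/
lemma opS_pt (hq0 : 0 < q) (hq1 : q < 1) (hv : W.supp.Valid) {s : Bool} {k : ℤ}
    (hk : W.supp.On s k) (φ : ℝ → ℝ) :
    W.opS q φ (W.supp.pt √q s k) = (1 + √q) ^ 2 *
      (∑' m, linkSame m k * W.supp.arm √q s (fun x => φ x * W.ω x) m -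
        ∑' m, linkCross m k * W.supp.arm √q (!s) (fun x => φ x * W.ω x) m) := by
  have h1 : ∀ m, W.supp.arm √q s
      (fun z => W.supp.skewKernel q z (W.supp.pt √q s k) * φ z * W.ω z) m =
      (1 + √q) ^ 2 * orient s *
        (linkSame m k * W.supp.arm √q s (fun x => φ x * W.ω x) m) := by
    intro m
    by_cases h : W.supp.On s m
    · simp only [arm_of_on h, skewKernel_same hq0 hq1 hv h hk]; ring
    · simp only [arm_of_not_on h, mul_zero]
  have h2 : ∀ m, W.supp.arm √q (!s)
      (fun z => W.supp.skewKernel q z (W.supp.pt √q s k) * φ z * W.ω z) m =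
      (1 + √q) ^ 2 * orient s *
        (linkCross m k * W.supp.arm √q (!s) (fun x => φ x * W.ω x) m) := by
    intro m
    by_cases h : W.supp.On (!s) m
    · simp only [arm_of_on h, skewKernel_cross hq0 hq1 hv h hk]; ring
    · simp only [arm_of_not_on h, mul_zero]
  rw [opS, integral_eq_arm]
  cases s
  · simp only [Bool.not_false] at h2 ⊢
    simp only [h1, h2, tsum_mul_left, orient]
    simp only [Bool.false_eq_true, if_false]; ring
  · simp only [Bool.not_true] at h2 ⊢
    simp only [h1, h2, tsum_mul_left, orient]
    simp only [if_true]; ring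

/-- The skew inner product in terms of sums over the two arms. -/
lemma inner1_eq (hq0 : 0 < q) (φ ψ : ℝ → ℝ)
    (hφ : ∀ s, Summable (W.supp.arm √q s fun x => φ x * W.ω x))
    (hψ : ∀ s, Summable (W.supp.arm √q s fun x => ψ x * W.ω x)) :
    W.inner1 q φ ψ = (1 + √q) ^ 2 *
      (skewSum (W.supp.arm √q true fun x => φ x * W.ω x) (W.supp.arm √q true fun x => ψ x * W.ω x) -
       skewSum (W.supp.arm √q false fun x => φ x * W.ω x)
        (W.supp.arm √q false fun x => ψ x * W.ω x) -
       ((∑' n : ℤ, W.supp.arm √q false (fun x => φ x * W.ω x) (2 * n)) *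
          (∑' n : ℤ, W.supp.arm √q true (fun x => ψ x * W.ω x) (2 * n)) -
        (∑' n : ℤ, W.supp.arm √q true (fun x => φ x * W.ω x) (2 * n)) *
          (∑' n : ℤ, W.supp.arm √q false (fun x => ψ x * W.ω x) (2 * n)))) := by
  set E : Bool → ℤ → ℝ := fun s => W.supp.arm √q s fun x => φ x * W.ω x with hE
  set E' : Bool → ℤ → ℝ := fun s => W.supp.arm √q s fun x => ψ x * W.ω x with hE'
  -- For fixed `y` the inner integrand is a linear combination of the two sequences `E` and `E'`.
  have harm : ∀ (s : Bool) (y : ℝ) (m : ℤ),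
      W.supp.arm √q s (fun x => (φ x * ψ y - φ y * ψ x) * W.ω x * W.ω y) m =
      ψ y * W.ω y * E s m + -(φ y * W.ω y) * E' s m := by
    intro s y m
    simp only [hE, hE', ← arm_smul, ← arm_add]
    refine arm_congr fun _ => ?_
    ring
  -- The integral from the left end to `√q y` is the odd tail on the arm of `y` minus the whole even
  -- sum on the negative arm. The odd tails build the two skew sums; the even sums leave only the
  -- cross term, since for `s = false` their contributions cancel.
  have hinner : ∀ (s : Bool) (n : ℤ), W.supp.arm √q s (fun y =>
      W.supp.integralTo q (√q * y) fun x => (φ x * ψ y - φ y * ψ x) * W.ω x * W.ω y) (2 * n) =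
      (1 + √q) * ((oddTail (E s) n * E' s (2 * n) - E s (2 * n) * oddTail (E' s) n) -
        ((∑' n : ℤ, E false (2 * n)) * E' s (2 * n) -
          (∑' n : ℤ, E' false (2 * n)) * E s (2 * n))) := by
    intro s n
    by_cases h : W.supp.On s (2 * n)
    · rw [arm_of_on h, integralTo_pt hq0 _ h]
      set y := W.supp.pt √q s (2 * n)
      have e1 : (W.supp.arm √q s fun x => (φ x * ψ y - φ y * ψ x) * W.ω x * W.ω y) =
          fun m => ψ y * W.ω y * E s m + -(φ y * W.ω y) * E' s m := funext (harm s y)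
      have e2 : (fun j : ℤ => W.supp.arm √q false
          (fun x => (φ x * ψ y - φ y * ψ x) * W.ω x * W.ω y) (2 * j)) =
          fun j : ℤ => ψ y * W.ω y * E false (2 * j) + -(φ y * W.ω y) * E' false (2 * j) :=
        funext fun j => harm false y _
      rw [e1, e2, oddTail_add ((hφ s).mul_left _) ((hψ s).mul_left _), oddTail_smul, oddTail_smul,
        ((summable_even (hφ false)).mul_left _).tsum_add ((summable_even (hψ false)).mul_left _),
        tsum_mul_left, tsum_mul_left]
      have e3 : E s (2 * n) = (1 - √q) * (y * (φ y * W.ω y)) := arm_of_on h _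
      have e4 : E' s (2 * n) = (1 - √q) * (y * (ψ y * W.ω y)) := arm_of_on h _
      rw [e3, e4]; ring
    · have e3 : E s (2 * n) = 0 := arm_of_not_on h _
      have e4 : E' s (2 * n) = 0 := arm_of_not_on h _
      rw [arm_of_not_on h, e3, e4]; ring
  have hsum : ∀ s, ∑' n : ℤ, W.supp.arm √q s (fun y =>
      W.supp.integralTo q (√q * y) fun x => (φ x * ψ y - φ y * ψ x) * W.ω x * W.ω y) (2 * n) =
      (1 + √q) * (skewSum (E s) (E' s) -
        ((∑' n : ℤ, E false (2 * n)) * (∑' n : ℤ, E' s (2 * n)) -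
          (∑' n : ℤ, E' false (2 * n)) * (∑' n : ℤ, E s (2 * n)))) := by
    intro s
    have s1 := (summable_oddTail_mul (hφ s) (hψ s)).sub
      ((summable_oddTail_mul (hψ s) (hφ s)).congr fun n => mul_comm _ _)
    have s2 := (summable_even (hψ s)).mul_left (∑' n : ℤ, E false (2 * n))
    have s3 := (summable_even (hφ s)).mul_left (∑' n : ℤ, E' false (2 * n))
    simp only [hinner]
    rw [tsum_mul_left, Summable.tsum_sub s1 (s2.sub s3), Summable.tsum_sub s2 s3, tsum_mul_left,
      tsum_mul_left, skewSum]
  rw [inner1, integral_sq hq0, hsum, hsum]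
  ring

end Weight

end QEnsemble

end

noncomputable section

namespace QEnsemble

open Filter Topology Polynomial

/-! ### Difference operators on polynomials -/

/-- The dilation `p(x) ↦ p(c x)`. -/
def dil (c : ℝ) : ℝ[X] →ₐ[ℝ] ℝ[X] := aeval (C c * X)

lemma dil_eq_comp (c : ℝ) (p : ℝ[X]) : dil c p = p.comp (C c * X) := by
  rw [dil, comp_eq_aeval]

@[simp] lemma eval_dil (c x : ℝ) (p : ℝ[X]) : (dil c p).eval x = p.eval (c * x) := by
  simp [dil_eq_comp]

@[simp] lemma coeff_dil (c : ℝ) (p : ℝ[X]) (n : ℕ) : (dil c p).coeff n = p.coeff n * c ^ n := by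
  rw [dil_eq_comp, comp_C_mul_X_coeff]

lemma natDegree_dil_le (c : ℝ) (p : ℝ[X]) : (dil c p).natDegree ≤ p.natDegree := by
  rw [natDegree_le_iff_coeff_eq_zero]
  intro N hN
  rw [coeff_dil, coeff_eq_zero_of_natDegree_lt hN, zero_mul]

lemma dil_dil_inv {c : ℝ} (hc : c ≠ 0) (p : ℝ[X]) : dil c (dil c⁻¹ p) = p := by
  ext n
  rw [coeff_dil, coeff_dil, mul_assoc, ← mul_pow, inv_mul_cancel₀ hc, one_pow, mul_one]

lemma dil_inv_dil {c : ℝ} (hc : c ≠ 0) (p : ℝ[X]) : dil c⁻¹ (dil c p) = p := by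
  ext n
  rw [coeff_dil, coeff_dil, mul_assoc, ← mul_pow, mul_inv_cancel₀ hc, one_pow, mul_one]

/-- Division by `X`, as a linear map. -/
def divXLin : ℝ[X] →ₗ[ℝ] ℝ[X] where
  toFun := divX
  map_add' := fun _ _ => divX_add
  map_smul' := fun c p => by simp [smul_eq_C_mul, divX_C_mul]

@[simp] lemma coeff_divXLin (p : ℝ[X]) (n : ℕ) : (divXLin p).coeff n = p.coeff (n + 1) :=
  coeff_divX

lemma X_mul_divXLin {p : ℝ[X]} (h : p.coeff 0 = 0) : X * divXLin p = p := by
  have := X_mul_divX_add p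
  rw [h, C_0, add_zero] at this
  exact this

lemma mul_eval_divXLin {p : ℝ[X]} (h : p.coeff 0 = 0) (x : ℝ) :
    x * (divXLin p).eval x = p.eval x := by
  conv_rhs => rw [← X_mul_divXLin h]
  simp

/-- The coefficient `f - (1 - r) x g` of the Pearson equation. -/
def pearsonShift (f g : ℝ[X]) (r : ℝ) : ℝ[X] := f - C (1 - r) * X * g

/-- The operator `p ↦ (f(x) p(x/r) - (f - (1-r) x g)(x) p(r x)) / ((1 - r) x)`. -/
def symPearson (f g : ℝ[X]) (r : ℝ) : ℝ[X] →ₗ[ℝ] ℝ[X] :=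
  (1 - r)⁻¹ • divXLin ∘ₗ (LinearMap.mulLeft ℝ f ∘ₗ (dil r⁻¹).toLinearMap -
    LinearMap.mulLeft ℝ (pearsonShift f g r) ∘ₗ (dil r).toLinearMap)

/-- The operator `p ↦ (f(x) p(x) - (f - (1-r) x g)(x) p(r x)) / ((1 - r) x)`. -/
def pearsonOp (f g : ℝ[X]) (r : ℝ) : ℝ[X] →ₗ[ℝ] ℝ[X] :=
  (1 - r)⁻¹ • divXLin ∘ₗ (LinearMap.mulLeft ℝ f -
    LinearMap.mulLeft ℝ (pearsonShift f g r) ∘ₗ (dil r).toLinearMap)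

/-- The difference operator `p ↦ (p(x) - p(r x)) / x`. -/
def diffOp (r : ℝ) : ℝ[X] →ₗ[ℝ] ℝ[X] := divXLin ∘ₗ (LinearMap.id - (dil r).toLinearMap)

variable {f g : ℝ[X]} {r : ℝ}

lemma symPearson_apply (p : ℝ[X]) : symPearson f g r p =
    (1 - r)⁻¹ • divXLin (f * dil r⁻¹ p - pearsonShift f g r * dil r p) := rfl

lemma pearsonOp_apply (p : ℝ[X]) : pearsonOp f g r p =
    (1 - r)⁻¹ • divXLin (f * p - pearsonShift f g r * dil r p) := rfl

lemma diffOp_apply (p : ℝ[X]) : diffOp r p = divXLin (p - dil r p) := rfl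

lemma pearsonShift_coeff_zero : (pearsonShift f g r).coeff 0 = f.coeff 0 := by
  simp [pearsonShift, mul_assoc]

lemma pearsonShift_coeff_two :
    (pearsonShift f g r).coeff 2 = f.coeff 2 - (1 - r) * g.coeff 1 := by
  rw [pearsonShift, coeff_sub, mul_assoc, coeff_C_mul, coeff_X_mul]

lemma pearsonShift_natDegree_le (hf : f.natDegree ≤ 2) (hg : g.natDegree ≤ 1) :
    (pearsonShift f g r).natDegree ≤ 2 := by
  refine (natDegree_sub_le _ _).trans (max_le hf ?_)
  rw [mul_assoc]
  refine (natDegree_C_mul_le _ _).trans (natDegree_mul_le.trans ?_)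
  have := natDegree_X_le (R := ℝ)
  omega

lemma eval_pearsonShift (x : ℝ) :
    (pearsonShift f g r).eval x = f.eval x - (1 - r) * x * g.eval x := by
  simp [pearsonShift]

lemma eval_symPearson (hr1 : r ≠ 1) (p : ℝ[X]) (x : ℝ) :
    (1 - r) * (x * (symPearson f g r p).eval x) =
      f.eval x * p.eval (r⁻¹ * x) - (pearsonShift f g r).eval x * p.eval (r * x) := by
  have h : 1 - r ≠ 0 := sub_ne_zero.2 hr1.symm
  rw [symPearson_apply, eval_smul, smul_eq_mul, mul_left_comm x, mul_inv_cancel_left₀ h,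
    mul_eval_divXLin]
  · simp
  · simp [mul_coeff_zero, pearsonShift_coeff_zero]

lemma X_mul_diffOp (p : ℝ[X]) : X * diffOp r p = p - dil r p := by
  rw [diffOp_apply, X_mul_divXLin (by simp)]

lemma X_mul_pearsonOp (hr1 : r ≠ 1) (p : ℝ[X]) : X * (C (1 - r) * pearsonOp f g r p) =
    f * p - pearsonShift f g r * dil r p := by
  have h : 1 - r ≠ 0 := sub_ne_zero.2 hr1.symm
  rw [pearsonOp_apply, smul_eq_C_mul, ← mul_assoc (C _), ← C_mul, mul_inv_cancel₀ h, C_1, one_mul,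
    X_mul_divXLin (by simp [mul_coeff_zero, pearsonShift_coeff_zero])]

lemma X_mul_symPearson (hr1 : r ≠ 1) (p : ℝ[X]) : X * (C (1 - r) * symPearson f g r p) =
    f * dil r⁻¹ p - pearsonShift f g r * dil r p := by
  have h : 1 - r ≠ 0 := sub_ne_zero.2 hr1.symm
  rw [symPearson_apply, smul_eq_C_mul, ← mul_assoc (C _), ← C_mul, mul_inv_cancel₀ h, C_1, one_mul,
    X_mul_divXLin (by simp [mul_coeff_zero, pearsonShift_coeff_zero])]

/-- The leading coefficient of `pearsonOp` on `x ^ n`. -/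
def pearsonLead (f g : ℝ[X]) (r : ℝ) (n : ℕ) : ℝ :=
  (f.coeff 2 - (f.coeff 2 - (1 - r) * g.coeff 1) * r ^ n) / (1 - r)

/-- The leading coefficient of `symPearson` on `x ^ n`. -/
def symLead (f g : ℝ[X]) (r : ℝ) (n : ℕ) : ℝ := r⁻¹ ^ n * pearsonLead f g r (2 * n)

lemma natDegree_pearsonOp_le (hf : f.natDegree ≤ 2) (hg : g.natDegree ≤ 1) {p : ℝ[X]} {n : ℕ}
    (hp : p.natDegree ≤ n) : (pearsonOp f g r p).natDegree ≤ n + 1 := by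
  rw [natDegree_le_iff_coeff_eq_zero]
  intro N hN
  have h1 : (f * p).natDegree < N + 1 := natDegree_mul_le.trans_lt (by omega)
  have h2 : (pearsonShift f g r * dil r p).natDegree < N + 1 :=
    natDegree_mul_le.trans_lt (by
      have := pearsonShift_natDegree_le (r := r) hf hg
      have := natDegree_dil_le r p
      omega)
  simp [pearsonOp_apply, coeff_eq_zero_of_natDegree_lt h1, coeff_eq_zero_of_natDegree_lt h2]

lemma natDegree_symPearson_le (hf : f.natDegree ≤ 2) (hg : g.natDegree ≤ 1) {p : ℝ[X]} {n : ℕ}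
    (hp : p.natDegree ≤ n) : (symPearson f g r p).natDegree ≤ n + 1 := by
  rw [natDegree_le_iff_coeff_eq_zero]
  intro N hN
  have h1 : (f * dil r⁻¹ p).natDegree < N + 1 := natDegree_mul_le.trans_lt (by
      have := natDegree_dil_le r⁻¹ p
      omega)
  have h2 : (pearsonShift f g r * dil r p).natDegree < N + 1 :=
    natDegree_mul_le.trans_lt (by
      have := pearsonShift_natDegree_le (r := r) hf hg
      have := natDegree_dil_le r p
      omega)
  simp [symPearson_apply, coeff_eq_zero_of_natDegree_lt h1, coeff_eq_zero_of_natDegree_lt h2]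

lemma coeff_pearsonOp (hf : f.natDegree ≤ 2) (hg : g.natDegree ≤ 1) {p : ℝ[X]} {n : ℕ}
    (hp : p.natDegree ≤ n) :
    (pearsonOp f g r p).coeff (n + 1) = pearsonLead f g r n * p.coeff n := by
  have h1 : (f * p).coeff (n + 1 + 1) = f.coeff 2 * p.coeff n := by
    rw [← coeff_mul_add_eq_of_natDegree_le hf hp]; congr 1; ring
  have h2 : (pearsonShift f g r * dil r p).coeff (n + 1 + 1) =
      (pearsonShift f g r).coeff 2 * (dil r p).coeff n := by
    rw [← coeff_mul_add_eq_of_natDegree_le (pearsonShift_natDegree_le hf hg)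
      ((natDegree_dil_le r p).trans hp)]; congr 1; ring
  rw [pearsonOp_apply, coeff_smul, coeff_divXLin, coeff_sub, h1, h2, pearsonShift_coeff_two,
    coeff_dil, pearsonLead, smul_eq_mul]
  ring

/-- The dilations by `r⁻¹` and `r` act on `x ^ n` by `r ^ (-n)` and `r ^ n`; taking out `r ^ (-n)`
leaves `1` and `r ^ (2 n)`, hence the index `2 * n` in `symLead`. -/
lemma coeff_symPearson (hr0 : r ≠ 0) (hf : f.natDegree ≤ 2) (hg : g.natDegree ≤ 1) {p : ℝ[X]}
    {n : ℕ} (hp : p.natDegree ≤ n) :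
    (symPearson f g r p).coeff (n + 1) = symLead f g r n * p.coeff n := by
  have h1 : (f * dil r⁻¹ p).coeff (n + 1 + 1) = f.coeff 2 * (dil r⁻¹ p).coeff n := by
    rw [← coeff_mul_add_eq_of_natDegree_le hf ((natDegree_dil_le r⁻¹ p).trans hp)]; congr 1; ring
  have h2 : (pearsonShift f g r * dil r p).coeff (n + 1 + 1) =
      (pearsonShift f g r).coeff 2 * (dil r p).coeff n := by
    rw [← coeff_mul_add_eq_of_natDegree_le (pearsonShift_natDegree_le hf hg)
      ((natDegree_dil_le r p).trans hp)]; congr 1; ring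
  rw [symPearson_apply, coeff_smul, coeff_divXLin, coeff_sub, h1, h2, pearsonShift_coeff_two,
    coeff_dil, coeff_dil, symLead, pearsonLead, smul_eq_mul, two_mul, pow_add, inv_pow]
  have : r ^ n ≠ 0 := pow_ne_zero _ hr0
  by_cases h : 1 - r = 0
  · simp [h]
  · field_simp

lemma coeff_diffOp (p : ℝ[X]) (n : ℕ) :
    (diffOp r p).coeff n = (1 - r ^ (n + 1)) * p.coeff (n + 1) := by
  simp [diffOp_apply]; ring

/-! ### A functional annihilating the range of a symmetric Pearson operator -/

/-- The map is diagonal on monomials, with eigenvalues `r⁻¹ ^ n + 1 > 0`. -/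
lemma surjective_dil_add_id (hr0 : 0 < r) (θ : ℝ[X]) : ∃ ψ : ℝ[X], dil r⁻¹ ψ + ψ = θ := by
  induction θ using Polynomial.induction_on' with
  | add p q hp hq =>
    obtain ⟨a, rfl⟩ := hp
    obtain ⟨b, rfl⟩ := hq
    exact ⟨a + b, by rw [map_add]; ring⟩
  | monomial n c =>
    have h : r⁻¹ ^ n + 1 ≠ 0 := by positivity
    refine ⟨monomial n (c / (r⁻¹ ^ n + 1)), ?_⟩
    ext m
    rw [coeff_add, coeff_dil, coeff_monomial, coeff_monomial]
    split_ifs with hm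
    · subst hm; field_simp
    · simp

/-- With `σ = pearsonShift f g r`, the numerator `f (ψ(x/r) + ψ) - σ (ψ + ψ(r x))` splits into `f
ψ(x/r) - σ ψ(r x)` and `(f - σ) ψ`. Skewness of `symPearson` makes the two parts cancel under `u`.
-/
lemma pearsonOp_dil_add (hr0 : r ≠ 0) (hr1 : r ≠ 1) (ψ : ℝ[X]) :
    pearsonOp f g r (dil r⁻¹ ψ + ψ) = symPearson f g r ψ + symPearson f g r 1 * ψ := by
  have h : (C (1 - r) : ℝ[X]) ≠ 0 := by rw [Ne, C_eq_zero]; exact sub_ne_zero.2 hr1.symm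
  apply mul_left_cancel₀ h
  apply mul_left_cancel₀ (X_ne_zero (R := ℝ))
  have e : X * (C (1 - r) * (symPearson f g r ψ + symPearson f g r 1 * ψ)) =
    X * (C (1 - r) * symPearson f g r ψ) + (X * (C (1 - r) * symPearson f g r 1)) * ψ := by ring
  rw [e, X_mul_pearsonOp hr1, X_mul_symPearson hr1, X_mul_symPearson hr1, map_add,
    dil_dil_inv hr0, map_one, map_one]
  ring

/-- If `symPearson` is skew for the pairing `u (φ ψ)` then `u` annihilates the range of
`pearsonOp`. -/
lemma pearsonOp_annihilated (hr0 : 0 < r) (hr1 : r ≠ 1) {u : ℝ[X] →ₗ[ℝ] ℝ}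
    (hu : ∀ φ ψ, u (φ * symPearson f g r ψ) = -u (symPearson f g r φ * ψ)) (θ : ℝ[X]) :
    u (pearsonOp f g r θ) = 0 := by
  obtain ⟨ψ, rfl⟩ := surjective_dil_add_id hr0 θ
  rw [pearsonOp_dil_add hr0.ne' hr1, map_add, ← one_mul (symPearson f g r ψ), hu]
  ring

/-- A Leibniz rule: adding and subtracting `σ θ(r x) χ(x)`, with `σ = pearsonShift f g r`, leaves
the difference of `χ` multiplied by the shifted coefficient. -/
lemma pearsonOp_mul (hr1 : r ≠ 1) (θ χ : ℝ[X]) :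
    C (1 - r) * pearsonOp f g r (θ * χ) =
      C (1 - r) * (pearsonOp f g r θ * χ) + pearsonShift f g r * dil r θ * diffOp r χ := by
  apply mul_left_cancel₀ (X_ne_zero (R := ℝ))
  rw [X_mul_pearsonOp hr1, mul_add, mul_left_comm X (_ * _) (diffOp _ _), X_mul_diffOp, map_mul]
  have : X * (C (1 - r) * (pearsonOp f g r θ * χ)) =
    (X * (C (1 - r) * pearsonOp f g r θ)) * χ := by ring
  rw [this, X_mul_pearsonOp hr1]
  ring

/-- The other Leibniz rule: since the dilation by `r` undoes the one by `r⁻¹`, the term with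
`pearsonShift` is common to both sides, and the difference falls on the term with `f`. -/
lemma pearsonOp_mul' (hr0 : r ≠ 0) (hr1 : r ≠ 1) (θ χ : ℝ[X]) :
    C (1 - r) * pearsonOp f g r (θ * dil r⁻¹ χ) =
      C (1 - r) * (pearsonOp f g r θ * χ) + f * θ * diffOp r (dil r⁻¹ χ) := by
  apply mul_left_cancel₀ (X_ne_zero (R := ℝ))
  rw [X_mul_pearsonOp hr1, mul_add, mul_left_comm X (_ * _) (diffOp _ _), X_mul_diffOp, map_mul,
    dil_dil_inv hr0]
  have : X * (C (1 - r) * (pearsonOp f g r θ * χ)) =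
    (X * (C (1 - r) * pearsonOp f g r θ)) * χ := by ring
  rw [this, X_mul_pearsonOp hr1]
  ring

/-- `u ((f - (1-r) x g) θ(r x) D χ) = -u (χ T θ)` for a functional with `u ∘ T = 0`. -/
lemma map_pearsonShift_mul (hr1 : r ≠ 1) {u : ℝ[X] →ₗ[ℝ] ℝ}
    (hu : ∀ θ, u (pearsonOp f g r θ) = 0) (θ χ : ℝ[X]) :
    u (pearsonShift f g r * dil r θ * diffOp r χ) = -((1 - r) * u (pearsonOp f g r θ * χ)) := by
  have h := congrArg u (pearsonOp_mul (f := f) (g := g) hr1 θ χ)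
  simp only [← smul_eq_C_mul, map_add, map_smul, hu, smul_eq_mul] at h
  linarith

/-- `u (f θ D (χ(x/r))) = -u (χ T θ)` for a functional with `u ∘ T = 0`. -/
lemma map_pearson_mul (hr0 : r ≠ 0) (hr1 : r ≠ 1) {u : ℝ[X] →ₗ[ℝ] ℝ}
    (hu : ∀ θ, u (pearsonOp f g r θ) = 0) (θ χ : ℝ[X]) :
    u (f * θ * diffOp r (dil r⁻¹ χ)) = -((1 - r) * u (pearsonOp f g r θ * χ)) := by
  have h := congrArg u (pearsonOp_mul' (f := f) (g := g) hr0 hr1 θ χ)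
  simp only [← smul_eq_C_mul, map_add, map_smul, hu, smul_eq_mul] at h
  linarith

/-- Diagonal up to a shift of degree, with the nonzero factors `1 - r ^ (n + 1)`. -/
lemma surjective_diffOp (hr0 : 0 < r) (hr1 : r < 1) (w : ℝ[X]) : ∃ χ, diffOp r χ = w := by
  induction w using Polynomial.induction_on' with
  | add p q hp hq =>
    obtain ⟨a, rfl⟩ := hp
    obtain ⟨b, rfl⟩ := hq
    exact ⟨a + b, map_add _ _ _⟩
  | monomial n c =>
    have h : 1 - r ^ (n + 1) ≠ 0 := sub_ne_zero.2 (pow_lt_one₀ hr0.le hr1 n.succ_ne_zero).ne'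
    refine ⟨monomial (n + 1) (c / (1 - r ^ (n + 1))), ?_⟩
    ext m
    rw [coeff_diffOp, coeff_monomial, coeff_monomial]
    by_cases hm : n = m
    · subst hm; simp; field_simp
    · simp [hm]

/-- For a regular functional, the leading coefficients of the Pearson operator do not vanish. -/
lemma pearsonLead_ne_zero (hr0 : 0 < r) (hr1 : r < 1) (hf : f.natDegree ≤ 2)
    (hg : g.natDegree ≤ 1) (hf0 : f ≠ 0) {u : ℝ[X] →ₗ[ℝ] ℝ}
    (hu : ∀ θ, u (pearsonOp f g r θ) = 0) (h1 : u 1 ≠ 0)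
    (hreg : ∀ P : ℝ[X], P ≠ 0 → ∃ w, u (P * w) ≠ 0) (k : ℕ) : pearsonLead f g r k ≠ 0 := by
  intro hk
  -- If the leading coefficient vanishes at degree `k`, the operator no longer raises the degree
  -- there and becomes an endomorphism of a finite-dimensional space.
  have hmaps : ∀ p ∈ degreeLE ℝ k, pearsonOp f g r p ∈ degreeLE ℝ k := by
    intro p hp
    rw [mem_degreeLE, ← natDegree_le_iff_degree_le] at hp ⊢
    have h2 := natDegree_pearsonOp_le (r := r) hf hg hp
    have h3 := coeff_pearsonOp (r := r) hf hg hp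
    rw [hk, zero_mul] at h3
    rw [natDegree_le_iff_coeff_eq_zero]
    intro N hN
    rcases Nat.lt_or_ge (k + 1) N with h | h
    · exact coeff_eq_zero_of_natDegree_lt (h2.trans_lt h)
    · obtain rfl : N = k + 1 := by omega
      exact h3
  set T := (pearsonOp f g r).restrict hmaps with hT
  have hfin : FiniteDimensional ℝ (degreeLE ℝ (k : WithBot ℕ)) := by
    rw [degreeLE_eq_span_X_pow]
    exact FiniteDimensional.span_finset ℝ _
  -- An injective endomorphism would be onto, and `1` in the range contradicts `u 1 ≠ 0`.
  have hninj : ¬ Function.Injective T := by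
    intro hinj
    obtain ⟨θ, hθ⟩ := LinearMap.surjective_of_injective hinj
      ⟨1, by rw [mem_degreeLE, ← natDegree_le_iff_degree_le]; simp⟩
    have : pearsonOp f g r θ = 1 := congrArg Subtype.val hθ
    exact h1 (by rw [← this, hu])
  rw [← LinearMap.ker_eq_bot, LinearMap.ker_eq_bot'] at hninj
  push Not at hninj
  obtain ⟨θ, hθ, hθ0⟩ := hninj
  have hθ' : pearsonOp f g r θ = 0 := congrArg Subtype.val hθ
  have hθ0' : (θ : ℝ[X]) ≠ 0 := fun h => hθ0 (Subtype.ext h)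
  -- For `θ` in the kernel, `u (f θ w) = 0` for every `w`, because each `w` is the difference of
  -- some `χ'(x/r)` and `map_pearson_mul` then has the factor `pearsonOp θ = 0`. This contradicts
  -- regularity.
  obtain ⟨w, hw⟩ := hreg (f * θ) (mul_ne_zero hf0 hθ0')
  obtain ⟨χ, rfl⟩ := surjective_diffOp hr0 hr1 w
  obtain ⟨χ', rfl⟩ : ∃ χ', dil r⁻¹ χ' = χ := ⟨dil r χ, dil_inv_dil hr0.ne' χ⟩
  apply hw
  rw [map_pearson_mul hr0.ne' hr1.ne hu, hθ', zero_mul, map_zero, mul_zero, neg_zero]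

end QEnsemble

end

/-! ### The functional of `ρ`, the skew form of `ω`, and the telescoping identities -/

noncomputable section

namespace QEnsemble

open Filter Topology Polynomial Support

namespace Support

variable {D : Support} {q : ℝ} {s : Bool}

/-- An even point is linked, on its own arm, to the odd points closer to the origin, and an odd
point to the even points farther away. These are the two kinds of sums that telescope;
`tsum_linkSame_odd` treats the second. -/
lemma tsum_linkSame_even (E : ℤ → ℝ) (j : ℤ) :
    ∑' m, linkSame m (2 * j) * E m = oddTail E j := by
  have hi : Function.Injective fun k : ℕ => 2 * j + 2 * (k : ℤ) + 1 := fun a b h => by simpa using h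
  rw [← hi.tsum_eq]
  · refine tsum_congr fun k => ?_
    have h1 : Odd (2 * j + 2 * (k : ℤ) + 1) := ⟨j + k, by ring⟩
    have h2 : 2 * j < 2 * j + 2 * (k : ℤ) + 1 := by omega
    simp [linkSame, h1, h2]
  · intro m hm
    by_contra hcon
    apply hm
    have h1 : ¬ (Odd m ∧ 2 * j < m) := by
      rintro ⟨⟨a, rfl⟩, h⟩
      exact hcon ⟨(a - j).toNat, by
        have := Int.toNat_of_nonneg (show 0 ≤ a - j by omega)
        simp only [this]; ring⟩
    have h2 : ¬ Odd (2 * j) := Int.not_odd_iff_even.2 (even_two_mul j)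
    simp only [linkSame, even_two_mul, true_and, h1, h2, false_and, and_false, if_false, zero_mul]

lemma tsum_linkSame_odd (E : ℤ → ℝ) (j : ℤ) :
    ∑' m, linkSame m (2 * j + 1) * E m = -∑' k : ℕ, E (2 * (j - k)) := by
  have hi : Function.Injective fun k : ℕ => 2 * (j - (k : ℤ)) := fun a b h => by simpa using h
  have h3 : Odd (2 * j + 1) := odd_two_mul_add_one j
  have h4 : ¬ Even (2 * j + 1) := Int.not_even_iff_odd.2 h3
  rw [← hi.tsum_eq, ← tsum_neg]
  · refine tsum_congr fun k => ?_
    have h1 : Even (2 * (j - (k : ℤ))) := even_two_mul _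
    have h2 : 2 * (j - (k : ℤ)) < 2 * j + 1 := by omega
    simp [linkSame, h2, h4, h3]
  · intro m hm
    by_contra hcon
    apply hm
    have h1 : ¬ (Even m ∧ m < 2 * j + 1) := by
      rintro ⟨he, h⟩
      obtain ⟨a, rfl⟩ := he.two_dvd
      exact hcon ⟨(j - a).toNat, by
        have := Int.toNat_of_nonneg (show 0 ≤ j - a by omega)
        simp only [this]; ring⟩
    simp only [linkSame, h3, h4, true_and, h1, false_and, and_false, if_false, zero_mul]

lemma tsum_linkCross_even (E : ℤ → ℝ) (j : ℤ) :
    ∑' m, linkCross m (2 * j) * E m = ∑' n : ℤ, E (2 * n) := by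
  have hi : Function.Injective fun k : ℤ => 2 * k := fun a b h => by simpa using h
  rw [← hi.tsum_eq]
  · refine tsum_congr fun k => ?_
    simp [linkCross]
  · intro m hm
    by_contra hcon
    apply hm
    have h1 : ¬ Even m := fun he => by
      obtain ⟨a, rfl⟩ := he.two_dvd
      exact hcon ⟨a, rfl⟩
    simp [linkCross, h1]

lemma tsum_linkCross_odd (E : ℤ → ℝ) (j : ℤ) :
    ∑' m, linkCross m (2 * j + 1) * E m = 0 := by
  have h4 : ¬ Even (2 * j + 1) := Int.not_even_iff_odd.2 (odd_two_mul_add_one j)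
  simp only [linkCross, h4, and_false, if_false, zero_mul, tsum_zero]

end Support

namespace Weight

variable {W : Weight} {q : ℝ} {s : Bool} {n : ℤ}

lemma IsClassical.valid (h : W.IsClassical q) : W.supp.Valid := by
  have hb := h.boundary
  unfold BoundaryConditions at hb
  cases hs : W.supp with
  | segment a b => rw [hs] at hb; exact ⟨hb.1, hb.2.1⟩
  | halfLine => trivial

lemma IsClassical.f_base (h : W.IsClassical q) (hb : W.supp.Bounded) (s : Bool) :
    W.f.eval (W.supp.base s) = 0 := by
  have hbc := h.boundary
  unfold BoundaryConditions at hbc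
  cases hs : W.supp with
  | segment a b =>
    rw [hs] at hbc
    cases s
    · exact hbc.2.2.1
    · exact hbc.2.2.2.1
  | halfLine => rw [hs] at hb; exact (not_bounded_halfLine hb).elim

/-- Either `f` vanishes at `0`, or the support has two arms and `ω` has a limit at `0`. -/
lemma IsClassical.zero_alternative (h : W.IsClassical q) : W.f.eval 0 = 0 ∨
    (W.supp.Bounded ∧ W.supp.base false < 0 ∧
      ∃ l, Tendsto W.ω (𝓝[W.supp.lattice q] 0) (𝓝 l)) := by
  have hb := h.boundary
  unfold BoundaryConditions at hb
  cases hs : W.supp with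
  | segment a b =>
    rw [hs] at hb
    rcases hb.1.lt_or_eq with ha | ha
    · exact Or.inr ⟨trivial, ha, hb.2.2.2.2 ha⟩
    · left
      have h0 := hb.2.2.1
      rwa [ha] at h0
  | halfLine => rw [hs] at hb; exact Or.inl hb

lemma summable_arm_poly {v : ℝ → ℝ} {D : Support} {r : ℝ}
    (h : ∀ k : ℕ, D.Integrable r fun x => x ^ k * v x) (p : ℝ[X]) (s : Bool) :
    Summable (D.arm r s fun x => p.eval x * v x) := by
  induction p using Polynomial.induction_on' with
  | add p q hp hq =>
    refine (hp.add hq).congr fun n => ?_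
    rw [← arm_add]
    exact arm_congr fun _ => by rw [eval_add, add_mul]
  | monomial n c =>
    refine (((h n).summable_arm s).mul_left c).congr fun m => ?_
    rw [← arm_smul]
    exact arm_congr fun _ => by rw [eval_monomial, mul_assoc]

lemma IsClassical.summable_omega (h : W.IsClassical q) (p : ℝ[X]) (s : Bool) :
    Summable (W.supp.arm √q s fun x => p.eval x * W.ω x) := summable_arm_poly h.moments_omega p s

lemma IsClassical.summable_rho (h : W.IsClassical q) (p : ℝ[X]) (s : Bool) :
    Summable (W.supp.arm √q s fun x => p.eval x * W.ρ x) := summable_arm_poly h.moments_rho p s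

/-- The moment functional of `ρ`. -/
def IsClassical.functional (h : W.IsClassical q) : ℝ[X] →ₗ[ℝ] ℝ where
  toFun p := W.supp.integral √q fun x => p.eval x * W.ρ x
  map_add' p p' := by
    have e : ∀ s, ∑' n, W.supp.arm √q s (fun x => (p + p').eval x * W.ρ x) n =
        ∑' n, W.supp.arm √q s (fun x => p.eval x * W.ρ x) n +
          ∑' n, W.supp.arm √q s (fun x => p'.eval x * W.ρ x) n := by
      intro s
      rw [← (h.summable_rho p s).tsum_add (h.summable_rho p' s)]
      refine tsum_congr fun n => ?_
      rw [← arm_add]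
      exact arm_congr fun _ => by rw [eval_add, add_mul]
    simp only [integral_eq_arm, e]; ring
  map_smul' c p := by
    have e : ∀ s, ∑' n, W.supp.arm √q s (fun x => (c • p).eval x * W.ρ x) n =
        c * ∑' n, W.supp.arm √q s (fun x => p.eval x * W.ρ x) n := by
      intro s
      rw [← tsum_mul_left]
      refine tsum_congr fun n => ?_
      rw [← arm_smul]
      exact arm_congr fun _ => by rw [eval_smul, smul_eq_mul, mul_assoc]
    simp only [integral_eq_arm, e, RingHom.id_apply, smul_eq_mul]; ring

lemma IsClassical.functional_apply (h : W.IsClassical q) (p : ℝ[X]) :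
    h.functional p = W.supp.integral √q fun x => p.eval x * W.ρ x := rfl

lemma IsClassical.inner2_eq (h : W.IsClassical q) (φ ψ : ℝ[X]) :
    W.inner2 q (fun x => φ.eval x) (fun x => ψ.eval x) = h.functional (φ * ψ) := by
  simp [inner2, h.functional_apply]

lemma IsClassical.inner1_poly (h : W.IsClassical q) (hq0 : 0 < q) (φ ψ : ℝ[X]) :
    W.inner1 q (fun x => φ.eval x) (fun x => ψ.eval x) = (1 + √q) ^ 2 *
      (skewSum (W.supp.arm √q true fun x => φ.eval x * W.ω x)
        (W.supp.arm √q true fun x => ψ.eval x * W.ω x) -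
       skewSum (W.supp.arm √q false fun x => φ.eval x * W.ω x)
        (W.supp.arm √q false fun x => ψ.eval x * W.ω x) -
       ((∑' n : ℤ, W.supp.arm √q false (fun x => φ.eval x * W.ω x) (2 * n)) *
          (∑' n : ℤ, W.supp.arm √q true (fun x => ψ.eval x * W.ω x) (2 * n)) -
        (∑' n : ℤ, W.supp.arm √q true (fun x => φ.eval x * W.ω x) (2 * n)) *
          (∑' n : ℤ, W.supp.arm √q false (fun x => ψ.eval x * W.ω x) (2 * n)))) :=
  inner1_eq hq0 (fun x => φ.eval x) (fun x => ψ.eval x) (h.summable_omega φ) (h.summable_omega ψ)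

/-- The integrand is antisymmetric, and a sign passes through sums without any convergence
hypothesis, so this holds for arbitrary functions. -/
lemma inner1_swap (W : Weight) (q : ℝ) (φ ψ : ℝ → ℝ) : W.inner1 q φ ψ = -W.inner1 q ψ φ := by
  have e : ∀ y, (fun x => (φ x * ψ y - φ y * ψ x) * W.ω x * W.ω y) =
      fun x => -((ψ x * φ y - ψ y * φ x) * W.ω x * W.ω y) := fun y => by ext x; ring
  have hj : ∀ (r b : ℝ) (w : ℝ → ℝ), jackson r b (fun x => -w x) = -jackson r b w := by
    intro r b w
    simp only [jackson, mul_neg, tsum_neg]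
  unfold inner1
  simp only [e]
  cases W.supp with
  | segment a b =>
    simp only [integralTo, integral, hj, ← neg_sub', ]
  | halfLine =>
    simp only [integralTo, integral, hj, mul_neg, tsum_neg]

/-- The skew inner product as a bilinear form on polynomials. -/
def IsClassical.skewForm (h : W.IsClassical q) (hq0 : 0 < q) : ℝ[X] →ₗ[ℝ] ℝ[X] →ₗ[ℝ] ℝ := by
  have hadd : ∀ φ φ' ψ : ℝ[X], W.inner1 q (fun x => (φ + φ').eval x) (fun x => ψ.eval x) =
      W.inner1 q (fun x => φ.eval x) (fun x => ψ.eval x) +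
      W.inner1 q (fun x => φ'.eval x) (fun x => ψ.eval x) := by
    intro φ φ' ψ
    have e : ∀ s, (W.supp.arm √q s fun x => (φ + φ').eval x * W.ω x) = fun m =>
        W.supp.arm √q s (fun x => φ.eval x * W.ω x) m +
          W.supp.arm √q s (fun x => φ'.eval x * W.ω x) m := by
      intro s; ext m
      rw [← arm_add]
      exact arm_congr fun _ => by rw [eval_add, add_mul]
    rw [h.inner1_poly hq0, h.inner1_poly hq0, h.inner1_poly hq0]
    simp only [e]
    rw [skewSum_add (h.summable_omega _ _) (h.summable_omega _ _) (h.summable_omega _ _),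
      skewSum_add (h.summable_omega _ _) (h.summable_omega _ _) (h.summable_omega _ _),
      (summable_even (h.summable_omega φ _)).tsum_add (summable_even (h.summable_omega φ' _)),
      (summable_even (h.summable_omega φ _)).tsum_add (summable_even (h.summable_omega φ' _))]
    ring
  have hsmul : ∀ (c : ℝ) (φ ψ : ℝ[X]), W.inner1 q (fun x => (c • φ).eval x) (fun x => ψ.eval x) =
      c * W.inner1 q (fun x => φ.eval x) (fun x => ψ.eval x) := by
    intro c φ ψ
    have e : ∀ s, (W.supp.arm √q s fun x => (c • φ).eval x * W.ω x) = fun m =>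
        c * W.supp.arm √q s (fun x => φ.eval x * W.ω x) m := by
      intro s; ext m
      rw [← arm_smul]
      exact arm_congr fun _ => by rw [eval_smul, smul_eq_mul, mul_assoc]
    rw [h.inner1_poly hq0, h.inner1_poly hq0]
    simp only [e]
    rw [skewSum_smul, skewSum_smul, tsum_mul_left, tsum_mul_left]
    ring
  -- Linearity in the second argument follows from linearity in the first by antisymmetry.
  exact LinearMap.mk₂ ℝ (fun φ ψ => W.inner1 q (fun x => φ.eval x) (fun x => ψ.eval x)) hadd hsmul
    (fun φ ψ ψ' => by rw [inner1_swap, hadd, inner1_swap W q _ fun x => φ.eval x,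
      inner1_swap W q (fun x => ψ'.eval x)]; ring)
    (fun c φ ψ => by rw [inner1_swap, hsmul, inner1_swap W q _ fun x => φ.eval x]; simp)

lemma IsClassical.skewForm_apply (h : W.IsClassical q) (hq0 : 0 < q) (φ ψ : ℝ[X]) :
    h.skewForm hq0 φ ψ = W.inner1 q (fun x => φ.eval x) (fun x => ψ.eval x) := rfl

open Classical in
/-- The function `ρ φ / ω` on an arm, extended by `0`. -/
def ratioArm (W : Weight) (q : ℝ) (s : Bool) (φ : ℝ[X]) (n : ℤ) : ℝ :=
  if W.supp.On s n then
    W.ρ (W.supp.pt √q s n) / W.ω (W.supp.pt √q s n) * φ.eval (W.supp.pt √q s n) else 0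

lemma ratioArm_of_on (h : W.supp.On s n) (φ : ℝ[X]) : W.ratioArm q s φ n =
    W.ρ (W.supp.pt √q s n) / W.ω (W.supp.pt √q s n) * φ.eval (W.supp.pt √q s n) := if_pos h

lemma ratioArm_of_not_on (h : ¬ W.supp.On s n) (φ : ℝ[X]) : W.ratioArm q s φ n = 0 := if_neg h

/-- The polynomial form of the operator `𝒜_q`. -/
def opAPoly (W : Weight) (q : ℝ) : ℝ[X] →ₗ[ℝ] ℝ[X] := symPearson W.f W.g √q

/-- Since `q^{-1/2} / (1 - q^{-1/2}) = -1 / (1 - q^{1/2})`, the two terms `f(x) φ(x)` in `𝒜_q`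
cancel. The point `0` is excluded because `qDiff` divides by `x`, whereas the polynomial form has no
singularity. -/
lemma eval_opAPoly (hq0 : 0 < q) (hq1 : q < 1) (φ : ℝ[X]) {x : ℝ} (hx : x ≠ 0) :
    (W.opAPoly q φ).eval x = W.opA q (fun x => φ.eval x) x := by
  obtain ⟨hr0, hr1, -⟩ := sqrt_facts hq0 hq1
  have h := eval_symPearson (f := W.f) (g := W.g) hr1.ne φ x
  have h1 : 1 - √q ≠ 0 := sub_ne_zero.2 hr1.ne'
  have h2 : 1 - (√q)⁻¹ ≠ 0 := by
    rw [sub_ne_zero]; exact (one_lt_inv₀ hr0 |>.2 hr1).ne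
  have h3 : √q - 1 ≠ 0 := sub_ne_zero.2 hr1.ne
  rw [eval_pearsonShift] at h
  have key : (1 - √q) * (x * W.opA q (fun x => φ.eval x) x) =
      W.f.eval x * φ.eval ((√q)⁻¹ * x) -
        (W.f.eval x - (1 - √q) * x * W.g.eval x) * φ.eval (√q * x) := by
    have e : (√q)⁻¹ * ((φ.eval x - φ.eval ((√q)⁻¹ * x)) / ((1 - (√q)⁻¹) * x)) =
        -((φ.eval x - φ.eval ((√q)⁻¹ * x)) / ((1 - √q) * x)) := by
      field_simp
      ring
    simp only [opA, qDiff]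
    rw [mul_right_comm, e]
    field_simp
    ring
  exact mul_left_cancel₀ hx (mul_left_cancel₀ h1 (h.trans key.symm))

lemma IsClassical.ratio_eq (h : W.IsClassical q) {x : ℝ} (hx : x ∈ W.supp.lattice q) :
    W.ρ x / W.ω x = W.ω (√q * x) * W.f.eval (√q * x) := by
  have h1 := h.omega_mul x hx
  have h2 := h.f_ne_zero x hx
  have h3 := h.omega_ne_zero x hx
  field_simp at h1 ⊢
  linarith

/-- The companion of `ratio_eq`: there `ρ/ω` at `x` is read off from the next point, here `ρ/ω` at
the next point is read off from `x`. Together they identify both terms of `(A φ) ω` as neighbouring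
values of `ρ φ / ω`. -/
lemma IsClassical.ratio_shift (h : W.IsClassical q) {x : ℝ} (hx : x ∈ W.supp.lattice q)
    (hx' : √q * x ∈ W.supp.lattice q) :
    W.ρ (√q * x) / W.ω (√q * x) =
      (W.f.eval x - (1 - √q) * x * W.g.eval x) * W.ω x := by
  have h1 := h.omega_mul x hx
  have h2 := h.f_ne_zero x hx
  have h3 := h.omega_ne_zero x hx
  have h4 := h.omega_ne_zero _ hx'
  have h5 := h.pearson x hx
  have h6 := h.rho_ne_zero x hx
  rw [div_eq_div_iff h6 h2] at h5
  rw [eq_div_iff h2] at h1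
  rw [div_eq_iff h4]
  have : W.ρ (√q * x) * W.f.eval (√q * x) * W.ρ x = ((W.f.eval x - (1 - √q) * x * W.g.eval x) *
      (W.ω x * W.ω (√q * x)) * W.f.eval (√q * x)) * W.ρ x := by rw [h5, ← h1]; ring
  have := mul_right_cancel₀ h6 this
  have := mul_right_cancel₀ h2 this
  rw [this]; ring

/-- The central identity. In `(1-r) x A φ = f(x) φ(x/r) - (f - (1-r) x g)(x) φ(r x)`, multiplication
by `ω(x)` turns the first term into `ρ φ / ω` one step outwards and the second into `ρ φ / ω` one
step inwards. -/
lemma IsClassical.arm_opA (h : W.IsClassical q) (hq0 : 0 < q) (hq1 : q < 1) (φ : ℝ[X])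
    (hn : W.supp.On s n) :
    W.supp.arm √q s (fun x => (W.opAPoly q φ).eval x * W.ω x) n =
      W.ratioArm q s φ (n - 1) - W.ratioArm q s φ (n + 1) := by
  obtain ⟨hr0, hr1, -⟩ := sqrt_facts hq0 hq1
  set x := W.supp.pt √q s n with hx
  have hxL : x ∈ W.supp.lattice q := pt_mem_lattice hq0 hn
  have e1 : W.supp.pt √q s (n + 1) = √q * x := pt_succ hr0.ne' n
  have hn1 : W.supp.On s (n + 1) := hn.mono (by omega)
  have key := eval_symPearson (f := W.f) (g := W.g) hr1.ne φ x
  rw [eval_pearsonShift] at key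
  have hx'L : √q * x ∈ W.supp.lattice q := e1 ▸ pt_mem_lattice hq0 hn1
  have hup : W.ratioArm q s φ (n + 1) =
      (W.f.eval x - (1 - √q) * x * W.g.eval x) * W.ω x * φ.eval (√q * x) := by
    rw [ratioArm_of_on hn1, e1, h.ratio_shift hxL hx'L]
  have hdown : W.ratioArm q s φ (n - 1) = W.f.eval x * W.ω x * φ.eval ((√q)⁻¹ * x) := by
    by_cases hn' : W.supp.On s (n - 1)
    · have e2 : √q * W.supp.pt √q s (n - 1) = x := by
        rw [← pt_succ hr0.ne', sub_add_cancel]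
      have e3 : W.supp.pt √q s (n - 1) = (√q)⁻¹ * x := by rw [← e2, inv_mul_cancel_left₀ hr0.ne']
      rw [ratioArm_of_on hn', h.ratio_eq (pt_mem_lattice hq0 hn'), e2, e3]; ring
    -- The outer neighbour is missing only at the end point of a bounded arm. There `f` vanishes, in
    -- agreement with the extension of `ratioArm` by `0`.
    · have hbd : W.supp.Bounded := by
        by_contra hb
        exact hn' ⟨hn.1, fun hb' => (hb hb').elim⟩
      have h0 : n = 0 := by
        have h1 := hn.2 hbd
        have h2 : ¬ (0 ≤ n - 1) := fun h' => hn' ⟨hn.1, fun _ => h'⟩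
        omega
      have e4 : x = W.supp.base s := by rw [hx, h0]; simp [pt]
      rw [ratioArm_of_not_on hn', e4, h.f_base hbd]; ring
  rw [arm_of_on hn, hup, hdown]
  change (1 - √q) * (x * ((symPearson W.f W.g √q φ).eval x * W.ω x)) = _
  linear_combination W.ω x * key

lemma tendsto_pt_atTop {D : Support} {r : ℝ} (hr0 : 0 < r) (hr1 : r < 1) (s : Bool) :
    Tendsto (D.pt r s) atTop (𝓝 0) := by
  have h : Tendsto (fun n : ℤ => r ^ n) atTop (𝓝 0) := by
    rw [← Filter.tendsto_comp_val_Ici_atTop (a := (0 : ℤ))]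
    have h2 : Tendsto (fun n : Set.Ici (0 : ℤ) => (n : ℤ).toNat) atTop atTop := by
      refine tendsto_atTop.2 fun b => ?_
      filter_upwards [eventually_ge_atTop (⟨b, by simp⟩ : Set.Ici (0 : ℤ))] with n hn
      have : (b : ℤ) ≤ n := hn
      omega
    refine ((tendsto_pow_atTop_nhds_zero_of_lt_one hr0.le hr1).comp h2).congr fun n => ?_
    simp only [Function.comp]
    rw [← zpow_natCast, Int.toNat_of_nonneg n.2]
  have h2 := h.const_mul (D.base s)
  rw [mul_zero] at h2
  exact h2

/-- One `l` must serve both arms, because the boundary terms at the origin have to cancel between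
them. -/
lemma IsClassical.exists_tendsto_ratioArm (h : W.IsClassical q) (hq0 : 0 < q) (hq1 : q < 1)
    (φ : ℝ[X]) : ∃ l, ∀ s, Tendsto (W.ratioArm q s φ) atTop (𝓝 l) ∧
      Tendsto (W.ratioArm q s φ) atBot (𝓝 0) := by
  obtain ⟨hr0, hr1, -⟩ := sqrt_facts hq0 hq1
  rcases h.zero_alternative with h0 | ⟨hb, hneg, l, hl⟩
  -- If `f(0) = 0`, then `ρ φ / ω` at `x` is `ω f φ(·/√q)` at `√q x`, and the polynomial `f φ(·/√q)`
  -- is divisible by `x`. So it is a multiple of a term of a convergent moment series and tends to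
  -- `0` in both directions.
  · set P := W.f * dil (√q)⁻¹ φ with hP
    have hP0 : P.coeff 0 = 0 := by
      rw [hP, mul_coeff_zero, coeff_zero_eq_eval_zero, h0, zero_mul]
    have key : ∀ s n, W.supp.On s n → W.ratioArm q s φ n =
        (1 - √q)⁻¹ * W.supp.arm √q s (fun x => (divXLin P).eval x * W.ω x) (n + 1) := by
      intro s n hn
      rw [ratioArm_of_on hn, arm_of_on (hn.mono (by omega)), pt_succ hr0.ne',
        h.ratio_eq (pt_mem_lattice hq0 hn), inv_mul_cancel_left₀ (sub_ne_zero.2 hr1.ne'),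
        ← mul_assoc, mul_eval_divXLin hP0, hP, eval_mul, eval_dil,
        inv_mul_cancel_left₀ hr0.ne']
      ring
    have hlim : ∀ s, Tendsto (fun n => (1 - √q)⁻¹ *
        W.supp.arm √q s (fun x => (divXLin P).eval x * W.ω x) (n + 1)) cofinite (𝓝 0) := by
      intro s
      have h1 : Summable fun n : ℤ =>
          W.supp.arm √q s (fun x => (divXLin P).eval x * W.ω x) (n + 1) :=
        (h.summable_omega _ s).comp_injective (i := fun n : ℤ => n + 1) (add_left_injective 1)
      have := h1.tendsto_cofinite_zero.const_mul ((1 - √q)⁻¹)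
      rwa [mul_zero] at this
    have hlim' : ∀ s, Tendsto (W.ratioArm q s φ) cofinite (𝓝 0) := by
      intro s
      refine squeeze_zero_norm (fun n => ?_) (tendsto_zero_iff_norm_tendsto_zero.1 (hlim s))
      by_cases hn : W.supp.On s n
      · rw [key s n hn]
      · rw [ratioArm_of_not_on hn, norm_zero]; exact norm_nonneg _
    refine ⟨0, fun s => ⟨(hlim' s).mono_left ?_, (hlim' s).mono_left ?_⟩⟩
    · exact atTop_le_cofinite
    · exact atBot_le_cofinite
  · have hon : ∀ s, ∀ n : ℤ, 0 ≤ n → W.supp.On s n := by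
      intro s n hn
      refine ⟨?_, fun _ => hn⟩
      cases s
      · exact hneg.ne
      · exact (base_pos h.valid).ne'
    -- With two arms the limit of `ω f φ(·/√q)` at the origin is independent of the arm because `ω`
    -- has one limit along the whole lattice.
    refine ⟨l * W.f.eval 0 * φ.eval 0, fun s => ⟨?_, ?_⟩⟩
    · have hpt := tendsto_pt_atTop (D := W.supp) hr0 hr1 s
      have hpt1 : Tendsto (fun n : ℤ => W.supp.pt √q s (n + 1)) atTop (𝓝 0) :=
        hpt.comp (tendsto_atTop_add_const_right _ _ tendsto_id)
      have hw : Tendsto (fun n : ℤ => W.ω (W.supp.pt √q s (n + 1))) atTop (𝓝 l) := by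
        refine hl.comp (tendsto_nhdsWithin_iff.2 ⟨hpt1, ?_⟩)
        filter_upwards [eventually_ge_atTop (0 : ℤ)] with n hn
        exact pt_mem_lattice hq0 (hon s _ (by omega))
      have hf := (W.f.continuous.tendsto 0).comp hpt1
      have hφ := (φ.continuous.tendsto 0).comp hpt
      refine ((hw.mul hf).mul hφ).congr' ?_
      filter_upwards [eventually_ge_atTop (0 : ℤ)] with n hn
      rw [ratioArm_of_on (hon s n hn), h.ratio_eq (pt_mem_lattice hq0 (hon s n hn)),
        ← pt_succ hr0.ne']
      rfl
    · refine tendsto_const_nhds.congr' ?_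
      filter_upwards [eventually_lt_atBot (0 : ℤ)] with n hn
      rw [ratioArm_of_not_on fun h' => absurd (h'.2 hb) (not_le.2 hn)]

lemma IsClassical.ratioArm_mul (h : W.IsClassical q) (hq0 : 0 < q) (φ ψ : ℝ[X]) (s : Bool)
    (n : ℤ) : W.ratioArm q s φ n * W.supp.arm √q s (fun x => ψ.eval x * W.ω x) n =
      W.supp.arm √q s (fun x => (φ * ψ).eval x * W.ρ x) n := by
  by_cases hn : W.supp.On s n
  · rw [ratioArm_of_on hn, arm_of_on hn, arm_of_on hn, eval_mul]
    have := h.omega_ne_zero _ (pt_mem_lattice hq0 hn)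
    field_simp
  · simp [arm_of_not_on hn]

/-- At even indices the difference relation also holds off the arm: an index `2n < 0` has `2n + 1 <
0` too, so all terms vanish. At odd indices the neighbour of `-1` is the end point `0`, and this
breaks down. -/
lemma IsClassical.arm_opA_even (h : W.IsClassical q) (hq0 : 0 < q) (hq1 : q < 1) (φ : ℝ[X])
    (s : Bool) (n : ℤ) :
    W.supp.arm √q s (fun x => (W.opAPoly q φ).eval x * W.ω x) (2 * n) =
      W.ratioArm q s φ (2 * n - 1) - W.ratioArm q s φ (2 * n + 1) := by
  by_cases hn : W.supp.On s (2 * n)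
  · exact h.arm_opA hq0 hq1 φ hn
  · have h1 : ¬ W.supp.On s (2 * n - 1) := fun h' => hn (h'.mono (by omega))
    have h2 : ¬ W.supp.On s (2 * n + 1) := fun h' =>
      hn ⟨h'.1, fun hb => by have := h'.2 hb; omega⟩
    rw [arm_of_not_on hn, ratioArm_of_not_on h1, ratioArm_of_not_on h2, sub_zero]

/-- `⟨𝒜 φ, ψ⟩₁ = (1 + q^{1/2})² ⟨φ, ψ⟩₂`. -/
lemma IsClassical.skewForm_opA (h : W.IsClassical q) (hq0 : 0 < q) (hq1 : q < 1) (φ ψ : ℝ[X]) :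
    h.skewForm hq0 (W.opAPoly q φ) ψ = (1 + √q) ^ 2 * h.functional (φ * ψ) := by
  obtain ⟨l, hl⟩ := h.exists_tendsto_ratioArm hq0 hq1 φ
  have hE := h.summable_omega (W.opAPoly q φ)
  have hE' := h.summable_omega ψ
  have hsk : ∀ s, skewSum (W.supp.arm √q s fun x => (W.opAPoly q φ).eval x * W.ω x)
      (W.supp.arm √q s fun x => ψ.eval x * W.ω x) =
      ∑' n, W.supp.arm √q s (fun x => (φ * ψ).eval x * W.ρ x) n -
        l * ∑' n : ℤ, W.supp.arm √q s (fun x => ψ.eval x * W.ω x) (2 * n) := by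
    intro s
    rw [skewSum_eq_of_telescope (hE s) (hE' s) (hl s).2 (hl s).1 (h.arm_opA_even hq0 hq1 φ s)]
    · simp only [h.ratioArm_mul hq0]
    · intro n hn k
      have hon : W.supp.On s (2 * n) := by
        by_contra hcon; exact hn (arm_of_not_on hcon _)
      rw [h.arm_opA hq0 hq1 φ (hon.mono (by omega))]
      congr 2 <;> ring
    · exact (h.summable_rho (φ * ψ) s).congr fun n => (h.ratioArm_mul hq0 φ ψ s n).symm
  -- The even sums of `(A φ) ω` are `-l` on each arm, so the cross term of the skew product cancels
  -- the boundary terms `l ∑ E'` left by the two arms.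
  have hev : ∀ s, ∑' n : ℤ, W.supp.arm √q s (fun x => (W.opAPoly q φ).eval x * W.ω x) (2 * n) =
      -l := fun s =>
    tsum_even_eq_of_telescope (hE s) (hl s).2 (hl s).1 (h.arm_opA_even hq0 hq1 φ s)
  rw [h.skewForm_apply, h.inner1_poly hq0, hsk, hsk, hev, hev, h.functional_apply, integral_eq_arm]
  ring

lemma IsClassical.skewForm_swap (h : W.IsClassical q) (hq0 : 0 < q) (φ ψ : ℝ[X]) :
    h.skewForm hq0 φ ψ = -h.skewForm hq0 ψ φ := inner1_swap W q _ _

/-- `s_x (𝒜 φ) = (1 + q^{1/2})² (ρ / ω) φ` on the lattice. -/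
lemma IsClassical.opS_opA (h : W.IsClassical q) (hq0 : 0 < q) (hq1 : q < 1) (φ : ℝ[X]) {x : ℝ}
    (hx : x ∈ W.supp.lattice q) :
    W.opS q (fun z => (W.opAPoly q φ).eval z) x =
      (1 + √q) ^ 2 * (W.ρ x / W.ω x * φ.eval x) := by
  obtain ⟨l, hl⟩ := h.exists_tendsto_ratioArm hq0 hq1 φ
  have hE := h.summable_omega (W.opAPoly q φ)
  obtain ⟨s, k, hk, rfl⟩ := (mem_lattice hq0 x).1 hx
  rw [opS_pt hq0 hq1 h.valid hk, ← ratioArm_of_on hk]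
  congr 1
  obtain ⟨j, rfl | rfl⟩ := Int.even_or_odd' k
  -- At an even point the tail on the same arm gives `F(k) - l` and the sum across the origin
  -- returns the missing `l`. At an odd point there is no link across, and the outward sum has no
  -- boundary term.
  · rw [tsum_linkSame_even, tsum_linkCross_even,
      tsum_even_eq_of_telescope (hE _) (hl _).2 (hl _).1 (h.arm_opA_even hq0 hq1 φ _),
      oddTail_eq_of_telescope (hE s) (hl s).1]
    · ring
    · intro k
      rw [h.arm_opA hq0 hq1 φ (hk.mono (by omega))]
      congr 2 <;> ring
  · rw [tsum_linkSame_odd, tsum_linkCross_odd,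
      tsum_evenInit_eq_of_telescope (hE s) (hl s).2 (h.arm_opA_even hq0 hq1 φ s)]
    ring


/-- The operator `s_x` as a functional on polynomials. -/
def IsClassical.opSLin (h : W.IsClassical q) (x : ℝ) :
    ℝ[X] →ₗ[ℝ] ℝ := by
  have hsum : ∀ (p : ℝ[X]) (s : Bool), Summable (W.supp.arm √q s fun z =>
      W.supp.skewKernel q z x * p.eval z * W.ω z) := by
    intro p s
    -- The kernel is bounded by `(1 + √q)²`, so the moments of `ω` dominate.
    refine Summable.of_norm_bounded (g := fun n => (1 + √q) ^ 2 *
      ‖W.supp.arm √q s (fun z => p.eval z * W.ω z) n‖) ((h.summable_omega p s).norm.mul_left _)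
      fun n => ?_
    by_cases hn : W.supp.On s n
    · set z := W.supp.pt √q s n
      have hk : ‖W.supp.skewKernel q z x‖ ≤ (1 + √q) ^ 2 := by
        have h0 : 0 ≤ (1 + √q) ^ 2 := by positivity
        unfold skewKernel
        split_ifs <;> simp
        exact h0
      have e : W.supp.arm √q s (fun z => W.supp.skewKernel q z x * p.eval z * W.ω z) n =
          W.supp.skewKernel q z x * W.supp.arm √q s (fun z => p.eval z * W.ω z) n := by
        rw [arm_of_on hn, arm_of_on hn]; ring
      rw [e, norm_mul]
      exact mul_le_mul_of_nonneg_right hk (norm_nonneg _)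
    · simp [arm_of_not_on hn]
  exact
  { toFun := fun p => W.opS q (fun z => p.eval z) x
    map_add' := fun p p' => by
      have e : ∀ s, ∑' n, W.supp.arm √q s
          (fun z => W.supp.skewKernel q z x * (p + p').eval z * W.ω z) n =
          ∑' n, W.supp.arm √q s (fun z => W.supp.skewKernel q z x * p.eval z * W.ω z) n +
          ∑' n, W.supp.arm √q s (fun z => W.supp.skewKernel q z x * p'.eval z * W.ω z) n := by
        intro s
        rw [← (hsum p s).tsum_add (hsum p' s)]
        refine tsum_congr fun n => ?_
        rw [← arm_add]
        exact arm_congr fun _ => by rw [eval_add]; ring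
      simp only [opS, integral_eq_arm, e]; ring
    map_smul' := fun c p => by
      have e : ∀ s, ∑' n, W.supp.arm √q s
          (fun z => W.supp.skewKernel q z x * (c • p).eval z * W.ω z) n =
          c * ∑' n, W.supp.arm √q s
            (fun z => W.supp.skewKernel q z x * p.eval z * W.ω z) n := by
        intro s
        rw [← tsum_mul_left]
        refine tsum_congr fun n => ?_
        rw [← arm_smul]
        exact arm_congr fun _ => by rw [eval_smul, smul_eq_mul]; ring
      simp only [opS, integral_eq_arm, e, RingHom.id_apply, smul_eq_mul]; ring }

lemma IsClassical.opSLin_apply (h : W.IsClassical q) (x : ℝ) (p : ℝ[X]) :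
    h.opSLin x p = W.opS q (fun z => p.eval z) x := rfl

end Weight

end QEnsemble

end

noncomputable section

namespace QEnsemble

open Polynomial

/-! ### Orthogonal and skew orthogonal polynomials, algebraically -/

/-- Monic polynomials of degrees `0, …, N - 1` span all polynomials of degree below `N`. The
conclusion is phrased for a submodule so that it can be applied to kernels of functionals. -/
lemma mem_of_monic_mem {p : ℕ → ℝ[X]} (hm : ∀ n, (p n).Monic) (hd : ∀ n, (p n).natDegree = n)
    (S : Submodule ℝ ℝ[X]) {N : ℕ} (h : ∀ k < N, p k ∈ S) {Q : ℝ[X]} (hQ : Q.degree < N) :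
    Q ∈ S := by
  induction N generalizing Q with
  | zero =>
    have : Q = 0 := by
      ext m
      exact (degree_lt_iff_coeff_zero Q 0).1 hQ m (Nat.zero_le m)
    rw [this]; exact S.zero_mem
  | succ N ih =>
    have h1 : (Q - Q.coeff N • p N).degree < N := by
      rw [degree_lt_iff_coeff_zero] at hQ ⊢
      intro m hm'
      rw [coeff_sub, coeff_smul, smul_eq_mul]
      rcases hm'.eq_or_lt with rfl | hlt
      · have : (p N).coeff N = 1 := by
          have := (hm N).coeff_natDegree
          rwa [hd N] at this
        rw [this, mul_one, sub_self]
      · rw [hQ m hlt, coeff_eq_zero_of_natDegree_lt (p := p N) (by rw [hd]; exact hlt),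
          mul_zero, sub_zero]
    have h2 := ih (fun k hk => h k (hk.trans N.lt_succ_self)) h1
    have h3 := S.add_mem h2 (S.smul_mem (Q.coeff N) (h N N.lt_succ_self))
    rwa [sub_add_cancel] at h3

/-- Monic orthogonal polynomials with norms `h` for a functional `u`. -/
structure IsOP (u : ℝ[X] →ₗ[ℝ] ℝ) (p : ℕ → ℝ[X]) (h : ℕ → ℝ) : Prop where
  monic : ∀ n, (p n).Monic
  natDegree : ∀ n, (p n).natDegree = n
  orthogonal : ∀ m n, m ≠ n → u (p m * p n) = 0
  norm : ∀ n, u (p n * p n) = h n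
  ne_zero : ∀ n, h n ≠ 0

namespace IsOP

variable {u : ℝ[X] →ₗ[ℝ] ℝ} {p : ℕ → ℝ[X]} {h : ℕ → ℝ}

lemma degree_lt (H : IsOP u p h) {n N : ℕ} (hn : n < N) : (p n).degree < N := by
  rw [degree_eq_natDegree (H.monic n).ne_zero, H.natDegree]
  exact_mod_cast hn

lemma coeff_self (H : IsOP u p h) (n : ℕ) : (p n).coeff n = 1 := by
  have := (H.monic n).coeff_natDegree
  rwa [H.natDegree n] at this

lemma map_mul_of_degree_lt (H : IsOP u p h) {n : ℕ} {Q : ℝ[X]} (hQ : Q.degree < n) :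
    u (p n * Q) = 0 :=
  mem_of_monic_mem H.monic H.natDegree (LinearMap.ker (u ∘ₗ LinearMap.mulLeft ℝ (p n)))
    (fun k hk => H.orthogonal n k hk.ne') hQ

lemma map_mul (H : IsOP u p h) {n : ℕ} {Q : ℝ[X]} (hQ : Q.natDegree ≤ n) :
    u (p n * Q) = Q.coeff n * h n := by
  have h1 : (Q - Q.coeff n • p n).degree < n := by
    rw [degree_lt_iff_coeff_zero]
    intro m hm
    rw [coeff_sub, coeff_smul, smul_eq_mul]
    rcases hm.eq_or_lt with rfl | hlt
    · rw [H.coeff_self, mul_one, sub_self]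
    · rw [coeff_eq_zero_of_natDegree_lt (hQ.trans_lt hlt),
        coeff_eq_zero_of_natDegree_lt (p := p n) (by rw [H.natDegree]; exact hlt), mul_zero,
        sub_zero]
  have h2 := H.map_mul_of_degree_lt h1
  rw [mul_sub, map_sub, mul_smul_comm, map_smul, H.norm, smul_eq_mul] at h2
  linarith

/-- Pairing a nonzero `Q` with `p` of index `deg Q` returns the leading coefficient times a nonzero
norm. -/
lemma eq_zero_of_map_mul (H : IsOP u p h) {N : ℕ} {Q : ℝ[X]} (hQ : Q.degree < N)
    (h0 : ∀ j < N, u (p j * Q) = 0) : Q = 0 := by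
  by_contra hne
  have hd : Q.natDegree < N := (natDegree_lt_iff_degree_lt hne).2 hQ
  have h1 := h0 _ hd
  rw [H.map_mul le_rfl] at h1
  rcases mul_eq_zero.1 h1 with h2 | h2
  · exact hne (leadingCoeff_eq_zero.1 h2)
  · exact H.ne_zero _ h2

lemma exists_map_mul_ne_zero (H : IsOP u p h) {P : ℝ[X]} (hP : P ≠ 0) : ∃ w, u (P * w) ≠ 0 := by
  refine ⟨p P.natDegree, ?_⟩
  rw [mul_comm, H.map_mul le_rfl]
  exact mul_ne_zero (leadingCoeff_ne_zero.2 hP) (H.ne_zero _)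

end IsOP

/-- A skew form `B` and an operator `A` raising the degree by one such that
`B(A φ, ψ) = κ u(φ ψ)`. -/
structure IsSkewPair (u : ℝ[X] →ₗ[ℝ] ℝ) (B : ℝ[X] →ₗ[ℝ] ℝ[X] →ₗ[ℝ] ℝ) (A : ℝ[X] →ₗ[ℝ] ℝ[X])
    (κ : ℝ) (a : ℕ → ℝ) : Prop where
  map : ∀ φ ψ, B (A φ) ψ = κ * u (φ * ψ)
  swap : ∀ φ ψ, B φ ψ = -B ψ φ
  scale_ne_zero : κ ≠ 0
  natDegree_le : ∀ (Q : ℝ[X]) (n : ℕ), Q.natDegree ≤ n → (A Q).natDegree ≤ n + 1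
  coeff : ∀ (Q : ℝ[X]) (n : ℕ), Q.natDegree ≤ n → (A Q).coeff (n + 1) = a n * Q.coeff n

namespace IsSkewPair

variable {u : ℝ[X] →ₗ[ℝ] ℝ} {B : ℝ[X] →ₗ[ℝ] ℝ[X] →ₗ[ℝ] ℝ} {A : ℝ[X] →ₗ[ℝ] ℝ[X]} {κ : ℝ}
  {a : ℕ → ℝ} {p : ℕ → ℝ[X]} {h : ℕ → ℝ}

lemma map_right (P : IsSkewPair u B A κ a) (φ ψ : ℝ[X]) : B φ (A ψ) = -(κ * u (φ * ψ)) := by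
  rw [P.swap, P.map, mul_comm ψ]

lemma self (P : IsSkewPair u B A κ a) (φ : ℝ[X]) : B φ φ = 0 := by
  have := P.swap φ φ
  linarith

/-- `B (A φ) (A ψ)` is evaluated once through its first and once through its second argument. -/
lemma skew (P : IsSkewPair u B A κ a) (φ ψ : ℝ[X]) : u (φ * A ψ) = -u (A φ * ψ) := by
  have h1 := P.map φ (A ψ)
  rw [P.map_right, mul_comm] at h1
  have := P.scale_ne_zero
  have h2 : κ * u (φ * A ψ) = κ * -u (A φ * ψ) := by rw [← h1]; ring
  exact mul_left_cancel₀ this h2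

lemma map_succ (P : IsSkewPair u B A κ a) (H : IsOP u p h) (n : ℕ) :
    u (p (n + 1) * A (p n)) = a n * h (n + 1) := by
  rw [H.map_mul (P.natDegree_le _ _ (H.natDegree n).le), P.coeff _ _ (H.natDegree n).le,
    H.coeff_self, mul_one]

lemma degree_lt (P : IsSkewPair u B A κ a) (H : IsOP u p h) {n N : ℕ} (hn : n + 1 < N) :
    (A (p n)).degree < N := by
  have := P.natDegree_le _ _ (H.natDegree n).le
  refine degree_le_natDegree.trans_lt ?_
  exact_mod_cast this.trans_lt hn

/-- Skewness makes `A` a skew Jacobi matrix: the pairing with `p j` vanishes for `j < n` because `A`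
raises degrees by at most one, and on the diagonal by antisymmetry. The lower entry is the upper one
transposed with a sign. -/
lemma apply_succ (P : IsSkewPair u B A κ a) (H : IsOP u p h) (n : ℕ) :
    A (p (n + 1)) = a (n + 1) • p (n + 2) - (a n * h (n + 1) / h n) • p n := by
  rw [← sub_eq_zero]
  refine H.eq_zero_of_map_mul (N := n + 3) ?_ ?_
  · refine (degree_sub_le _ _).trans_lt (max_lt (P.degree_lt H (by omega)) ?_)
    refine (degree_sub_le _ _).trans_lt (max_lt ?_ ?_)
    · exact (degree_smul_le _ _).trans_lt (H.degree_lt (by omega))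
    · exact (degree_smul_le _ _).trans_lt (H.degree_lt (by omega))
  · intro j hj
    have hn := H.ne_zero n
    rw [mul_sub, mul_sub, map_sub, map_sub, mul_smul_comm, mul_smul_comm, map_smul, map_smul,
      smul_eq_mul, smul_eq_mul]
    have hcases : j < n ∨ j = n ∨ j = n + 1 ∨ j = n + 2 := by omega
    rcases hcases with hlt | rfl | rfl | rfl
    · rw [P.skew, mul_comm (A _), H.map_mul_of_degree_lt (P.degree_lt H (by omega)),
        H.orthogonal _ _ (by omega), H.orthogonal _ _ (by omega)]
      ring
    · rw [P.skew, mul_comm (A _), P.map_succ H, H.orthogonal _ _ (by omega), H.norm]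
      field_simp; ring
    · have h1 := P.skew (p (n + 1)) (p (n + 1))
      rw [mul_comm (A _)] at h1
      rw [H.orthogonal _ _ (by omega), H.orthogonal _ _ (by omega)]
      linarith
    · rw [P.map_succ H, H.norm, H.orthogonal _ _ (by omega)]
      ring

lemma apply_zero (P : IsSkewPair u B A κ a) (H : IsOP u p h) : A (p 0) = a 0 • p 1 := by
  rw [← sub_eq_zero]
  refine H.eq_zero_of_map_mul (N := 2) ?_ ?_
  · refine (degree_sub_le _ _).trans_lt (max_lt (P.degree_lt H (by omega)) ?_)
    exact (degree_smul_le _ _).trans_lt (H.degree_lt (by omega))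
  · intro j hj
    rw [mul_sub, map_sub, mul_smul_comm, map_smul, smul_eq_mul]
    have hcases : j = 0 ∨ j = 1 := by omega
    rcases hcases with rfl | rfl
    · have h1 := P.skew (p 0) (p 0)
      rw [mul_comm (A _)] at h1
      rw [H.orthogonal _ _ (by omega)]
      linarith
    · rw [P.map_succ H, H.norm]; ring

/-- `B (p (2m)) (A (p (2j))) = -κ u (p (2m) p (2j)) = 0` for `j < m`. By the two-term formula for `A
(p (2j))` the vanishing climbs from one odd index to the next, beginning with `A (p 0) = a 0 • p 1`.
-/
lemma even_odd_eq_zero (P : IsSkewPair u B A κ a) (H : IsOP u p h) (ha : ∀ n, a n ≠ 0) (m j : ℕ)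
    (hj : j < m) : B (p (2 * m)) (p (2 * j + 1)) = 0 := by
  induction j with
  | zero =>
    have h1 := P.map_right (p (2 * m)) (p 0)
    rw [P.apply_zero H, H.orthogonal _ _ (by omega), map_smul, smul_eq_mul, mul_zero,
      neg_zero] at h1
    exact (mul_eq_zero.1 h1).resolve_left (ha 0)
  | succ j ih =>
    have h1 := P.map_right (p (2 * m)) (p (2 * j + 1 + 1))
    rw [P.apply_succ H, H.orthogonal _ _ (by omega), map_sub, map_smul, map_smul,
      ih (by omega), smul_eq_mul, smul_zero, mul_zero, neg_zero, sub_zero] at h1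
    exact (mul_eq_zero.1 h1).resolve_left (ha _)

/-- Here the recursion descends from `B (p (2m)) (p (2m)) = 0`: orthogonality to the odd `p (2k +
1)` relates the even indices `2k + 2` and `2k`, and the lower coefficient `a h / h` is nonzero. -/
lemma even_even_eq_zero (P : IsSkewPair u B A κ a) (H : IsOP u p h) (ha : ∀ n, a n ≠ 0) (m i : ℕ)
    (hi : i ≤ m) : B (p (2 * m)) (p (2 * (m - i))) = 0 := by
  induction i with
  | zero => exact P.self _
  | succ i ih =>
    obtain ⟨k, hk⟩ : ∃ k, m - i = k + 1 := ⟨m - i - 1, by omega⟩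
    have hk' : m - (i + 1) = k := by omega
    have h0 := ih (by omega)
    rw [hk] at h0
    rw [hk']
    have h1 := P.map_right (p (2 * m)) (p (2 * k + 1))
    rw [P.apply_succ H, H.orthogonal _ _ (by omega), map_sub, map_smul, map_smul,
      show 2 * k + 2 = 2 * (k + 1) by ring, h0, smul_zero, mul_zero, neg_zero,
      zero_sub, neg_eq_zero, smul_eq_mul] at h1
    refine (mul_eq_zero.1 h1).resolve_left ?_
    exact div_ne_zero (mul_ne_zero (ha _) (H.ne_zero _)) (H.ne_zero _)

/-- `p_{2m}` is skew orthogonal to all polynomials of degree at most `2m`. -/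
lemma even_eq_zero (P : IsSkewPair u B A κ a) (H : IsOP u p h) (ha : ∀ n, a n ≠ 0) (m : ℕ)
    {Q : ℝ[X]} (hQ : Q.degree < (2 * m + 1 : ℕ)) : B (p (2 * m)) Q = 0 := by
  refine mem_of_monic_mem H.monic H.natDegree (LinearMap.ker (B (p (2 * m)))) (fun k hk => ?_) hQ
  rw [LinearMap.mem_ker]
  obtain ⟨j, rfl | rfl⟩ := Nat.even_or_odd' k
  · have := P.even_even_eq_zero H ha m (m - j) (by omega)
    rwa [Nat.sub_sub_self (by omega)] at this
  · exact P.even_odd_eq_zero H ha m j (by omega)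

/-- Only the leading term of `A (p (2m))` is seen by `B (p (2m))`, and `B (p (2m)) (A (p (2m))) = -κ
h (2m)`. -/
lemma even_succ (P : IsSkewPair u B A κ a) (H : IsOP u p h) (ha : ∀ n, a n ≠ 0) (m : ℕ) :
    B (p (2 * m)) (p (2 * m + 1)) = -(κ * h (2 * m)) / a (2 * m) := by
  have h1 := P.map_right (p (2 * m)) (p (2 * m))
  have h2 : (A (p (2 * m)) - a (2 * m) • p (2 * m + 1)).degree < (2 * m + 1 : ℕ) := by
    rw [degree_lt_iff_coeff_zero]
    intro N hN
    rw [coeff_sub, coeff_smul, smul_eq_mul]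
    rcases hN.eq_or_lt with rfl | hlt
    · rw [P.coeff _ _ (H.natDegree _).le, H.coeff_self, H.coeff_self]; ring
    · rw [coeff_eq_zero_of_natDegree_lt ((P.natDegree_le _ _ (H.natDegree _).le).trans_lt hlt),
        coeff_eq_zero_of_natDegree_lt (by rw [H.natDegree]; exact hlt), mul_zero, sub_zero]
  have h3 := P.even_eq_zero H ha m h2
  rw [map_sub, map_smul, h1, H.norm, smul_eq_mul, sub_eq_zero] at h3
  rw [eq_div_iff (ha _), h3]; ring

/-- A polynomial of degree less than `2 n` is determined by its skew products. -/
lemma eq_zero_of_degree_lt (P : IsSkewPair u B A κ a) (H : IsOP u p h) (ha : ∀ n, a n ≠ 0) (m : ℕ)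
    {Q : ℝ[X]} (hQ : Q.degree < (2 * m + 2 : ℕ))
    (h0 : ∀ R : ℝ[X], R.degree < (2 * m + 2 : ℕ) → B Q R = 0) : Q = 0 := by
  set c := Q.coeff (2 * m + 1)
  have hle : Q.natDegree ≤ 2 * m + 1 := by
    rw [natDegree_le_iff_coeff_eq_zero]
    exact fun N hN => (degree_lt_iff_coeff_zero Q _).1 hQ N hN
  -- The tests `R = A (p j)` with `j ≤ 2m` make `Q` orthogonal to `p j`, so `Q` is a multiple of `p
  -- (2m + 1)`. The remaining test `R = p (2m)` kills the factor.
  have h1 : Q - c • p (2 * m + 1) = 0 := by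
    refine H.eq_zero_of_map_mul (N := 2 * m + 2) ?_ fun j hj => ?_
    · exact (degree_sub_le _ _).trans_lt (max_lt hQ
        ((degree_smul_le _ _).trans_lt (H.degree_lt (by omega))))
    · rw [mul_sub, map_sub, mul_smul_comm, map_smul, smul_eq_mul]
      rcases (Nat.lt_succ_iff.1 hj).eq_or_lt with rfl | hlt
      · rw [H.map_mul hle, H.norm, sub_self]
      · rw [H.orthogonal _ _ (by omega), mul_zero, sub_zero]
        have h2 := P.map_right Q (p j)
        rw [h0 _ (P.degree_lt H (by omega)), zero_eq_neg, mul_eq_zero] at h2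
        rw [mul_comm]
        exact h2.resolve_left P.scale_ne_zero
  rw [sub_eq_zero] at h1
  have h2 := h0 (p (2 * m)) (H.degree_lt (by omega))
  rw [h1, map_smul, LinearMap.smul_apply, P.swap, P.even_succ H ha, smul_eq_mul] at h2
  have h3 : -(-(κ * h (2 * m)) / a (2 * m)) ≠ 0 :=
    neg_ne_zero.2 (div_ne_zero (neg_ne_zero.2 (mul_ne_zero P.scale_ne_zero (H.ne_zero _))) (ha _))
  rw [h1, (mul_eq_zero.1 h2).resolve_right h3, zero_smul]

end IsSkewPair

/-! ### The skew kernel of a classical weight -/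

namespace Weight

variable {W : Weight} {q : ℝ} {p : ℕ → ℝ[X]}

lemma IsClassical.isOP (h : W.IsClassical q) (hp : W.IsMonicOP q p) :
    IsOP h.functional p (W.h q p) where
  monic := hp.monic
  natDegree := hp.natDegree
  orthogonal m n hmn := by rw [← h.inner2_eq, hp.orthogonal m n hmn]
  norm n := by rw [← h.inner2_eq, Weight.h]
  ne_zero n := hp.norm_ne_zero n

lemma IsClassical.isSkewPair (h : W.IsClassical q) (hq0 : 0 < q) (hq1 : q < 1) :
    IsSkewPair h.functional (h.skewForm hq0) (W.opAPoly q) ((1 + √q) ^ 2) (symLead W.f W.g √q) where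
  map := h.skewForm_opA hq0 hq1
  swap := h.skewForm_swap hq0
  scale_ne_zero := by positivity
  natDegree_le _ _ hn := natDegree_symPearson_le h.natDegree_f h.natDegree_g hn
  coeff _ _ hn := coeff_symPearson (Real.sqrt_pos.2 hq0).ne' h.natDegree_f h.natDegree_g hn

/-- The moment functional satisfies the Pearson equation. -/
lemma IsClassical.functional_pearsonOp (h : W.IsClassical q) (hq0 : 0 < q) (hq1 : q < 1)
    (θ : ℝ[X]) : h.functional (pearsonOp W.f W.g √q θ) = 0 :=
  pearsonOp_annihilated (Real.sqrt_pos.2 hq0) (sqrt_facts hq0 hq1).2.1.ne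
    (h.isSkewPair hq0 hq1).skew θ

/-- The regularity required by `pearsonLead_ne_zero` comes from the orthogonal polynomials: `u 1 = h
0`, and no nonzero polynomial is orthogonal to everything. That `f` is not the zero polynomial is
read off at a lattice point. -/
lemma IsClassical.symLead_ne_zero (h : W.IsClassical q) (hq0 : 0 < q) (hq1 : q < 1)
    (hp : W.IsMonicOP q p) (n : ℕ) : symLead W.f W.g √q n ≠ 0 := by
  obtain ⟨hr0, hr1, -⟩ := sqrt_facts hq0 hq1
  have H := h.isOP hp
  refine mul_ne_zero (pow_ne_zero _ (inv_ne_zero hr0.ne')) ?_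
  refine pearsonLead_ne_zero hr0 hr1 h.natDegree_f h.natDegree_g ?_
    (h.functional_pearsonOp hq0 hq1) ?_ (fun P hP => H.exists_map_mul_ne_zero hP) _
  · intro hf
    have hv := h.valid
    have hon : W.supp.On true 0 := ⟨(Support.base_pos hv).ne', fun _ => le_rfl⟩
    exact h.f_ne_zero _ (Support.pt_mem_lattice hq0 hon) (by rw [hf, eval_zero])
  · have h0 : p 0 = 1 := (H.monic 0).natDegree_eq_zero.1 (H.natDegree 0)
    have := H.norm 0
    rw [h0, one_mul] at this
    rw [this]; exact H.ne_zero 0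

/-- Only the leading coefficient of `A p_n` survives the pairing with `p_{n+1}`, so `c_n = -a_n
h_{n+1}` and the norm `h_{n+1}` drops out of `γ_n`. -/
lemma IsClassical.gamma_eq (h : W.IsClassical q) (hq0 : 0 < q) (hq1 : q < 1)
    (hp : W.IsMonicOP q p) (n : ℕ) :
    W.gamma q p n = -symLead W.f W.g √q n / ((1 + √q) ^ 2 * W.h q p n) := by
  have H := h.isOP hp
  have P := h.isSkewPair hq0 hq1
  have hc : W.c q p n = -(symLead W.f W.g √q n * W.h q p (n + 1)) := by
    rw [← P.map_succ H, c, h.functional_apply, inner2, Support.integral_eq_arm,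
      Support.integral_eq_arm]
    congr 2 <;>
    · refine tsum_congr fun m => Support.arm_congr fun hm => ?_
      rw [eval_mul, eval_opAPoly hq0 hq1 _ (Support.pt_ne_zero (Real.sqrt_pos.2 hq0) hm)]
  have h1 := H.ne_zero n
  have h2 := H.ne_zero (n + 1)
  rw [gamma, hc]
  field_simp

lemma IsClassical.exists_isMonicSOP (h : W.IsClassical q) (hq0 : 0 < q) (hq1 : q < 1)
    (hp : W.IsMonicOP q p) : ∃ Q u, W.IsMonicSOP q Q u := by
  have H := h.isOP hp
  have P := h.isSkewPair hq0 hq1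
  have ha := h.symLead_ne_zero hq0 hq1 hp
  set a := symLead W.f W.g √q
  have hodd : ∀ m, (a (2 * m))⁻¹ • W.opAPoly q (p (2 * m)) ≠ 0 ∧
      ((a (2 * m))⁻¹ • W.opAPoly q (p (2 * m))).Monic ∧
      ((a (2 * m))⁻¹ • W.opAPoly q (p (2 * m))).natDegree = 2 * m + 1 := by
    intro m
    have h1 := (natDegree_smul_le (a (2 * m))⁻¹ (W.opAPoly q (p (2 * m)))).trans
      (P.natDegree_le _ _ (H.natDegree (2 * m)).le)
    have h2 : ((a (2 * m))⁻¹ • W.opAPoly q (p (2 * m))).coeff (2 * m + 1) = 1 := by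
      rw [coeff_smul, P.coeff _ _ (H.natDegree (2 * m)).le, H.coeff_self, mul_one, smul_eq_mul,
        inv_mul_cancel₀ (ha _)]
    have hmon := monic_of_natDegree_le_of_coeff_eq_one _ h1 h2
    refine ⟨hmon.ne_zero, hmon, le_antisymm h1 ?_⟩
    exact le_natDegree_of_ne_zero (by rw [h2]; exact one_ne_zero)
  -- The even members are the orthogonal polynomials themselves, the odd ones the normalized `A (p
  -- (2m))`. Two odd members pair to a multiple of `u (p (2m) A (p (2n)))`, which vanishes because
  -- `A (p (2n))` involves only odd indices. An even and an odd one pair to `-κ u (p (2m) p (2n)) /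
  -- a (2n)`, whence the value of `u m`.
  refine ⟨fun k => if Even k then p k else (a (k - 1))⁻¹ • W.opAPoly q (p (k - 1)),
    fun m => -((1 + √q) ^ 2 * W.h q p (2 * m)) / a (2 * m), ?_, ?_, ?_, ?_, ?_, ?_⟩
  · intro n
    obtain ⟨k, rfl | rfl⟩ := Nat.even_or_odd' n
    · simpa using hp.monic _
    · simpa using (hodd k).2.1
  · intro n
    obtain ⟨k, rfl | rfl⟩ := Nat.even_or_odd' n
    · simpa using hp.natDegree _
    · simpa using (hodd k).2.2
  · intro m n
    rw [← h.skewForm_apply hq0]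
    simp only [even_two_mul, if_true]
    rcases le_total n m with hmn | hmn
    · exact P.even_eq_zero H ha m (H.degree_lt (by omega))
    · rw [P.swap, P.even_eq_zero H ha n (H.degree_lt (by omega)), neg_zero]
  · intro m n
    rw [← h.skewForm_apply hq0]
    have e : ∀ k : ℕ, ¬ Even (2 * k + 1) := fun k => by simp
    simp only [e, if_false, Nat.add_sub_cancel, map_smul, LinearMap.smul_apply]
    rw [P.map]
    rcases n with _ | n
    · rw [mul_zero, P.apply_zero H, mul_smul_comm, map_smul, H.orthogonal _ _ (by omega)]; simp
    · rw [show 2 * (n + 1) = 2 * n + 1 + 1 by ring, P.apply_succ H, mul_sub, mul_smul_comm,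
        mul_smul_comm, map_sub, map_smul, map_smul, H.orthogonal _ _ (by omega),
        H.orthogonal _ _ (by omega)]; simp
  · intro m n
    rw [← h.skewForm_apply hq0]
    have e : ∀ k : ℕ, ¬ Even (2 * k + 1) := fun k => by simp
    simp only [e, if_false, Nat.add_sub_cancel, even_two_mul, if_true, map_smul]
    rw [P.map_right, smul_eq_mul]
    split_ifs with hmn
    · subst hmn; rw [H.norm]; ring
    · rw [H.orthogonal _ _ (by omega)]; ring
  · intro n
    refine div_ne_zero (neg_ne_zero.2 (mul_ne_zero ?_ (hp.norm_ne_zero _))) (ha _)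
    positivity

/-- The kernel `K_{2n}(·, y)` as a polynomial. -/
def kernelKPoly (Q : ℕ → ℝ[X]) (u : ℕ → ℝ) (n : ℕ) (y : ℝ) : ℝ[X] :=
  ∑ i ∈ Finset.range n, (1 / u i) •
    ((Q (2 * i + 1)).eval y • Q (2 * i) - (Q (2 * i)).eval y • Q (2 * i + 1))

lemma eval_kernelKPoly (Q : ℕ → ℝ[X]) (u : ℕ → ℝ) (n : ℕ) (x y : ℝ) :
    (kernelKPoly Q u n y).eval x = kernelK Q u n x y := by
  rw [kernelKPoly, kernelK, eval_finsetSum]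
  refine Finset.sum_congr rfl fun i _ => ?_
  simp only [eval_smul, eval_sub, smul_eq_mul]
  ring

/-- The kernel `S_N(·, y)` as a polynomial. -/
def kernelSPoly (W : Weight) (q : ℝ) (p : ℕ → ℝ[X]) (N : ℕ) (y : ℝ) : ℝ[X] :=
  ∑ l ∈ Finset.range N, ((p l).eval y / W.h q p l) • p l

lemma eval_kernelSPoly (W : Weight) (q : ℝ) (p : ℕ → ℝ[X]) (N : ℕ) (x y : ℝ) :
    (W.kernelSPoly q p N y).eval x = W.kernelS q p N x y := by
  rw [kernelSPoly, kernelS, eval_finsetSum]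
  refine Finset.sum_congr rfl fun i _ => ?_
  simp only [eval_smul, smul_eq_mul]
  ring

/-- The skew `K`-kernel is a rank one perturbation of the image of the Christoffel–Darboux
kernel. -/
lemma IsClassical.kernelKPoly_eq (h : W.IsClassical q) (hq0 : 0 < q) (hq1 : q < 1)
    (hp : W.IsMonicOP q p) {Q : ℕ → ℝ[X]} {u : ℕ → ℝ} (hQ : W.IsMonicSOP q Q u) (m : ℕ) (y : ℝ) :
    kernelKPoly Q u (m + 1) y =
      ((1 + √q) ^ 2)⁻¹ • W.opAPoly q (W.kernelSPoly q p (2 * m + 1) y) +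
        (W.gamma q p (2 * m) * (p (2 * m + 1)).eval y) • p (2 * m) := by
  have H := h.isOP hp
  have P := h.isSkewPair hq0 hq1
  have ha := h.symLead_ne_zero hq0 hq1 hp
  have hQd : ∀ {n N : ℕ}, n < N → (Q n).degree < N := by
    intro n N hn
    rw [degree_eq_natDegree (hQ.monic n).ne_zero, hQ.natDegree]
    exact_mod_cast hn
  have hκ := P.scale_ne_zero
  rw [← sub_eq_zero]
  -- Both sides have degree below `2m + 2` and, paired with any `R` of such degree, give `R(y)`.
  -- Nondegeneracy of the skew form then makes them equal.
  refine P.eq_zero_of_degree_lt H ha m ?_ ?_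
  · have hK : (kernelKPoly Q u (m + 1) y).degree < (2 * m + 2 : ℕ) := by
      refine (degree_sum_le _ _).trans_lt ((Finset.sup_lt_iff (WithBot.bot_lt_coe _)).2 ?_)
      intro i hi
      have hi := Finset.mem_range.1 hi
      refine (degree_smul_le _ _).trans_lt ((degree_sub_le _ _).trans_lt (max_lt ?_ ?_)) <;>
      exact (degree_smul_le _ _).trans_lt (hQd (by omega))
    refine (degree_sub_le _ _).trans_lt (max_lt hK
      ((degree_add_le _ _).trans_lt (max_lt ?_ ?_)))
    · refine (degree_smul_le _ _).trans_lt ?_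
      rw [kernelSPoly, map_sum]
      refine (degree_sum_le _ _).trans_lt ((Finset.sup_lt_iff (WithBot.bot_lt_coe _)).2 ?_)
      intro i hi
      have hi := Finset.mem_range.1 hi
      rw [map_smul]
      exact (degree_smul_le _ _).trans_lt (P.degree_lt H (by omega))
    · exact (degree_smul_le _ _).trans_lt (H.degree_lt (by omega))
  · intro R hR
    have hK : h.skewForm hq0 (kernelKPoly Q u (m + 1) y) R = R.eval y := by
      have := mem_of_monic_mem hQ.monic hQ.natDegree
        (LinearMap.ker (h.skewForm hq0 (kernelKPoly Q u (m + 1) y) - (aeval y).toLinearMap))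
        (N := 2 * m + 2) (fun k hk => ?_) hR
      · rw [LinearMap.mem_ker, LinearMap.sub_apply, sub_eq_zero] at this
        rw [this]; simp [aeval_def, eval₂_eq_eval_map]
      rw [LinearMap.mem_ker, LinearMap.sub_apply, sub_eq_zero]
      have e0 : (aeval y).toLinearMap (Q k) = (Q k).eval y := by simp [aeval_def, eval₂_eq_eval_map]
      rw [e0, kernelKPoly]
      simp only [map_sum, LinearMap.sum_apply, map_smul, map_sub, LinearMap.smul_apply,
        LinearMap.sub_apply, smul_eq_mul]
      obtain ⟨j, rfl | rfl⟩ := Nat.even_or_odd' k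
      · rw [Finset.sum_eq_single_of_mem j (Finset.mem_range.2 (by omega))]
        · rw [h.skewForm_swap hq0 (Q (2 * j + 1))]
          simp only [h.skewForm_apply, hQ.even_even, hQ.even_odd, if_true]
          have := hQ.norm_ne_zero j
          field_simp; ring
        · intro i _ hij
          rw [h.skewForm_swap hq0 (Q (2 * i + 1))]
          simp only [h.skewForm_apply, hQ.even_even, hQ.even_odd, hij.symm, if_false]
          ring
      · rw [Finset.sum_eq_single_of_mem j (Finset.mem_range.2 (by omega))]
        · simp only [h.skewForm_apply, hQ.odd_odd, hQ.even_odd, if_true]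
          have := hQ.norm_ne_zero j
          field_simp; ring
        · intro i _ hij
          simp only [h.skewForm_apply, hQ.odd_odd, hQ.even_odd, hij, if_false]
          ring
    have hR' : h.skewForm hq0 (((1 + √q) ^ 2)⁻¹ • W.opAPoly q (W.kernelSPoly q p (2 * m + 1) y) +
        (W.gamma q p (2 * m) * (p (2 * m + 1)).eval y) • p (2 * m)) R = R.eval y := by
      have := mem_of_monic_mem H.monic H.natDegree
        (LinearMap.ker (h.skewForm hq0 (((1 + √q) ^ 2)⁻¹ •
          W.opAPoly q (W.kernelSPoly q p (2 * m + 1) y) +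
          (W.gamma q p (2 * m) * (p (2 * m + 1)).eval y) • p (2 * m)) - (aeval y).toLinearMap))
        (N := 2 * m + 2) (fun k hk => ?_) hR
      · rw [LinearMap.mem_ker, LinearMap.sub_apply, sub_eq_zero] at this
        rw [this]; simp [aeval_def, eval₂_eq_eval_map]
      rw [LinearMap.mem_ker, LinearMap.sub_apply, sub_eq_zero]
      have e0 : (aeval y).toLinearMap (p k) = (p k).eval y := by simp [aeval_def, eval₂_eq_eval_map]
      rw [e0, map_add, LinearMap.add_apply, map_smul, map_smul, LinearMap.smul_apply,
        LinearMap.smul_apply, P.map, smul_eq_mul, smul_eq_mul, inv_mul_cancel_left₀ hκ, kernelSPoly,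
        Finset.sum_mul, map_sum]
      simp only [smul_mul_assoc, map_smul, smul_eq_mul]
      -- For indices up to `2m` the Christoffel–Darboux part reproduces and `p (2m)` contributes
      -- nothing. At the top index `2m + 1` the roles are exchanged, and `γ_{2m}` is exactly the
      -- factor that normalizes the skew product of `p (2m)` with `p (2m + 1)`.
      rcases (Nat.lt_succ_iff.1 hk).eq_or_lt with rfl | hlt
      · rw [Finset.sum_eq_zero, P.even_succ H ha, h.gamma_eq hq0 hq1 hp]
        · have h1 := H.ne_zero (2 * m)
          have h2 := ha (2 * m)
          field_simp
          ring
        · intro i hi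
          have hi := Finset.mem_range.1 hi
          rw [H.orthogonal _ _ (by omega), mul_zero]
      · rw [P.even_eq_zero H ha m (H.degree_lt hlt),
          Finset.sum_eq_single_of_mem k (Finset.mem_range.2 hlt), H.norm]
        · have h1 := H.ne_zero k
          field_simp; ring
        · intro i _ hik
          rw [H.orthogonal _ _ hik, mul_zero]
    rw [map_sub, LinearMap.sub_apply, hK, hR', sub_self]

theorem IsClassical.kernelJ_eq (h : W.IsClassical q) (hq0 : 0 < q) (hq1 : q < 1)
    (hp : W.IsMonicOP q p) {Q : ℕ → ℝ[X]} {u : ℕ → ℝ} (hQ : W.IsMonicSOP q Q u) {n : ℕ}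
    (hn : 1 ≤ n) {x : ℝ} (hx : x ∈ W.supp.lattice q) (y : ℝ) :
    W.kernelJ q Q u n x y = W.ρ x / W.ω x * W.kernelS q p (2 * n - 1) x y +
      W.gamma q p (2 * n - 2) * W.opS q (fun z => (p (2 * n - 2)).eval z) x *
        (p (2 * n - 1)).eval y := by
  obtain ⟨m, rfl⟩ : ∃ m, n = m + 1 := ⟨n - 1, by omega⟩
  have e1 : 2 * (m + 1) - 1 = 2 * m + 1 := by omega
  have e2 : 2 * (m + 1) - 2 = 2 * m := by omega
  rw [e1, e2, kernelJ]
  simp only [← eval_kernelKPoly]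
  rw [← h.opSLin_apply, h.kernelKPoly_eq hq0 hq1 hp hQ, map_add, map_smul, map_smul,
    h.opSLin_apply, h.opSLin_apply, h.opS_opA hq0 hq1 _ hx, eval_kernelSPoly, smul_eq_mul,
    smul_eq_mul, inv_mul_cancel_left₀ (by positivity)]
  ring

end Weight

end QEnsemble

end

noncomputable section

namespace QEnsemble

open Filter Topology

/-! ### Infinite shifted factorials -/

variable {r : ℝ}

lemma summable_norm_mul_pow (hr0 : 0 < r) (hr1 : r < 1) (a : ℝ) :
    Summable fun k : ℕ => ‖-(a * r ^ k)‖ := by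
  have := ((summable_geometric_of_lt_one hr0.le hr1).mul_left a).norm
  simpa using this

lemma multipliable_poch (hr0 : 0 < r) (hr1 : r < 1) (a : ℝ) :
    Multipliable fun k : ℕ => 1 - a * r ^ k := by
  simpa [sub_eq_add_neg] using multipliable_one_add_of_summable (summable_norm_mul_pow hr0 hr1 a)

lemma tendsto_pochFin (hr0 : 0 < r) (hr1 : r < 1) (a : ℝ) :
    Tendsto (pochFin a r) atTop (𝓝 (pochInf a r)) :=
  (multipliable_poch hr0 hr1 a).tendsto_prod_tprod_nat

lemma pochFin_zero (a r : ℝ) : pochFin a r 0 = 1 := by simp [pochFin]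

lemma pochFin_succ (a r : ℝ) (n : ℕ) :
    pochFin a r (n + 1) = pochFin a r n * (1 - a * r ^ n) := Finset.prod_range_succ _ _

lemma pochFin_succ' (a r : ℝ) (n : ℕ) :
    pochFin a r (n + 1) = (1 - a) * pochFin (a * r) r n := by
  rw [pochFin, Finset.prod_range_succ', pochFin, mul_comm]
  simp only [pow_zero, mul_one, pow_succ', mul_assoc]

lemma pochInf_eq_pochFin_mul (hr0 : 0 < r) (hr1 : r < 1) (a : ℝ) (n : ℕ) :
    pochInf a r = pochFin a r n * pochInf (a * r ^ n) r := by
  have e : (fun k => 1 - a * r ^ (k + n)) = fun k => 1 - a * r ^ n * r ^ k := by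
    ext k; rw [pow_add]; ring
  have h := (e ▸ multipliable_poch hr0 hr1 (a * r ^ n) :
    Multipliable fun k => 1 - a * r ^ (k + n))
  have := Multipliable.prod_mul_tprod_nat_mul' (f := fun k => 1 - a * r ^ k) h
  rw [e] at this
  exact this.symm

lemma pochInf_eq_mul (hr0 : 0 < r) (hr1 : r < 1) (a : ℝ) :
    pochInf a r = (1 - a) * pochInf (a * r) r := by
  rw [pochInf_eq_pochFin_mul hr0 hr1 a 1, pochFin_succ, pochFin_zero]; simp

lemma pochInf_zero (r : ℝ) : pochInf 0 r = 1 := by simp [pochInf]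

lemma continuous_pochInf (hr0 : 0 < r) (hr1 : r < 1) : Continuous fun a => pochInf a r := by
  rw [continuous_iff_continuousAt]
  intro a
  have h := tendsto_tprod_one_add_of_dominated_convergence (𝓕 := 𝓝 a)
    (f := fun (b : ℝ) (k : ℕ) => -(b * r ^ k)) (g := fun k => -(a * r ^ k))
    (bound := fun k => (|a| + 1) * r ^ k)
    ((summable_geometric_of_lt_one hr0.le hr1).mul_left _)
    (fun k => ((continuous_id.mul continuous_const).neg).tendsto a) ?_
  · simpa [pochInf, ContinuousAt, sub_eq_add_neg] using h
  · filter_upwards [Metric.ball_mem_nhds a one_pos] with b hb k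
    rw [norm_neg, norm_mul, norm_pow, Real.norm_of_nonneg hr0.le]
    refine mul_le_mul_of_nonneg_right ?_ (by positivity)
    have h1 : ‖b - a‖ < 1 := by simpa [dist_eq_norm] using hb
    have h2 := norm_sub_norm_le b a
    rw [Real.norm_eq_abs a] at h2
    linarith

lemma mul_pow_lt_one (hr0 : 0 < r) (hr1 : r < 1) {a : ℝ} (ha : a < 1) (k : ℕ) :
    a * r ^ k < 1 := by
  have h1 : 0 < r ^ k := pow_pos hr0 k
  have h2 : r ^ k ≤ 1 := pow_le_one₀ hr0.le hr1.le
  nlinarith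

lemma pochFin_pos (hr0 : 0 < r) (hr1 : r < 1) {a : ℝ} (ha : a < 1) (n : ℕ) : 0 < pochFin a r n :=
  Finset.prod_pos fun k _ => sub_pos.2 (mul_pow_lt_one hr0 hr1 ha k)

/-- As a limit of positive partial products it is nonnegative, and an infinite product of nonzero
factors with summable deviations from `1` does not vanish. -/
lemma pochInf_pos (hr0 : 0 < r) (hr1 : r < 1) {a : ℝ} (ha : a < 1) : 0 < pochInf a r := by
  refine lt_of_le_of_ne (ge_of_tendsto' (tendsto_pochFin hr0 hr1 a)
    fun n => (pochFin_pos hr0 hr1 ha n).le) (Ne.symm ?_)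
  have := tprod_one_add_ne_zero_of_summable (f := fun k : ℕ => -(a * r ^ k))
    (fun k => by have := mul_pow_lt_one hr0 hr1 ha k; rw [← sub_eq_add_neg]; linarith)
    (summable_norm_mul_pow hr0 hr1 a)
  simpa [pochInf, sub_eq_add_neg] using this

lemma pochFin_anti (hr0 : 0 < r) (hr1 : r < 1) {a b : ℝ} (hab : a ≤ b) (hb : b ≤ 1) (n : ℕ) :
    pochFin b r n ≤ pochFin a r n := by
  refine Finset.prod_le_prod (fun k _ => ?_) fun k _ => ?_
  · have h1 : 0 < r ^ k := pow_pos hr0 k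
    have h2 : r ^ k ≤ 1 := pow_le_one₀ hr0.le hr1.le
    nlinarith
  · have h1 : 0 < r ^ k := pow_pos hr0 k
    nlinarith

lemma pochInf_anti (hr0 : 0 < r) (hr1 : r < 1) {a b : ℝ} (hab : a ≤ b) (hb : b ≤ 1) :
    pochInf b r ≤ pochInf a r :=
  le_of_tendsto_of_tendsto' (tendsto_pochFin hr0 hr1 b) (tendsto_pochFin hr0 hr1 a)
    fun n => pochFin_anti hr0 hr1 hab hb n

lemma one_le_pochInf (hr0 : 0 < r) (hr1 : r < 1) {a : ℝ} (ha : a ≤ 0) : 1 ≤ pochInf a r := by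
  have := pochInf_anti hr0 hr1 ha zero_le_one
  rwa [pochInf_zero] at this

lemma pochInf_le_one (hr0 : 0 < r) (hr1 : r < 1) {a : ℝ} (ha : 0 ≤ a) (ha1 : a ≤ 1) :
    pochInf a r ≤ 1 := by
  have := pochInf_anti hr0 hr1 ha ha1
  rwa [pochInf_zero] at this

lemma pochFin_le_pochInf (hr0 : 0 < r) (hr1 : r < 1) {a : ℝ} (ha : a ≤ 0) (n : ℕ) :
    pochFin a r n ≤ pochInf a r := by
  rw [pochInf_eq_pochFin_mul hr0 hr1 a n]
  refine le_mul_of_one_le_right (pochFin_pos hr0 hr1 (by linarith) n).le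
    (one_le_pochInf hr0 hr1 ?_)
  exact mul_nonpos_of_nonpos_of_nonneg ha (pow_pos hr0 n).le

lemma pochInf_le_pochFin (hr0 : 0 < r) (hr1 : r < 1) {a : ℝ} (ha : 0 ≤ a) (ha1 : a ≤ 1) (n : ℕ) :
    pochInf a r ≤ pochFin a r n := by
  have h0 : 0 ≤ pochFin a r n := Finset.prod_nonneg fun k _ => by
    have h1 : 0 < r ^ k := pow_pos hr0 k
    have h2 : r ^ k ≤ 1 := pow_le_one₀ hr0.le hr1.le
    nlinarith
  rw [pochInf_eq_pochFin_mul hr0 hr1 a n]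
  refine mul_le_of_le_one_right h0 (pochInf_le_one hr0 hr1 (by positivity) ?_)
  have h2 : r ^ n ≤ 1 := pow_le_one₀ hr0.le hr1.le
  have h3 : 0 < r ^ n := pow_pos hr0 n
  nlinarith

lemma abs_pochFin_le (hr0 : 0 < r) (hr1 : r < 1) (a : ℝ) (n : ℕ) :
    |pochFin a r n| ≤ pochInf (-|a|) r := by
  refine le_trans ?_ (pochFin_le_pochInf hr0 hr1 (neg_nonpos.2 (abs_nonneg a)) n)
  rw [pochFin, Finset.abs_prod]
  refine Finset.prod_le_prod (fun k _ => abs_nonneg _) fun k _ => ?_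
  refine (abs_sub _ _).trans ?_
  rw [abs_one, abs_mul, abs_of_pos (pow_pos hr0 k)]
  linarith

lemma abs_pochInf_le (hr0 : 0 < r) (hr1 : r < 1) (a : ℝ) : |pochInf a r| ≤ pochInf (-|a|) r :=
  le_of_tendsto' (tendsto_pochFin hr0 hr1 a).abs fun n => abs_pochFin_le hr0 hr1 a n

lemma abs_pochInf_le_of_abs_le (hr0 : 0 < r) (hr1 : r < 1) {a b : ℝ} (h : |a| ≤ b) :
    |pochInf a r| ≤ pochInf (-b) r :=
  (abs_pochInf_le hr0 hr1 a).trans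
    (pochInf_anti hr0 hr1 (by linarith) (by linarith [abs_nonneg a]))

/-- Splitting an infinite product with base `r` into its even and odd factors. -/
lemma pochInf_sqrt {q : ℝ} (hq0 : 0 < q) (hq1 : q < 1) (a : ℝ) :
    pochInf a √q = pochInf a q * pochInf (a * √q) q := by
  have h2 : ∀ k : ℕ, √q ^ (2 * k) = q ^ k := fun k => by rw [pow_mul, Real.sq_sqrt hq0.le]
  have e1 : (fun k : ℕ => 1 - a * √q ^ (2 * k)) = fun k => 1 - a * q ^ k := by
    ext k; rw [h2]
  have e2 : (fun k : ℕ => 1 - a * √q ^ (2 * k + 1)) = fun k => 1 - a * √q * q ^ k := by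
    ext k; rw [pow_succ, h2]; ring
  have := tprod_even_mul_odd (f := fun k : ℕ => 1 - a * √q ^ k)
    (by rw [e1]; exact multipliable_poch hq0 hq1 a)
    (by rw [e2]; exact multipliable_poch hq0 hq1 _)
  rw [e1, e2] at this
  exact this.symm

/-! ### The `q`-binomial theorem -/

lemma summable_qBinomial (hr0 : 0 < r) (hr1 : r < 1) (a : ℝ) {z : ℝ} (hz0 : 0 ≤ z) (hz1 : z < 1) :
    Summable fun k : ℕ => pochFin a r k / pochFin r r k * z ^ k := by
  refine Summable.of_norm_bounded (g := fun k => pochInf (-|a|) r / pochInf r r * z ^ k)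
    ((summable_geometric_of_lt_one hz0 hz1).mul_left _) fun k => ?_
  have h1 := abs_pochFin_le hr0 hr1 a k
  have h2 := pochInf_le_pochFin hr0 hr1 hr0.le hr1.le k
  have h3 := pochInf_pos hr0 hr1 hr1
  have h4 := pochFin_pos hr0 hr1 hr1 k
  rw [norm_mul, norm_div, Real.norm_eq_abs, Real.norm_of_nonneg h4.le,
    Real.norm_of_nonneg (pow_nonneg hz0 k)]
  refine mul_le_mul_of_nonneg_right ?_ (pow_nonneg hz0 k)
  exact div_le_div₀ ((abs_nonneg _).trans h1) h1 h3 h2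

/-- Comparison of coefficients of the series: the ratio of consecutive coefficients is `(1 - a r ^
k) / (1 - r ^ (k + 1))`. -/
lemma qBinomial_step (hr0 : 0 < r) (hr1 : r < 1) (a : ℝ) {z : ℝ} (hz0 : 0 ≤ z) (hz1 : z < 1) :
    (1 - z) * ∑' k : ℕ, pochFin a r k / pochFin r r k * z ^ k =
      (1 - a * z) * ∑' k : ℕ, pochFin a r k / pochFin r r k * (z * r) ^ k := by
  have hzr0 : 0 ≤ z * r := by positivity
  have hzr1 : z * r < 1 := by nlinarith
  have s1 := summable_qBinomial hr0 hr1 a hz0 hz1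
  have s2 := summable_qBinomial hr0 hr1 a hzr0 hzr1
  have t1 : ∀ k : ℕ, pochFin a r (k + 1) / pochFin r r (k + 1) * z ^ (k + 1) -
      pochFin a r (k + 1) / pochFin r r (k + 1) * (z * r) ^ (k + 1) =
      z * (pochFin a r k / pochFin r r k * z ^ k) -
        a * z * (pochFin a r k / pochFin r r k * (z * r) ^ k) := by
    intro k
    have h4 := (pochFin_pos hr0 hr1 hr1 k).ne'
    have h5 := (pochFin_pos hr0 hr1 hr1 (k + 1)).ne'
    rw [pochFin_succ] at h5
    have h6 : 1 - r * r ^ k ≠ 0 := right_ne_zero_of_mul h5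
    rw [pochFin_succ, pochFin_succ, mul_pow, mul_pow, pow_succ r k]
    generalize r ^ k = P at *
    have h7 : 1 - P * r ≠ 0 := by rwa [mul_comm P]
    field_simp
    ring
  have e1 := s1.tsum_eq_zero_add
  have e2 := s2.tsum_eq_zero_add
  have s1' := (summable_nat_add_iff 1).2 s1
  have s2' := (summable_nat_add_iff 1).2 s2
  have e3 := s1'.tsum_sub s2'
  rw [tsum_congr t1, (s1.mul_left z).tsum_sub (s2.mul_left (a * z)), tsum_mul_left,
    tsum_mul_left] at e3
  simp only [pow_zero, pochFin_zero] at e1 e2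
  linarith

/-- The `q`-binomial theorem. -/
lemma qBinomial (hr0 : 0 < r) (hr1 : r < 1) (a : ℝ) {z : ℝ} (hz0 : 0 ≤ z) (hz1 : z < 1) :
    ∑' k : ℕ, pochFin a r k / pochFin r r k * z ^ k = pochInf (a * z) r / pochInf z r := by
  set F : ℝ → ℝ := fun z => ∑' k : ℕ, pochFin a r k / pochFin r r k * z ^ k with hF
  -- Iterating the functional equation moves the argument to `z r ^ N → 0`, where the series tends
  -- to its constant term `1`.
  have hit : ∀ N : ℕ, pochFin z r N * F z = pochFin (a * z) r N * F (z * r ^ N) := by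
    intro N
    induction N with
    | zero => simp [pochFin_zero]
    | succ N ih =>
      have h1 : 0 ≤ z * r ^ N := by positivity
      have h3 := qBinomial_step hr0 hr1 a h1 (mul_pow_lt_one hr0 hr1 hz1 N)
      rw [pochFin_succ, pochFin_succ, mul_right_comm, ih]
      have h4 : (1 - z * r ^ N) * F (z * r ^ N) = (1 - a * (z * r ^ N)) * F (z * r ^ N * r) := h3
      rw [pow_succ, ← mul_assoc z]
      linear_combination pochFin (a * z) r N * h4
  have hlim : Tendsto (fun N : ℕ => F (z * r ^ N)) atTop (𝓝 1) := by
    have hb := summable_qBinomial hr0 hr1 a hz0 hz1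
    have h := tendsto_tsum_of_dominated_convergence (𝓕 := atTop)
      (f := fun (N k : ℕ) => pochFin a r k / pochFin r r k * (z * r ^ N) ^ k)
      (g := fun k => if k = 0 then 1 else 0) hb.norm ?_ ?_
    · simpa using h
    · intro k
      rcases k with _ | k
      · simp [pochFin_zero]
      · have h1 : Tendsto (fun N : ℕ => z * r ^ N) atTop (𝓝 0) := by
          simpa using (tendsto_pow_atTop_nhds_zero_of_lt_one hr0.le hr1).const_mul z
        simpa using (h1.pow (k + 1)).const_mul (pochFin a r (k + 1) / pochFin r r (k + 1))
    · refine Eventually.of_forall fun N k => ?_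
      rw [norm_mul, norm_mul]
      refine mul_le_mul_of_nonneg_left ?_ (norm_nonneg _)
      rw [norm_pow, norm_pow, norm_mul]
      refine pow_le_pow_left₀ (by positivity) ?_ k
      refine mul_le_of_le_one_right (norm_nonneg _) ?_
      rw [norm_pow, Real.norm_of_nonneg hr0.le]
      exact pow_le_one₀ hr0.le hr1.le
  have h1 := (tendsto_pochFin hr0 hr1 z).mul_const (F z)
  have h2 := (tendsto_pochFin hr0 hr1 (a * z)).mul hlim
  rw [mul_one] at h2
  have h3 := tendsto_nhds_unique (h1.congr hit) h2
  rw [eq_div_iff (pochInf_pos hr0 hr1 hz1).ne', mul_comm]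
  exact h3

/-! ### A bilateral sum -/

/-- Growth faster than any power, by induction on `(-x; r)_∞ = (1 + x) (-x r; r)_∞`: each
application gains one factor `x`. -/
lemma exists_le_pochInf_neg (hr0 : 0 < r) (hr1 : r < 1) (K : ℕ) :
    ∃ C > 0, ∀ x : ℝ, 0 ≤ x → C * x ^ K ≤ pochInf (-x) r := by
  induction K with
  | zero => exact ⟨1, one_pos, fun x hx => by
      simpa using one_le_pochInf hr0 hr1 (neg_nonpos.2 hx)⟩
  | succ K ih =>
    obtain ⟨C, hC, h⟩ := ih
    refine ⟨C * r ^ K, by positivity, fun x hx => ?_⟩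
    have h1 := h (x * r) (by positivity)
    rw [pochInf_eq_mul hr0 hr1, neg_mul, sub_neg_eq_add]
    calc C * r ^ K * x ^ (K + 1) = x * (C * (x * r) ^ K) := by rw [mul_pow]; ring
      _ ≤ (1 + x) * pochInf (-(x * r)) r :=
        mul_le_mul (by linarith) h1 (by positivity) (by linarith)

/-- The step `t` is kept apart from the base `r`, since for the `q`-Laguerre weight `ω` has base `q`
but is summed over the `√q`-lattice. Towards `-∞` a power `K` with `t ^ K < z` beats the growth of
`z ^ n`. -/
lemma summable_bilateral {t : ℝ} (hr0 : 0 < r) (hr1 : r < 1) (ht0 : 0 < t) (ht1 : t < 1) {z : ℝ}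
    (hz0 : 0 < z) (hz1 : z < 1) : Summable fun n : ℤ => z ^ n / pochInf (-t ^ n) r := by
  have hpos : ∀ n : ℤ, 1 ≤ pochInf (-t ^ n) r := fun n =>
    one_le_pochInf hr0 hr1 (neg_nonpos.2 (zpow_pos ht0 n).le)
  refine Summable.of_nat_of_neg ?_ ?_
  · refine Summable.of_nonneg_of_le (fun n => ?_) (fun n => ?_)
      (summable_geometric_of_lt_one hz0.le hz1)
    · exact div_nonneg (zpow_pos hz0 _).le (zero_le_one.trans (hpos n))
    · rw [zpow_natCast]
      exact div_le_self (by positivity) (hpos n)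
  · obtain ⟨K, hK⟩ := exists_pow_lt_of_lt_one hz0 ht1
    obtain ⟨C, hC, h⟩ := exists_le_pochInf_neg hr0 hr1 K
    have hg : t ^ K / z < 1 := (div_lt_one hz0).2 hK
    refine Summable.of_nonneg_of_le (fun n => ?_) (fun n => ?_)
      ((summable_geometric_of_lt_one (by positivity) hg).mul_left C⁻¹)
    · exact div_nonneg (zpow_pos hz0 _).le (zero_le_one.trans (hpos _))
    · have h1 := h (t ^ (-(n : ℤ))) (zpow_pos ht0 _).le
      refine (div_le_div_of_nonneg_left (zpow_pos hz0 _).le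
        (mul_pos hC (pow_pos (zpow_pos ht0 _) K)) h1).trans_eq ?_
      rw [zpow_neg, zpow_neg, zpow_natCast, zpow_natCast, div_pow, ← pow_mul, mul_comm K n, pow_mul,
        inv_pow]
      field_simp

/-- Reflecting the first `M` factors of `(-z r^{-M}; r)_∞` produces `z ^ M` and a power of `r` that
does not depend on `z`. Division by the same identity at `z = 1` removes that power. -/
lemma pochInf_reflect (hr0 : 0 < r) (hr1 : r < 1) {z : ℝ} (hz : z ≠ 0) (M : ℕ) :
    pochInf (-(z / r ^ M)) r * (pochFin (-r) r M * pochInf (-1) r) =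
      z ^ M * (pochFin (-(r / z)) r M * pochInf (-z) r) * pochInf (-(1 / r ^ M)) r := by
  induction M with
  | zero => simp [pochFin_zero]
  | succ M ih =>
    have hr := hr0.ne'
    have hrM := pow_ne_zero M hr
    have e : ∀ w : ℝ, pochInf (-(w / r ^ (M + 1))) r =
        (1 + w / r ^ (M + 1)) * pochInf (-(w / r ^ M)) r := by
      intro w
      rw [pochInf_eq_mul hr0 hr1, sub_neg_eq_add]
      congr 2
      rw [pow_succ]; field_simp
    rw [e, e, pochFin_succ, pochFin_succ]
    have e2 : (1 + z / r ^ (M + 1)) * (1 - -r * r ^ M) =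
        z * (1 - -(r / z) * r ^ M) * (1 + 1 / r ^ (M + 1)) := by
      rw [pow_succ]; field_simp; ring
    linear_combination (pochInf (-(z / r ^ M)) r * pochFin (-r) r M * pochInf (-1) r) * e2 +
      z * (1 - -(r / z) * r ^ M) * (1 + 1 / r ^ (M + 1)) * ih

/-- Ramanujan's `₁ψ₁` sum with `a = -1`, `b = 0`. -/
lemma tsum_bilateral (hr0 : 0 < r) (hr1 : r < 1) {z : ℝ} (hz0 : 0 < z) (hz1 : z < 1) :
    ∑' n : ℤ, z ^ n / pochInf (-r ^ n) r = pochInf r r * pochInf (-(r / z)) r * pochInf (-z) r /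
      (pochInf (-r) r * pochInf (-1) r * pochInf z r) := by
  have hR := pochInf_pos hr0 hr1 hr1
  have hbase := summable_bilateral (t := r) hr0 hr1 hr0 hr1 hz0 hz1
  have hpos : ∀ n : ℤ, 0 < z ^ n / pochInf (-r ^ n) r := fun n => div_pos (zpow_pos hz0 n)
    (pochInf_pos hr0 hr1 (by have := zpow_pos hr0 n; linarith))
  -- The bilateral sum is approximated by sums over `n ≥ -M` with the extra factor `1 / (r; r)_{n +
  -- M}`. After reindexing these are `q`-binomial series with parameter `-r^{-M}`; as `M → ∞` the
  -- extra factor tends to `1 / (r; r)_∞`, which also gives the dominating series.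
  set f : ℕ → ℤ → ℝ := fun M n =>
    if -(M : ℤ) ≤ n then z ^ n / pochInf (-r ^ n) r / pochFin r r (n + M).toNat else 0 with hf
  have hM : ∀ M : ℕ, ∑' n, f M n = pochFin (-(r / z)) r M * pochInf (-z) r /
      (pochFin (-r) r M * pochInf (-1) r * pochInf z r) := by
    intro M
    have hinj : Function.Injective fun k : ℕ => (k : ℤ) - M := fun a b h => by simpa using h
    rw [← hinj.tsum_eq]
    · have h1 := pochInf_pos (a := -(1 / r ^ M)) hr0 hr1
        (by have : 0 < 1 / r ^ M := by positivity
            linarith)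
      have hterm : ∀ k : ℕ, f M ((k : ℤ) - M) = (z ^ M * pochInf (-(1 / r ^ M)) r)⁻¹ *
          (pochFin (-(1 / r ^ M)) r k / pochFin r r k * z ^ k) := by
        intro k
        have e1 : ((k : ℤ) - M + M).toNat = k := by simp
        have e2 : -r ^ ((k : ℤ) - M) = -(1 / r ^ M) * r ^ k := by
          rw [zpow_sub₀ hr0.ne', zpow_natCast, zpow_natCast]; ring
        have h2 := pochInf_eq_pochFin_mul hr0 hr1 (-(1 / r ^ M)) k
        have h3 : pochInf (-(1 / r ^ M) * r ^ k) r ≠ 0 := by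
          intro h0; rw [h0, mul_zero] at h2; exact h1.ne' h2
        have h4 := (pochFin_pos hr0 hr1 hr1 k).ne'
        have h5 : pochFin (-(1 / r ^ M)) r k ≠ 0 := by
          intro h0; rw [h0, zero_mul] at h2; exact h1.ne' h2
        simp only [hf]
        rw [if_pos (by omega), e1, e2, h2, zpow_sub₀ hz0.ne', zpow_natCast, zpow_natCast]
        field_simp
      simp only [hterm]
      rw [tsum_mul_left, qBinomial hr0 hr1 _ hz0.le hz1]
      have h6 := pochInf_reflect hr0 hr1 hz0.ne' M
      have h7 := (pochFin_pos (a := -r) hr0 hr1 (by linarith) M).ne'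
      have h8 := (pochInf_pos (a := -1) hr0 hr1 (by linarith)).ne'
      have h9 := (pochInf_pos hr0 hr1 hz1).ne'
      have e : -(1 / r ^ M) * z = -(z / r ^ M) := by ring
      have h10 := h1.ne'
      have hzM := pow_ne_zero M hz0.ne'
      rw [e, inv_mul_eq_div, div_div, div_eq_div_iff (by positivity) (by positivity)]
      linear_combination pochInf z r * h6
    · intro n hn
      by_contra hcon
      apply hn
      simp only [hf]
      rw [if_neg]
      intro h
      exact hcon ⟨(n + M).toNat, by
        have := Int.toNat_of_nonneg (show 0 ≤ n + M by omega)
        simp only [this]; ring⟩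
  have hlim : Tendsto (fun M => ∑' n, f M n) atTop
      (𝓝 (∑' n : ℤ, z ^ n / pochInf (-r ^ n) r / pochInf r r)) := by
    refine tendsto_tsum_of_dominated_convergence (hbase.div_const (pochInf r r)) (fun n => ?_)
      (Eventually.of_forall fun M n => ?_)
    · have h1 : Tendsto (fun M : ℕ => (n + (M : ℤ)).toNat) atTop atTop := by
        refine tendsto_atTop.2 fun b => ?_
        filter_upwards [eventually_ge_atTop (b + (-n).toNat)] with M hM'
        omega
      have h2 := (tendsto_const_nhds (x := z ^ n / pochInf (-r ^ n) r)).div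
        ((tendsto_pochFin hr0 hr1 r).comp h1) hR.ne'
      refine h2.congr' ?_
      filter_upwards [eventually_ge_atTop (-n).toNat] with M hM'
      simp only [hf]
      rw [if_pos (by omega)]
      rfl
    · simp only [hf]
      split_ifs
      · have h4 := pochFin_pos hr0 hr1 hr1 (n + M).toNat
        rw [Real.norm_of_nonneg (div_nonneg (hpos n).le h4.le)]
        exact div_le_div_of_nonneg_left (hpos n).le hR
          (pochInf_le_pochFin hr0 hr1 hr0.le hr1.le _)
      · rw [norm_zero]; exact div_nonneg (hpos n).le hR.le
  have hlim2 : Tendsto (fun M => ∑' n, f M n) atTop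
      (𝓝 (pochInf (-(r / z)) r * pochInf (-z) r / (pochInf (-r) r * pochInf (-1) r * pochInf z r))) := by
    simp only [hM]
    refine ((tendsto_pochFin hr0 hr1 _).mul_const _).div
      (((tendsto_pochFin hr0 hr1 _).mul_const _).mul_const _) ?_
    have h7 := (pochInf_pos (a := -r) hr0 hr1 (by linarith)).ne'
    have h8 := (pochInf_pos (a := -1) hr0 hr1 (by linarith)).ne'
    have h9 := (pochInf_pos hr0 hr1 hz1).ne'
    positivity
  have := tendsto_nhds_unique hlim hlim2
  rw [tsum_div_const, div_eq_iff hR.ne'] at this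
  rw [this]; ring

end QEnsemble

end

noncomputable section

namespace QEnsemble

open Filter Topology

variable {r : ℝ}

/-! ### The two-sided Jackson integral of Andrews and Askey -/

lemma tendsto_mul_pow (hr0 : 0 < r) (hr1 : r < 1) (b : ℝ) :
    Tendsto (fun n : ℕ => b * r ^ n) atTop (𝓝 0) := by
  simpa using (tendsto_pow_atTop_nhds_zero_of_lt_one hr0.le hr1).const_mul b

/-- Only boundedness of `w` near `0` matters; finitely many terms may be arbitrary. Continuity at
`0` is thus the natural hypothesis for weights that are quotients of infinite products. -/
lemma summable_jackson (hr0 : 0 < r) (hr1 : r < 1) (b : ℝ) {w : ℝ → ℝ} (hw : ContinuousAt w 0) :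
    Summable fun n : ℕ => b * r ^ n * w (b * r ^ n) := by
  refine summable_of_isBigO_nat (summable_geometric_of_lt_one hr0.le hr1) ?_
  have h1 : (fun n : ℕ => w (b * r ^ n)) =O[atTop] fun _ => (1 : ℝ) :=
    (hw.tendsto.comp (tendsto_mul_pow hr0 hr1 b)).isBigO_one ℝ
  have h2 : (fun n : ℕ => b * r ^ n) =O[atTop] fun n => r ^ n :=
    (Asymptotics.isBigO_refl _ _).const_mul_left b
  simpa using h2.mul h1

lemma jackson_linear (hr0 : 0 < r) (hr1 : r < 1) (b c d : ℝ) {v w : ℝ → ℝ}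
    (hv : ContinuousAt v 0) (hw : ContinuousAt w 0) :
    jackson r b (fun t => c * v t + d * w t) = c * jackson r b v + d * jackson r b w := by
  unfold jackson
  have e : ∀ n : ℕ, b * r ^ n * (c * v (b * r ^ n) + d * w (b * r ^ n)) =
      c * (b * r ^ n * v (b * r ^ n)) + d * (b * r ^ n * w (b * r ^ n)) := fun n => by ring
  rw [tsum_congr e, ((summable_jackson hr0 hr1 b hv).mul_left c).tsum_add
    ((summable_jackson hr0 hr1 b hw).mul_left d), tsum_mul_left, tsum_mul_left]
  ring

lemma jackson_congr {b : ℝ} {v w : ℝ → ℝ} (h : ∀ n : ℕ, v (b * r ^ n) = w (b * r ^ n)) :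
    jackson r b v = jackson r b w := by
  unfold jackson
  simp only [h]

/-- The weight `(r t, r t / α; r)_∞ / (A t, B t; r)_∞`. -/
def askeyWeight (r A B α t : ℝ) : ℝ :=
  pochInf (r * t) r * pochInf (r * t / α) r / (pochInf (A * t) r * pochInf (B * t) r)

/-- The Jackson integral of `askeyWeight` from `α` to `1`. -/
def askeyInt (r A B α : ℝ) : ℝ :=
  jackson r 1 (askeyWeight r A B α) - jackson r α (askeyWeight r A B α)

lemma continuousAt_askeyWeight (hr0 : 0 < r) (hr1 : r < 1) (A B α : ℝ) :
    ContinuousAt (askeyWeight r A B α) 0 := by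
  have hc := continuous_pochInf hr0 hr1
  unfold askeyWeight
  refine ContinuousAt.div ?_ ?_ ?_
  · exact ((hc.comp (continuous_const.mul continuous_id)).mul
      (hc.comp ((continuous_const.mul continuous_id).div_const α))).continuousAt
  · exact ((hc.comp (continuous_const.mul continuous_id)).mul
      (hc.comp (continuous_const.mul continuous_id))).continuousAt
  · simp [pochInf_zero]

lemma pochInf_mul_pow_ne_zero (hr0 : 0 < r) (hr1 : r < 1) {A b : ℝ} (h : A * b < 1) (n : ℕ) :
    pochInf (A * (b * r ^ n)) r ≠ 0 := by
  rw [← mul_assoc]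
  exact (pochInf_pos hr0 hr1 (mul_pow_lt_one hr0 hr1 h n)).ne'

/-- The integrand is the difference quotient of `V(t) = (1 - t)(1 - t/α) w(t)`, since `V(r t) = (1 -
A t)(1 - B t) w(t)`. `V` vanishes at both end points `1` and `α`, and `V(0) = 1`. -/
lemma jackson_askey_telescope (hr0 : 0 < r) (hr1 : r < 1) {A B α b : ℝ} (hα : α ≠ 0)
    (hb : b = 1 ∨ b = α) (hA : A * b < 1) (hB : B * b < 1) :
    jackson r b (fun t => (1 / α - A * B) * (t * askeyWeight r A B α t) +
      -(1 + 1 / α - A - B) * askeyWeight r A B α t) = -(1 - r) := by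
  set w := askeyWeight r A B α with hw
  have hcont := continuousAt_askeyWeight hr0 hr1 A B α
  set V : ℝ → ℝ := fun t => (1 - t) * (1 - t / α) * w t with hV
  have hVc : ContinuousAt V 0 :=
    (((continuous_const.sub continuous_id).mul
      (continuous_const.sub (continuous_id.div_const α))).continuousAt).mul hcont
  have hterm : ∀ n : ℕ, b * r ^ n * ((1 / α - A * B) * (b * r ^ n * w (b * r ^ n)) +
      -(1 + 1 / α - A - B) * w (b * r ^ n)) = V (b * r ^ n) - V (b * r ^ (n + 1)) := by
    intro n
    have h1 := pochInf_mul_pow_ne_zero hr0 hr1 hA n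
    have h2 := pochInf_mul_pow_ne_zero hr0 hr1 hB n
    have e1 : b * r ^ (n + 1) = r * (b * r ^ n) := by rw [pow_succ]; ring
    rw [e1]
    set t := b * r ^ n
    have f1 := pochInf_eq_mul hr0 hr1 (A * t)
    have f2 := pochInf_eq_mul hr0 hr1 (B * t)
    rw [f1] at h1
    rw [f2] at h2
    have g1 : 1 - A * t ≠ 0 := left_ne_zero_of_mul h1
    have g2 : 1 - B * t ≠ 0 := left_ne_zero_of_mul h2
    have g3 := right_ne_zero_of_mul h1
    have g4 := right_ne_zero_of_mul h2
    have hVr : V (r * t) = (1 - A * t) * (1 - B * t) * w t := by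
      have f3 := pochInf_eq_mul hr0 hr1 (r * t)
      have f4 := pochInf_eq_mul hr0 hr1 (r * t / α)
      simp only [hV, hw, askeyWeight]
      rw [f1, f2, f3, f4, show r * (r * t) = r * t * r by ring,
        show r * t * r / α = r * t / α * r by ring, show A * (r * t) = A * t * r by ring,
        show B * (r * t) = B * t * r by ring]
      generalize pochInf (A * t * r) r = PA at *
      generalize pochInf (B * t * r) r = PB at *
      generalize pochInf (r * t * r) r = PC
      generalize pochInf (r * t / α * r) r = PD
      rw [← mul_div_assoc ((1 - A * t) * (1 - B * t)), ← mul_div_assoc ((1 - r * t) * _), div_eq_div_iff (mul_ne_zero g3 g4)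
        (mul_ne_zero (mul_ne_zero g1 g3) (mul_ne_zero g2 g4))]
      ring
    rw [hVr]
    simp only [hV]
    field_simp
    ring
  have hs : Summable fun n : ℕ => V (b * r ^ n) - V (b * r ^ (n + 1)) := by
    have := summable_jackson hr0 hr1 b (w := fun t => (1 / α - A * B) * (t * w t) +
      -(1 + 1 / α - A - B) * w t) (((continuousAt_id.mul hcont).const_mul _).add
        (hcont.const_mul _))
    exact this.congr hterm
  have hlim : Tendsto (fun N : ℕ => V (b * r ^ 0) - V (b * r ^ N)) atTop
      (𝓝 (V (b * r ^ 0) - V 0)) :=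
    tendsto_const_nhds.sub (hVc.tendsto.comp (tendsto_mul_pow hr0 hr1 b))
  have hsum := tendsto_nhds_unique hs.hasSum.tendsto_sum_nat
    (hlim.congr fun N => (Finset.sum_range_sub' (fun n => V (b * r ^ n)) N).symm)
  have hV0 : V 0 = 1 := by simp [hV, hw, askeyWeight, pochInf_zero]
  have hVb : V (b * r ^ 0) = 0 := by
    rcases hb with rfl | rfl
    · simp [hV]
    · simp [hV, hα]
  unfold jackson
  rw [tsum_congr hterm, hsum, hV0, hVb]
  ring

/-- The telescoped value is the same at both end points, so it disappears from the integral from `α`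
to `1` and leaves a relation between the first two moments. -/
lemma askey_moment (hr0 : 0 < r) (hr1 : r < 1) {A B α : ℝ} (hα : α ≠ 0) (hA : A < 1)
    (hAα : A * α < 1) (hB : B < 1) (hBα : B * α < 1) :
    (1 - A * B * α) * (jackson r 1 (fun t => t * askeyWeight r A B α t) -
      jackson r α fun t => t * askeyWeight r A B α t) =
    (1 + α - (A + B) * α) * askeyInt r A B α := by
  have h1 := jackson_askey_telescope hr0 hr1 hα (Or.inl rfl) (by simpa using hA) (by simpa using hB)
  have h2 := jackson_askey_telescope hr0 hr1 hα (Or.inr rfl) hAα hBα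
  have hcont := continuousAt_askeyWeight hr0 hr1 A B α
  have hidc : ContinuousAt (fun t => t * askeyWeight r A B α t) 0 := continuousAt_id.mul hcont
  rw [jackson_linear hr0 hr1 _ _ _ hidc hcont] at h1 h2
  unfold askeyInt
  have h3 := congrArg (α * ·) (h1.trans h2.symm)
  have e : α * (1 / α) = 1 := mul_one_div_cancel hα
  linear_combination h3 - (jackson r 1 (fun t => t * askeyWeight r A B α t) -
      (jackson r α fun t => t * askeyWeight r A B α t) -
      (jackson r 1 (askeyWeight r A B α) - jackson r α (askeyWeight r A B α))) * e

/-- Replacing `A` by `A r` multiplies the weight by `1 - A t`, so the new mass is a combination of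
the first two moments. -/
lemma askeyInt_shift (hr0 : 0 < r) (hr1 : r < 1) {A B α : ℝ} (hα : α ≠ 0) (hA : A < 1)
    (hAα : A * α < 1) (hB : B < 1) (hBα : B * α < 1) :
    (1 - A * B * α) * askeyInt r (A * r) B α = (1 - A) * (1 - A * α) * askeyInt r A B α := by
  have hcont := continuousAt_askeyWeight hr0 hr1 A B α
  have key : ∀ b, A * b < 1 → jackson r b (askeyWeight r (A * r) B α) =
      1 * jackson r b (askeyWeight r A B α) + -A * jackson r b (fun t => t * askeyWeight r A B α t) := by
    intro b hb
    have hidc : ContinuousAt (fun t => t * askeyWeight r A B α t) 0 := continuousAt_id.mul hcont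
    rw [← jackson_linear hr0 hr1 b 1 (-A) hcont hidc]
    refine jackson_congr fun n => ?_
    have h1 := pochInf_mul_pow_ne_zero hr0 hr1 hb n
    set t := b * r ^ n
    have f1 := pochInf_eq_mul hr0 hr1 (A * t)
    rw [f1] at h1
    have g1 : 1 - A * t ≠ 0 := left_ne_zero_of_mul h1
    have g3 := right_ne_zero_of_mul h1
    simp only [askeyWeight]
    rw [f1, show A * r * t = A * t * r by ring]
    generalize pochInf (A * t * r) r = PA at *
    generalize pochInf (r * t) r * pochInf (r * t / α) r = PC
    have e : PC / (PA * pochInf (B * t) r) =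
        (1 - A * t) * (PC / ((1 - A * t) * PA * pochInf (B * t) r)) := by
      rw [mul_assoc (1 - A * t), ← mul_div_assoc, mul_div_mul_left _ _ g1]
    rw [e]
    ring
  have hm := askey_moment hr0 hr1 hα hA hAα hB hBα
  have e : askeyInt r (A * r) B α = askeyInt r A B α -
      A * (jackson r 1 (fun t => t * askeyWeight r A B α t) -
        jackson r α fun t => t * askeyWeight r A B α t) := by
    unfold askeyInt
    rw [key 1 (by simpa using hA), key α hAα]; ring
  rw [e]
  linear_combination -A * hm

lemma askeyInt_comm (r A B α : ℝ) : askeyInt r A B α = askeyInt r B A α := by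
  have : askeyWeight r A B α = askeyWeight r B A α := by
    ext t; unfold askeyWeight; rw [mul_comm (pochInf (A * t) r)]
  unfold askeyInt
  rw [this]

lemma askeyInt_shift_pow (hr0 : 0 < r) (hr1 : r < 1) {A B α : ℝ} (hα : α ≠ 0) (hA : A < 1)
    (hAα : A * α < 1) (hB : B < 1) (hBα : B * α < 1) (N : ℕ) :
    pochFin (A * B * α) r N * askeyInt r (A * r ^ N) B α =
      pochFin A r N * pochFin (A * α) r N * askeyInt r A B α := by
  induction N with
  | zero => simp [pochFin_zero]
  | succ N ih =>
    have h1 := askeyInt_shift hr0 hr1 hα (mul_pow_lt_one hr0 hr1 hA N)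
      (by rw [mul_right_comm]; exact mul_pow_lt_one hr0 hr1 hAα N) hB hBα
    rw [pochFin_succ, pochFin_succ, pochFin_succ, pow_succ, ← mul_assoc A]
    linear_combination pochFin (A * B * α) r N * h1 +
      (1 - A * r ^ N) * (1 - A * α * r ^ N) * ih

lemma tendsto_jackson_askey (hr0 : 0 < r) (hr1 : r < 1) {A B α b : ℝ} (hA : A * b < 1)
    (hB : B * b < 1) :
    Tendsto (fun N : ℕ => jackson r b (askeyWeight r (A * r ^ N) B α)) atTop
      (𝓝 (jackson r b (askeyWeight r 0 B α))) := by
  unfold jackson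
  refine Tendsto.const_mul _ ?_
  set M := max (A * b) 0
  have hM1 : M < 1 := max_lt hA one_pos
  have hM := pochInf_pos hr0 hr1 hM1
  have hbound := (summable_jackson hr0 hr1 b (continuousAt_askeyWeight hr0 hr1 0 B α)).norm.mul_left
    (pochInf M r)⁻¹
  refine tendsto_tsum_of_dominated_convergence hbound (fun n => ?_)
    (Eventually.of_forall fun N n => ?_)
  · refine Tendsto.const_mul _ ?_
    unfold askeyWeight
    have h2 := pochInf_mul_pow_ne_zero hr0 hr1 hB n
    refine Tendsto.div tendsto_const_nhds (Tendsto.mul_const _ ?_) ?_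
    · refine ((continuous_pochInf hr0 hr1).tendsto _).comp ?_
      exact (tendsto_mul_pow hr0 hr1 A).mul_const _
    · rw [zero_mul, pochInf_zero, one_mul]; exact h2
  -- The weight depends on `N` only through `1 / (A r ^ N t; r)_∞`, which is at most `1 / (M; r)_∞`
  -- uniformly; `M` is truncated at `0` to allow negative `A b`.
  · have hle : A * r ^ N * (b * r ^ n) ≤ M := by
      have h1 : 0 < r ^ N * r ^ n := by positivity
      have h2 : r ^ N * r ^ n ≤ 1 := by
        rw [← pow_add]; exact pow_le_one₀ hr0.le hr1.le
      have h3 : A * b ≤ M := le_max_left _ _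
      have h4 : 0 ≤ M := le_max_right _ _
      calc A * r ^ N * (b * r ^ n) = (A * b) * (r ^ N * r ^ n) := by ring
        _ ≤ M * (r ^ N * r ^ n) := mul_le_mul_of_nonneg_right h3 h1.le
        _ ≤ M := mul_le_of_le_one_right h4 h2
    have h5 := pochInf_anti hr0 hr1 hle hM1.le
    have h6 : 0 < pochInf (A * r ^ N * (b * r ^ n)) r := hM.trans_le h5
    have e : askeyWeight r (A * r ^ N) B α (b * r ^ n) =
        (pochInf (A * r ^ N * (b * r ^ n)) r)⁻¹ * askeyWeight r 0 B α (b * r ^ n) := by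
      simp only [askeyWeight, zero_mul, pochInf_zero, one_mul]
      rw [← div_div, div_right_comm, div_eq_inv_mul]
    rw [e, mul_left_comm, norm_mul, Real.norm_of_nonneg (inv_pos.2 h6).le]
    exact mul_le_mul_of_nonneg_right (inv_anti₀ hM h5) (norm_nonneg _)

lemma askeyInt_reduce (hr0 : 0 < r) (hr1 : r < 1) {A B α : ℝ} (hα : α ≠ 0) (hA : A < 1)
    (hAα : A * α < 1) (hB : B < 1) (hBα : B * α < 1) :
    pochInf (A * B * α) r * askeyInt r 0 B α =
      pochInf A r * pochInf (A * α) r * askeyInt r A B α := by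
  have h1 : Tendsto (fun N : ℕ => askeyInt r (A * r ^ N) B α) atTop (𝓝 (askeyInt r 0 B α)) :=
    (tendsto_jackson_askey hr0 hr1 (by simpa using hA) (by simpa using hB)).sub
      (tendsto_jackson_askey hr0 hr1 hAα hBα)
  exact tendsto_nhds_unique ((tendsto_pochFin hr0 hr1 _).mul h1)
    ((((tendsto_pochFin hr0 hr1 _).mul (tendsto_pochFin hr0 hr1 _)).mul_const _).congr
      fun N => (askeyInt_shift_pow hr0 hr1 hα hA hAα hB hBα N).symm)

/-- For `A = B = 0`, replacing `α` by `α r` multiplies the weight by `1 - t/α`. The new weight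
vanishes at `α`, so its integral from `α r` may be started at `α`, and `askey_moment` applies. -/
lemma askeyInt_zero_shift (hr0 : 0 < r) (hr1 : r < 1) {α : ℝ} (hα : α ≠ 0) :
    -α * askeyInt r 0 0 (α * r) = askeyInt r 0 0 α := by
  have hcont := continuousAt_askeyWeight hr0 hr1 0 0 α
  have hm := askey_moment (A := 0) (B := 0) hr0 hr1 hα (by simp) (by simp) (by simp) (by simp)
  have hw : ∀ t, askeyWeight r 0 0 (α * r) t = (1 - t / α) * askeyWeight r 0 0 α t := by
    intro t
    have hr := hr0.ne'
    have e1 : r * t / (α * r) = t / α := by field_simp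
    have e2 := pochInf_eq_mul hr0 hr1 (t / α)
    simp only [askeyWeight, zero_mul, pochInf_zero, mul_one, div_one]
    rw [e1, e2, show t / α * r = r * t / α by ring]
    ring
  have key : ∀ b, jackson r b (askeyWeight r 0 0 (α * r)) = 1 * jackson r b (askeyWeight r 0 0 α) +
      -(1 / α) * jackson r b (fun t => t * askeyWeight r 0 0 α t) := by
    intro b
    have hidc : ContinuousAt (fun t => t * askeyWeight r 0 0 α t) 0 := continuousAt_id.mul hcont
    rw [← jackson_linear hr0 hr1 b 1 _ hcont hidc]
    refine jackson_congr fun n => ?_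
    rw [hw]; ring
  have hend : jackson r (α * r) (askeyWeight r 0 0 (α * r)) =
      jackson r α (askeyWeight r 0 0 (α * r)) := by
    have hs := summable_jackson hr0 hr1 α (continuousAt_askeyWeight hr0 hr1 0 0 (α * r))
    unfold jackson
    rw [hs.tsum_eq_zero_add]
    have e0 : askeyWeight r 0 0 (α * r) (α * r ^ 0) = 0 := by rw [hw]; simp [hα]
    rw [e0, mul_zero, zero_add]
    congr 1
    refine tsum_congr fun n => ?_
    rw [pow_succ, show α * r * r ^ n = α * (r ^ n * r) by ring]
  have e : askeyInt r 0 0 (α * r) = askeyInt r 0 0 α - 1 / α *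
      (jackson r 1 (fun t => t * askeyWeight r 0 0 α t) -
        jackson r α fun t => t * askeyWeight r 0 0 α t) := by
    unfold askeyInt
    rw [hend, key, key]; ring
  rw [e]
  have e2 : α * (1 / α) = 1 := mul_one_div_cancel hα
  linear_combination hm + (jackson r 1 (fun t => t * askeyWeight r 0 0 α t) -
        jackson r α fun t => t * askeyWeight r 0 0 α t) * e2

/-- The total mass of the Al-Salam–Carlitz weight. -/
lemma askeyInt_zero (hr0 : 0 < r) (hr1 : r < 1) {α : ℝ} (hα : α < 0) :
    askeyInt r 0 0 α = (1 - r) * (pochInf r r * pochInf α r * pochInf (r / α) r) := by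
  set β := -α with hβ
  have hβ0 : 0 < β := by rw [hβ]; linarith
  have hαβ : α = -β := by rw [hβ]; ring
  set c : ℕ → ℝ := fun N => ∏ k ∈ Finset.range N, β * r ^ k with hc
  have hcs : ∀ N, c (N + 1) = c N * (β * r ^ N) := fun N => Finset.prod_range_succ _ _
  have hc0 : ∀ N, 0 < c N := fun N => Finset.prod_pos fun k _ => by positivity
  -- The mass is computed by sending `α r ^ N` to `0` under this invariance. The negative arm
  -- shrinks away, and on the positive arm only the point `t = 1` survives.
  have hit : ∀ N, c N * askeyInt r 0 0 (α * r ^ N) = askeyInt r 0 0 α := by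
    intro N
    induction N with
    | zero => simp [hc]
    | succ N ih =>
      have hne : α * r ^ N ≠ 0 := mul_ne_zero hα.ne (pow_pos hr0 N).ne'
      have h1 := askeyInt_zero_shift hr0 hr1 hne
      rw [← ih, ← h1, hcs, pow_succ, ← mul_assoc α, hβ]
      ring
  have hcB : ∀ N, c N ≤ pochInf α r := by
    intro N
    refine le_trans ?_ (pochFin_le_pochInf hr0 hr1 hα.le N)
    refine Finset.prod_le_prod (fun k _ => by positivity) fun k _ => ?_
    rw [hαβ]; nlinarith [pow_pos hr0 k]
  have hα1 : α * r⁻¹ ≤ 0 := mul_nonpos_of_nonpos_of_nonneg hα.le (inv_pos.2 hr0).le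
  have hprod : ∀ N n : ℕ, c N * pochInf (r * r ^ n / (α * r ^ N)) r =
      (∏ k ∈ Finset.range N, (r ^ n + β * r ^ k)) * pochInf (r * r ^ n / α) r := by
    intro N n
    induction N with
    | zero => simp [hc]
    | succ N ih =>
      have e1 := pochInf_eq_mul hr0 hr1 (r * r ^ n / (α * r ^ (N + 1)))
      have e2 : r * r ^ n / (α * r ^ (N + 1)) * r = r * r ^ n / (α * r ^ N) := by
        rw [pow_succ]; have := hr0.ne'; have := hα.ne; field_simp
      have e3 : β * r ^ N * (1 - r * r ^ n / (α * r ^ (N + 1))) = r ^ n + β * r ^ N := by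
        rw [pow_succ, hβ]; have := hr0.ne'; have := hα.ne; field_simp; ring
      rw [e2] at e1
      rw [e1, hcs, Finset.prod_range_succ]
      linear_combination (r ^ n + β * r ^ N) * ih +
        (c N * pochInf (r * r ^ n / (α * r ^ N)) r) * e3
  have hP0 : ∀ N n : ℕ, 0 ≤ ∏ k ∈ Finset.range N, (r ^ n + β * r ^ k) := fun N n =>
    Finset.prod_nonneg fun k _ => by positivity
  have hPB : ∀ N n : ℕ, ∏ k ∈ Finset.range N, (r ^ n + β * r ^ k) ≤ pochInf α r := by
    intro N n
    refine le_trans ?_ (pochFin_le_pochInf hr0 hr1 hα.le N)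
    refine Finset.prod_le_prod (fun k _ => by positivity) fun k _ => ?_
    have : r ^ n ≤ 1 := pow_le_one₀ hr0.le hr1.le
    rw [hαβ]; linarith
  -- At `t = r ^ n` the rescaled weight carries `∏ (r ^ n + β r ^ k)`. Its factors tend to `r ^ n`,
  -- so for `n ≥ 1` the product decays like `r ^ N`, whereas for `n = 0` it converges to `(α; r)_∞`.
  have hPlim : ∀ n : ℕ, Tendsto (fun N => ∏ k ∈ Finset.range N, (r ^ n + β * r ^ k)) atTop
      (𝓝 (if n = 0 then pochInf α r else 0)) := by
    intro n
    rcases n with _ | n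
    · simp only [if_true]
      refine (tendsto_pochFin hr0 hr1 α).congr fun N => ?_
      refine Finset.prod_congr rfl fun k _ => ?_
      rw [hαβ]; ring
    · simp only [Nat.succ_ne_zero, if_false]
      have hle : ∀ N, ∏ k ∈ Finset.range N, (r ^ (n + 1) + β * r ^ k) ≤
          r ^ N * pochInf (α * r⁻¹) r := by
        intro N
        refine le_trans ?_ (mul_le_mul_of_nonneg_left (pochFin_le_pochInf hr0 hr1 hα1 N)
          (pow_pos hr0 N).le)
        have e0 : r ^ N * pochFin (α * r⁻¹) r N =
            ∏ k ∈ Finset.range N, (r * (1 - α * r⁻¹ * r ^ k)) := by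
          simp [pochFin, Finset.prod_mul_distrib]
        rw [e0]
        refine Finset.prod_le_prod (fun k _ => by positivity) fun k _ => ?_
        have h1 : r ^ n ≤ 1 := pow_le_one₀ hr0.le hr1.le
        have e1 : r * (1 - α * r⁻¹ * r ^ k) = r + β * r ^ k := by
          rw [hβ]; have := hr0.ne'; field_simp; ring
        rw [e1, pow_succ]
        nlinarith
      refine squeeze_zero (fun N => hP0 N _) hle ?_
      simpa using (tendsto_pow_atTop_nhds_zero_of_lt_one hr0.le hr1).mul_const (pochInf (α * r⁻¹) r)
  have hw : ∀ γ t, askeyWeight r 0 0 γ t = pochInf (r * t) r * pochInf (r * t / γ) r := by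
    intro γ t; simp [askeyWeight, pochInf_zero]
  have hlim1 : Tendsto (fun N : ℕ => c N * jackson r 1 (askeyWeight r 0 0 (α * r ^ N))) atTop
      (𝓝 ((1 - r) * (pochInf r r * pochInf α r * pochInf (r / α) r))) := by
    have e : ∀ N : ℕ, c N * jackson r 1 (askeyWeight r 0 0 (α * r ^ N)) = (1 - r) *
        ∑' n : ℕ, r ^ n * pochInf (r * r ^ n) r * pochInf (r * r ^ n / α) r *
          ∏ k ∈ Finset.range N, (r ^ n + β * r ^ k) := by
      intro N
      rw [jackson, mul_left_comm, ← tsum_mul_left]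
      congr 1
      refine tsum_congr fun n => ?_
      rw [one_mul, hw]
      linear_combination (r ^ n * pochInf (r * r ^ n) r) * hprod N n
    simp only [e]
    refine Tendsto.const_mul _ ?_
    have hb : Summable fun n : ℕ => ‖r ^ n * pochInf (r * r ^ n) r * pochInf (r * r ^ n / α) r‖ *
        pochInf α r := by
      have := summable_jackson hr0 hr1 1 (continuousAt_askeyWeight hr0 hr1 0 0 α)
      simp only [hw, one_mul, ← mul_assoc] at this
      exact this.norm.mul_right _
    have h := tendsto_tsum_of_dominated_convergence hb
      (f := fun N n => r ^ n * pochInf (r * r ^ n) r * pochInf (r * r ^ n / α) r *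
          ∏ k ∈ Finset.range N, (r ^ n + β * r ^ k))
      (g := fun n => r ^ n * pochInf (r * r ^ n) r * pochInf (r * r ^ n / α) r *
        (if n = 0 then pochInf α r else 0)) (𝓕 := atTop)
      (fun n => (hPlim n).const_mul _) (Eventually.of_forall fun N n => ?_)
    · have e2 : ∑' n : ℕ, r ^ n * pochInf (r * r ^ n) r * pochInf (r * r ^ n / α) r *
          (if n = 0 then pochInf α r else 0) = pochInf r r * pochInf α r * pochInf (r / α) r := by
        rw [tsum_eq_single 0 (fun n hn => by simp [hn])]
        simp; ring
      rwa [e2] at h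
    · rw [norm_mul, Real.norm_of_nonneg (hP0 N n)]
      exact mul_le_mul_of_nonneg_left (hPB N n) (norm_nonneg _)
  have hlim2 : Tendsto (fun N : ℕ => c N * jackson r (α * r ^ N) (askeyWeight r 0 0 (α * r ^ N)))
      atTop (𝓝 0) := by
    have hg := summable_geometric_of_lt_one hr0.le hr1
    have hpt : ∀ N n : ℕ, ‖r ^ n * askeyWeight r 0 0 (α * r ^ N) (α * r ^ N * r ^ n)‖ ≤
        pochInf α r * r ^ n := by
      intro N n
      have hrN : r ^ N ≤ 1 := pow_le_one₀ hr0.le hr1.le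
      have hrn : r ^ n ≤ 1 := pow_le_one₀ hr0.le hr1.le
      have pN := pow_pos hr0 N
      have pn := pow_pos hr0 n
      have hne : α * r ^ N ≠ 0 := mul_ne_zero hα.ne pN.ne'
      have e1 : r * (α * r ^ N * r ^ n) / (α * r ^ N) = r * r ^ n := by
        have := hα.ne; have := pN.ne'; field_simp
      have h1 : |pochInf (r * (α * r ^ N * r ^ n)) r| ≤ pochInf α r := by
        rw [hαβ]
        refine abs_pochInf_le_of_abs_le hr0 hr1 ?_
        rw [show r * (-β * r ^ N * r ^ n) = -(β * (r * r ^ N * r ^ n)) by ring, abs_neg,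
          abs_of_pos (by positivity)]
        refine mul_le_of_le_one_right hβ0.le ?_
        calc r * r ^ N * r ^ n ≤ 1 * 1 * 1 := by gcongr
          _ = 1 := by norm_num
      have h2 : |pochInf (r * r ^ n) r| ≤ 1 := by
        have h3 : r * r ^ n ≤ 1 := by nlinarith
        rw [abs_of_nonneg]
        · exact pochInf_le_one hr0 hr1 (by positivity) h3
        · exact (pochInf_pos hr0 hr1 (mul_pow_lt_one hr0 hr1 hr1 n)).le
      rw [hw, e1, norm_mul, norm_mul, Real.norm_of_nonneg pn.le, mul_comm]
      refine mul_le_mul_of_nonneg_right ?_ pn.le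
      rw [Real.norm_eq_abs, Real.norm_eq_abs]
      calc _ ≤ pochInf α r * 1 := mul_le_mul h1 h2 (abs_nonneg _) ((abs_nonneg _).trans h1)
        _ = _ := mul_one _
    have hbd : ∀ N : ℕ, ‖c N * jackson r (α * r ^ N) (askeyWeight r 0 0 (α * r ^ N))‖ ≤
        (pochInf α r * |α| * |1 - r| * ∑' n : ℕ, pochInf α r * r ^ n) * r ^ N := by
      intro N
      have e : jackson r (α * r ^ N) (askeyWeight r 0 0 (α * r ^ N)) = (1 - r) * (α * r ^ N *
          ∑' n : ℕ, r ^ n * askeyWeight r 0 0 (α * r ^ N) (α * r ^ N * r ^ n)) := by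
        rw [jackson]
        congr 1
        rw [← tsum_mul_left]
        exact tsum_congr fun n => by ring
      have hle := tsum_of_norm_bounded (hg.mul_left (pochInf α r)).hasSum (hpt N)
      rw [e, norm_mul, norm_mul, norm_mul, norm_mul, Real.norm_of_nonneg (hc0 N).le,
        Real.norm_of_nonneg (pow_pos hr0 N).le, Real.norm_eq_abs (1 - r), Real.norm_eq_abs α]
      calc c N * (|1 - r| * (|α| * r ^ N *
            ‖∑' n : ℕ, r ^ n * askeyWeight r 0 0 (α * r ^ N) (α * r ^ N * r ^ n)‖))
          ≤ pochInf α r * (|1 - r| * (|α| * r ^ N * ∑' n : ℕ, pochInf α r * r ^ n)) := by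
            have h0 : 0 ≤ pochInf α r := (hc0 N).le.trans (hcB N)
            have h1 := hcB N
            gcongr
        _ = _ := by ring
    refine squeeze_zero_norm hbd ?_
    simpa using (tendsto_pow_atTop_nhds_zero_of_lt_one hr0.le hr1).const_mul
      (pochInf α r * |α| * |1 - r| * ∑' n : ℕ, pochInf α r * r ^ n)
  have hfin := hlim1.sub hlim2
  rw [sub_zero] at hfin
  refine tendsto_nhds_unique (tendsto_const_nhds.congr fun N => ?_) hfin
  rw [← hit N, askeyInt]; ring

/-- The Andrews–Askey integral. -/
lemma askeyInt_eq (hr0 : 0 < r) (hr1 : r < 1) {A B α : ℝ} (hα : α < 0) (hA : A < 1)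
    (hAα : A * α < 1) (hB : B < 1) (hBα : B * α < 1) :
    askeyInt r A B α = (1 - r) * (pochInf r r * pochInf α r * pochInf (r / α) r *
      pochInf (A * B * α) r) / (pochInf A r * pochInf (A * α) r * pochInf B r *
        pochInf (B * α) r) := by
  have h1 := askeyInt_reduce hr0 hr1 hα.ne hA hAα hB hBα
  have h2 := askeyInt_reduce (A := B) (B := 0) hr0 hr1 hα.ne hB hBα (by simp) (by simp)
  rw [askeyInt_comm r B 0, mul_zero, zero_mul, pochInf_zero, one_mul,
    askeyInt_zero hr0 hr1 hα] at h2
  have p1 := (pochInf_pos hr0 hr1 hA).ne'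
  have p2 := (pochInf_pos hr0 hr1 hAα).ne'
  have p3 := (pochInf_pos hr0 hr1 hB).ne'
  have p4 := (pochInf_pos hr0 hr1 hBα).ne'
  rw [eq_div_iff (by positivity)]
  linear_combination -(pochInf B r * pochInf (B * α) r) * h1 - pochInf (A * B * α) r * h2

end QEnsemble

end

noncomputable section

namespace QEnsemble

open Filter Topology Polynomial Support

/-! ### Norms of orthogonal polynomials under a shift of the parameters -/

/-- `P` is the monic polynomial of degree `n` that `u` makes orthogonal to all lower degrees. -/
structure IsOrth (u : ℝ[X] →ₗ[ℝ] ℝ) (n : ℕ) (P : ℝ[X]) : Prop where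
  monic : P.Monic
  natDegree : P.natDegree = n
  orthogonal : ∀ Q : ℝ[X], Q.degree < n → u (P * Q) = 0

namespace IsOrth

variable {u v : ℝ[X] →ₗ[ℝ] ℝ} {n : ℕ} {P : ℝ[X]}

lemma map_mul (H : IsOrth u n P) {Q : ℝ[X]} (hQ : Q.natDegree ≤ n) :
    u (P * Q) = Q.coeff n * u (P * P) := by
  have hlt : (Q - Q.coeff n • P).degree < n := by
    rw [degree_lt_iff_coeff_zero]
    intro m hm
    rw [coeff_sub, coeff_smul, smul_eq_mul]
    rcases hm.eq_or_lt with rfl | hm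
    · have : P.coeff n = 1 := by
        have := H.monic.coeff_natDegree; rwa [H.natDegree] at this
      rw [this]; ring
    · rw [coeff_eq_zero_of_natDegree_lt (hQ.trans_lt hm),
        coeff_eq_zero_of_natDegree_lt (H.natDegree.trans_lt hm)]; ring
  have h := H.orthogonal _ hlt
  rw [mul_sub, mul_smul_comm, map_sub, map_smul, smul_eq_mul] at h
  linarith

lemma coeff_self (H : IsOrth u n P) : P.coeff n = 1 := by
  have := H.monic.coeff_natDegree; rwa [H.natDegree] at this

lemma zero_iff : IsOrth u 0 P ↔ P = 1 := by
  constructor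
  · intro H; exact (H.monic.natDegree_eq_zero).1 H.natDegree
  · rintro rfl
    refine ⟨monic_one, natDegree_one, fun Q hQ => ?_⟩
    have : Q = 0 := by simpa using hQ
    simp [this]

variable {f g : ℝ[X]} {r κ : ℝ}

/-- An orthogonal polynomial up to a nonzero factor. -/
lemma of_leadingCoeff {T : ℝ[X]} (hT : T.natDegree ≤ n) {l : ℝ} (hl : T.coeff n = l) (hl0 : l ≠ 0)
    (h : ∀ Q : ℝ[X], Q.degree < n → u (T * Q) = 0) : IsOrth u n (l⁻¹ • T) := by
  have hc : (l⁻¹ • T).coeff n = 1 := by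
    rw [coeff_smul, hl, smul_eq_mul, inv_mul_cancel₀ hl0]
  have hd : (l⁻¹ • T).natDegree ≤ n := (natDegree_smul_le _ _).trans hT
  refine ⟨monic_of_natDegree_le_of_coeff_eq_one n hd hc,
    natDegree_eq_of_le_of_coeff_ne_zero hd (by rw [hc]; exact one_ne_zero), fun Q hQ => ?_⟩
  rw [smul_mul_assoc, map_smul, h Q hQ, smul_zero]

lemma natDegree_le_of_lt {Q : ℝ[X]} (hQ : Q.degree < n) : Q.natDegree ≤ n - 1 := by
  rcases eq_or_ne Q 0 with rfl | h0
  · simp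
  · have := (natDegree_lt_iff_degree_lt h0).2 hQ; omega

/-- The common part of the two ways to lower the degree. The right side of `h` pairs `P` with a
polynomial of degree at most `n + 1`, so it sees only the coefficient of degree `n` of `Q`. Hence
`T` is orthogonal to lower degrees under `v`, and `Q` equal to the monic multiple of `T` relates the
two norms. -/
lemma exists_lower {T : ℝ[X]} (hf : f.natDegree ≤ 2) (hg : g.natDegree ≤ 1)
    (H : IsOrth u (n + 1) P) (hT : T.natDegree ≤ n) {l m : ℝ} (hl : T.coeff n = l) (hl0 : l ≠ 0)
    (hκ : κ ≠ 0) (Φ : ℝ[X] →ₗ[ℝ] ℝ[X]) (hΦd : ∀ Q, (Φ Q).natDegree ≤ Q.natDegree)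
    (hΦc : ∀ Q, (Φ Q).coeff n = m * Q.coeff n)
    (h : ∀ Q, κ * v (T * Q) = -((1 - r) * u (pearsonOp f g r (Φ Q) * P))) :
    ∃ P', IsOrth v n P' ∧
      κ * l * v (P' * P') = -((1 - r) * (pearsonLead f g r n * m)) * u (P * P) := by
  have key : ∀ Q : ℝ[X], Q.natDegree ≤ n → κ * v (T * Q) =
      -((1 - r) * (pearsonLead f g r n * (m * Q.coeff n))) * u (P * P) := by
    intro Q hQ
    have hd := (hΦd Q).trans hQ
    rw [h, mul_comm _ P, H.map_mul (natDegree_pearsonOp_le hf hg hd), coeff_pearsonOp hf hg hd,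
      hΦc]
    ring
  have H' : IsOrth v n (l⁻¹ • T) := by
    refine of_leadingCoeff hT hl hl0 fun Q hQ => ?_
    have h0 : Q.coeff n = 0 := coeff_eq_zero_of_degree_lt hQ
    have := key Q (natDegree_le_of_lt hQ |>.trans (Nat.sub_le _ _))
    rw [h0] at this
    refine (mul_eq_zero.1 ?_).resolve_left hκ
    rw [this]; ring
  refine ⟨_, H', ?_⟩
  have := key (l⁻¹ • T) H'.natDegree.le
  rw [H'.coeff_self, mul_one] at this
  rw [← this, smul_mul_assoc, map_smul, smul_eq_mul]
  field_simp

lemma pow_succ_ne_one (hr0 : 0 < r) (hr1 : r < 1) (n : ℕ) : 1 - r ^ (n + 1) ≠ 0 :=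
  (sub_pos.2 (pow_lt_one₀ hr0.le hr1 n.succ_ne_zero)).ne'

/-- Lowering the degree when `pearsonShift f g r` times the weight of `u` is a weight `v`. -/
lemma exists_lower_pearsonShift (hr0 : 0 < r) (hr1 : r < 1) (hf : f.natDegree ≤ 2) (hg : g.natDegree ≤ 1)
    (hu : ∀ θ, u (pearsonOp f g r θ) = 0) (hκ : κ ≠ 0)
    (hv : ∀ w, u (pearsonShift f g r * w) = κ * v w) (H : IsOrth u (n + 1) P) :
    ∃ P', IsOrth v n P' ∧ κ * (1 - r ^ (n + 1)) * v (P' * P') =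
      -((1 - r) * (pearsonLead f g r n * r⁻¹ ^ n)) * u (P * P) := by
  have hr := hr0.ne'
  refine exists_lower hf hg H (T := diffOp r P) ?_ (by rw [coeff_diffOp, H.coeff_self, mul_one])
    (pow_succ_ne_one hr0 hr1 n) hκ (dil r⁻¹).toLinearMap (fun Q => natDegree_dil_le _ Q)
    (fun Q => by simp [coeff_dil, mul_comm]) fun Q => ?_
  · rw [natDegree_le_iff_coeff_eq_zero]
    intro m hm
    rw [coeff_diffOp, coeff_eq_zero_of_natDegree_lt (by rw [H.natDegree]; omega), mul_zero]
  · rw [AlgHom.toLinearMap_apply, ← map_pearsonShift_mul hr1.ne hu, dil_dil_inv hr, mul_assoc, hv,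
      mul_comm Q]

/-- Lowering the degree when `f` times the weight of `u` is a weight `v`. -/
lemma exists_lower_mul (hr0 : 0 < r) (hr1 : r < 1) (hf : f.natDegree ≤ 2) (hg : g.natDegree ≤ 1)
    (hu : ∀ θ, u (pearsonOp f g r θ) = 0) (hκ : κ ≠ 0)
    (hv : ∀ w, u (f * w) = κ * v w) (H : IsOrth u (n + 1) P) :
    ∃ P', IsOrth v n P' ∧ κ * ((1 - r ^ (n + 1)) * r⁻¹ ^ (n + 1)) * v (P' * P') =
      -((1 - r) * (pearsonLead f g r n * 1)) * u (P * P) := by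
  have hr := hr0.ne'
  refine exists_lower hf hg H (T := diffOp r (dil r⁻¹ P)) ?_
    (by rw [coeff_diffOp, coeff_dil, H.coeff_self, one_mul])
    (mul_ne_zero (pow_succ_ne_one hr0 hr1 n) (pow_ne_zero _ (inv_ne_zero hr))) hκ LinearMap.id
    (fun Q => le_rfl) (fun Q => by simp) fun Q => ?_
  · rw [natDegree_le_iff_coeff_eq_zero]
    intro m hm
    rw [coeff_diffOp, coeff_eq_zero_of_natDegree_lt, mul_zero]
    exact (natDegree_dil_le _ _).trans_lt (by rw [H.natDegree]; omega)
  · rw [LinearMap.id_apply, ← map_pearson_mul hr hr1.ne hu, mul_assoc, hv, mul_comm Q]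

end IsOrth

lemma IsOP.isOrth {u : ℝ[X] →ₗ[ℝ] ℝ} {p : ℕ → ℝ[X]} {h : ℕ → ℝ} (H : IsOP u p h) (n : ℕ) :
    IsOrth u n (p n) :=
  ⟨H.monic n, H.natDegree n, fun _ hQ => H.map_mul_of_degree_lt hQ⟩

/-- Existence of orthogonal polynomials for a positive functional. -/
lemma exists_isOrth {u : ℝ[X] →ₗ[ℝ] ℝ} (hu : ∀ P, P ≠ 0 → 0 < u (P * P)) (n : ℕ) :
    ∃ P, IsOrth u n P := by
  -- Positivity makes the Gram form injective, hence onto the dual in finite dimension; `X ^ n`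
  -- minus its projection to lower degrees is the required polynomial.
  set B : degreeLT ℝ n →ₗ[ℝ] Module.Dual ℝ (degreeLT ℝ n) :=
    LinearMap.mk₂ ℝ (fun P Q => u (P * Q)) (fun _ _ _ => by simp [add_mul]) (fun _ _ _ => by simp)
      (fun _ _ _ => by simp [mul_add]) (fun _ _ _ => by simp) with hB
  have hfd : FiniteDimensional ℝ (degreeLT ℝ n) := (degreeLTEquiv ℝ n).symm.finiteDimensional
  have hinj : Function.Injective B := by
    rw [← LinearMap.ker_eq_bot, LinearMap.ker_eq_bot']
    intro P hP
    by_contra h0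
    have h1 := hu P fun h => h0 (Subtype.ext h)
    have h2 : B P P = 0 := by rw [hP]; rfl
    exact h1.ne' h2
  have hsurj : Function.Surjective B :=
    (LinearMap.injective_iff_surjective_of_finrank_eq_finrank
      (Subspace.dual_finrank_eq).symm).1 hinj
  obtain ⟨Q, hQ⟩ := hsurj ((u.comp (LinearMap.mulLeft ℝ (X ^ n))).comp (degreeLT ℝ n).subtype)
  have hlt : (Q : ℝ[X]).degree < n := mem_degreeLT.1 Q.2
  have hlt' : (Q : ℝ[X]).degree < (X ^ n : ℝ[X]).degree := by rwa [degree_X_pow]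
  refine ⟨X ^ n - (Q : ℝ[X]), (monic_X_pow n).sub_of_left hlt', ?_, fun R hR => ?_⟩
  · rw [natDegree_eq_of_degree_eq (degree_sub_eq_left_of_degree_lt hlt'), natDegree_X_pow]
  · have h3 := LinearMap.congr_fun hQ ⟨R, mem_degreeLT.2 hR⟩
    have h4 : u (Q * R) = u (X ^ n * R) := h3
    rw [sub_mul, map_sub, h4, sub_self]

/-! ### Positivity, parameter shifts, and `γ` in terms of the norm -/

namespace Weight

variable {W W' : Weight} {q : ℝ}

lemma IsClassical.exists_isMonicOP (h : W.IsClassical q)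
    (hpos : ∀ P, P ≠ 0 → 0 < h.functional (P * P)) : ∃ p, W.IsMonicOP q p := by
  choose p hp using exists_isOrth hpos
  have hlt : ∀ m n, m < n → h.functional (p n * p m) = 0 := fun m n hmn =>
    (hp n).orthogonal _ (by
      rw [degree_eq_natDegree (hp m).monic.ne_zero, (hp m).natDegree]; exact_mod_cast hmn)
  refine ⟨p, fun n => (hp n).monic, fun n => (hp n).natDegree, fun m n hmn => ?_, fun n => ?_⟩
  · rw [h.inner2_eq]
    rcases hmn.lt_or_gt with hmn | hmn
    · rw [mul_comm]; exact hlt _ _ hmn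
    · exact hlt _ _ hmn
  · rw [h.inner2_eq]
    exact (hpos _ (hp n).monic.ne_zero).ne'

/-- The sum over the negative arm has negative points and is subtracted, so it contributes a
nonnegative amount. On the positive arm a nonzero polynomial cannot vanish at all of the infinitely
many points. -/
lemma IsClassical.functional_mul_self_pos (h : W.IsClassical q) (hq0 : 0 < q) (hq1 : q < 1)
    (hρ : ∀ x ∈ W.supp.lattice q, 0 < W.ρ x) {P : ℝ[X]} (hP : P ≠ 0) :
    0 < h.functional (P * P) := by
  obtain ⟨hr0, hr1, -⟩ := sqrt_facts hq0 hq1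
  have hv := h.valid
  have hs := h.summable_rho (P * P)
  have hnn : ∀ x ∈ W.supp.lattice q, 0 ≤ (P * P).eval x * W.ρ x := fun x hx => by
    rw [eval_mul]; exact mul_nonneg (mul_self_nonneg _) (hρ x hx).le
  have hon : ∀ n : ℕ, W.supp.On true n := fun n => ⟨(base_pos hv).ne', fun _ => by positivity⟩
  have ht : ∀ n, 0 ≤ W.supp.arm √q true (fun x => (P * P).eval x * W.ρ x) n := by
    intro n
    by_cases hn : W.supp.On true n
    · rw [arm_of_on hn]
      exact mul_nonneg (sub_pos.2 hr1).le (mul_nonneg (pt_true_pos hv hr0 n).le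
        (hnn _ (pt_mem_lattice hq0 hn)))
    · rw [arm_of_not_on hn]
  have hf : ∀ n, W.supp.arm √q false (fun x => (P * P).eval x * W.ρ x) n ≤ 0 := by
    intro n
    by_cases hn : W.supp.On false n
    · rw [arm_of_on hn]
      exact mul_nonpos_of_nonneg_of_nonpos (sub_pos.2 hr1).le
        (mul_nonpos_of_nonpos_of_nonneg (pt_false_neg hv hr0 hn).le
          (hnn _ (pt_mem_lattice hq0 hn)))
    · rw [arm_of_not_on hn]
  obtain ⟨n, hn⟩ : ∃ n : ℕ, P.eval (W.supp.pt √q true n) ≠ 0 := by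
    by_contra! hall
    refine hP (eq_zero_of_infinite_isRoot P ?_)
    refine (Set.infinite_range_of_injective (f := fun n : ℕ => W.supp.pt √q true n) ?_).mono ?_
    · intro n m hnm
      exact_mod_cast (pt_inj hv hr0 hr1 (hon n) (hon m) hnm).2
    · rintro _ ⟨n, rfl⟩
      exact hall n
  have hpos : 0 < W.supp.arm √q true (fun x => (P * P).eval x * W.ρ x) n := by
    rw [arm_of_on (hon n), eval_mul]
    exact mul_pos (sub_pos.2 hr1) (mul_pos (pt_true_pos hv hr0 n)
      (mul_pos (mul_self_pos.2 hn) (hρ _ (pt_mem_lattice hq0 (hon n)))))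
  rw [h.functional_apply, integral_eq_arm]
  have h1 := (hs true).tsum_pos ht _ hpos
  have h2 : ∑' n, W.supp.arm √q false (fun x => (P * P).eval x * W.ρ x) n ≤ 0 := tsum_nonpos hf
  linarith

lemma integral_congr {D : Support} (hq0 : 0 < q) {w w' : ℝ → ℝ}
    (h : ∀ x ∈ D.lattice q, w x = w' x) : D.integral √q w = D.integral √q w' := by
  have e : ∀ s n, D.arm √q s w n = D.arm √q s w' n := fun s n =>
    arm_congr fun hn => h _ (pt_mem_lattice hq0 hn)
  simp only [integral_eq_arm, e]

lemma integral_smul {D : Support} {r : ℝ} (κ : ℝ) (w : ℝ → ℝ) :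
    D.integral r (fun x => κ * w x) = κ * D.integral r w := by
  simp only [integral_eq_arm, arm_smul, tsum_mul_left]; ring

lemma IsClassical.functional_shift (h : W.IsClassical q) (h' : W'.IsClassical q) (hq0 : 0 < q)
    (hD : W'.supp = W.supp) {F : ℝ[X]} {κ : ℝ}
    (hF : ∀ x ∈ W.supp.lattice q, F.eval x * W.ρ x = κ * W'.ρ x) (w : ℝ[X]) :
    h.functional (F * w) = κ * h'.functional w := by
  rw [h.functional_apply, h'.functional_apply, hD, ← integral_smul]
  refine integral_congr hq0 fun x hx => ?_
  rw [eval_mul]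
  linear_combination w.eval x * hF x hx

lemma IsClassical.h_eq (h : W.IsClassical q) (p : ℕ → ℝ[X]) (n : ℕ) :
    W.h q p n = h.functional (p n * p n) := h.inner2_eq _ _

/-- The factor `-((1 - √q) * pearsonLead)` is kept together because it is a simple expression in
each family, and `(1 + √q)²` is traded for `(1 - q)²` to match the stated constants. -/
lemma IsClassical.gamma_eq_of_norm (h : W.IsClassical q) (hq0 : 0 < q) (hq1 : q < 1)
    {p : ℕ → ℝ[X]} (hp : W.IsMonicOP q p) (j : ℕ) :
    W.gamma q p j = (1 - √q) * (-((1 - √q) * pearsonLead W.f W.g √q (2 * j))) * (√q)⁻¹ ^ j /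
      ((1 - q) ^ 2 * h.functional (p j * p j)) := by
  obtain ⟨hr0, hr1, hr2⟩ := sqrt_facts hq0 hq1
  have h1 : 1 - √q ≠ 0 := (sub_pos.2 hr1).ne'
  have h2 : 1 - q = (1 + √q) * (1 - √q) := by linear_combination hr2
  rw [h.gamma_eq hq0 hq1 hp, ← h.h_eq, symLead, h2]
  have h3 : 1 + √q ≠ 0 := by positivity
  have h4 : W.h q p j ≠ 0 := hp.norm_ne_zero j
  field_simp

/-- The points of the lattice of a segment lie between the origin and the end points. -/
lemma mem_segment_lattice {a b x : ℝ} (hq0 : 0 < q) (hq1 : q < 1) (ha : a ≤ 0) (hb : 0 < b)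
    (hx : x ∈ (segment a b).lattice q) : (0 < x ∧ x ≤ b) ∨ (a ≤ x ∧ x < 0) := by
  obtain ⟨hr0, hr1, -⟩ := sqrt_facts hq0 hq1
  obtain ⟨s, n, hn, rfl⟩ := (mem_lattice hq0 x).1 hx
  obtain ⟨k, rfl⟩ := Int.eq_ofNat_of_zero_le (hn.2 (bounded_segment a b))
  have hv : (segment a b).Valid := ⟨ha, hb⟩
  have h1 : √q ^ k ≤ 1 := pow_le_one₀ hr0.le hr1.le
  cases s
  · right
    refine ⟨?_, pt_false_neg hv hr0 hn⟩
    rw [segment_pt_natCast]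
    simp only [Bool.false_eq_true, if_false]
    nlinarith
  · left
    refine ⟨pt_true_pos hv hr0 _, ?_⟩
    rw [segment_pt_natCast]
    simp only [if_true]
    nlinarith

lemma mem_halfLine_lattice {x : ℝ} (hq0 : 0 < q) (hq1 : q < 1) (hx : x ∈ halfLine.lattice q) :
    0 < x := by
  obtain ⟨hr0, hr1, -⟩ := sqrt_facts hq0 hq1
  obtain ⟨s, n, hn, rfl⟩ := (mem_lattice hq0 x).1 hx
  cases s
  · exact absurd rfl hn.1
  · exact pt_true_pos (D := halfLine) trivial hr0 n

end Weight

end QEnsemble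

end

noncomputable section

namespace QEnsemble

open Filter Topology Polynomial Support

lemma rpow_eq_sqrt_rpow {q : ℝ} (hq0 : 0 < q) (t : ℝ) : q ^ t = √q ^ (2 * t) := by
  rw [Real.sqrt_eq_rpow, ← Real.rpow_mul hq0.le]
  congr 1; ring

lemma sqrt_mul_lt_one {r x b : ℝ} (hr0 : 0 < r) (hr1 : r < 1) (hx : x ≤ b) (hb : b ≤ 1) :
    r * x < 1 := by
  rcases le_or_gt x 0 with h | h
  · nlinarith
  · nlinarith

lemma pochInf_mul_pochInf {q : ℝ} (hq0 : 0 < q) (hq1 : q < 1) (x : ℝ) :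
    pochInf x q * pochInf (x * √q) q = pochInf x √q := (pochInf_sqrt hq0 hq1 x).symm

lemma integrable_segment {r : ℝ} (hr0 : 0 < r) (hr1 : r < 1) (a b : ℝ) {w : ℝ → ℝ}
    (hw : ContinuousAt w 0) : (segment a b).Integrable r w :=
  ⟨summable_jackson hr0 hr1 b hw, summable_jackson hr0 hr1 a hw⟩

namespace Weight

variable {q α : ℝ}

/-! ### The Al-Salam–Carlitz weight -/

lemma alSalamCarlitz_lt_one {r x : ℝ} (hr0 : 0 < r) (hr1 : r < 1) (hα : α < 0)
    (hx : (0 < x ∧ x ≤ 1) ∨ (α ≤ x ∧ x < 0)) : r * x < 1 ∧ r * x / α < 1 := by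
  have h1 : x / α ≤ 1 := by
    rcases hx with hx | hx
    · exact (div_nonpos_of_nonneg_of_nonpos hx.1.le hα.le).trans zero_le_one
    · rw [div_le_one_of_neg hα]; exact hx.1
  refine ⟨sqrt_mul_lt_one hr0 hr1 (by rcases hx with hx | hx <;> linarith) le_rfl, ?_⟩
  rw [mul_div_assoc]
  exact sqrt_mul_lt_one hr0 hr1 h1 le_rfl

lemma alSalamCarlitz_eval_f (x : ℝ) : (alSalamCarlitz q α).f.eval x = (1 - x) * (x - α) := by
  simp [alSalamCarlitz]

/-- Since this is a constant, lowering the degree leads back to the same weight: the recursion for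
the norms needs no change of parameter. -/
lemma alSalamCarlitz_eval_pearsonShift (hq0 : 0 < q) (hq1 : q < 1) (x : ℝ) :
    (pearsonShift (alSalamCarlitz q α).f (alSalamCarlitz q α).g √q).eval x = -α := by
  have h1 : √q - 1 ≠ 0 := (sub_neg.2 (sqrt_facts hq0 hq1).2.1).ne
  rw [eval_pearsonShift]
  simp only [alSalamCarlitz, eval_mul, eval_sub, eval_one, eval_X, eval_C]
  field_simp
  ring

theorem alSalamCarlitz_isClassical (hq0 : 0 < q) (hq1 : q < 1) (hα : α < 0) :
    (alSalamCarlitz q α).IsClassical q := by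
  obtain ⟨hr0, hr1, hr2⟩ := sqrt_facts hq0 hq1
  have hmem : ∀ x ∈ (alSalamCarlitz q α).supp.lattice q,
      (0 < x ∧ x ≤ 1) ∨ (α ≤ x ∧ x < 0) := fun x hx =>
    mem_segment_lattice hq0 hq1 hα.le one_pos hx
  have hβ : 0 < (-α) ^ (-(1 : ℝ) / 2) := Real.rpow_pos_of_pos (by linarith) _
  have hcr := continuous_pochInf hr0 hr1
  have hcq := continuous_pochInf hq0 hq1
  have hcρ : Continuous (alSalamCarlitz q α).ρ := by
    unfold alSalamCarlitz; dsimp only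
    exact (hcr.comp (by fun_prop : Continuous fun x : ℝ => √q * x)).mul
      (hcr.comp (by fun_prop : Continuous fun x : ℝ => √q * x / α))
  have hcω : Continuous (alSalamCarlitz q α).ω := by
    unfold alSalamCarlitz; dsimp only
    exact (continuous_const.mul (hcq.comp (by fun_prop : Continuous fun x : ℝ => q * x))).mul
      (hcq.comp (by fun_prop : Continuous fun x : ℝ => q * x / α))
  have hf : ∀ x, (0 < x ∧ x ≤ 1) ∨ (α ≤ x ∧ x < 0) →
      (alSalamCarlitz q α).f.eval (√q * x) = -α * ((1 - √q * x) * (1 - √q * x / α)) := by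
    intro x _
    rw [alSalamCarlitz_eval_f]
    have := hα.ne
    field_simp
    ring
  have hρ : ∀ x, (alSalamCarlitz q α).ρ x = (1 - √q * x) * (1 - √q * x / α) *
      (alSalamCarlitz q α).ρ (√q * x) := by
    intro x
    simp only [alSalamCarlitz]
    rw [pochInf_eq_mul hr0 hr1 (√q * x), pochInf_eq_mul hr0 hr1 (√q * x / α),
      show √q * x / α * √q = √q * (√q * x) / α by ring, mul_comm (√q * x) √q]
    ring
  refine ⟨?_, ?_, fun x hx => ?_, fun x hx => ?_, fun x hx => ?_, fun x hx => ?_, fun x hx => ?_,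
    ?_, fun k => ?_, fun k => ?_⟩
  · simp only [alSalamCarlitz]; compute_degree
  · simp only [alSalamCarlitz]; compute_degree
  · obtain ⟨h1, h2⟩ := alSalamCarlitz_lt_one hr0 hr1 hα (hmem x hx)
    exact (mul_pos (pochInf_pos hr0 hr1 h1) (pochInf_pos hr0 hr1 h2)).ne'
  · obtain ⟨h1, h2⟩ := alSalamCarlitz_lt_one hq0 hq1 hα (hmem x hx)
    exact (mul_pos (mul_pos hβ (pochInf_pos hq0 hq1 h1)) (pochInf_pos hq0 hq1 h2)).ne'
  · obtain ⟨h1, h2⟩ := alSalamCarlitz_lt_one hr0 hr1 hα (hmem x hx)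
    rw [hf x (hmem x hx)]
    exact mul_ne_zero (neg_ne_zero.2 hα.ne) (mul_pos (sub_pos.2 h1) (sub_pos.2 h2)).ne'
  · obtain ⟨h1, h2⟩ := alSalamCarlitz_lt_one hr0 hr1 hα (hmem x hx)
    have h3 : (alSalamCarlitz q α).ρ x ≠ 0 :=
      (mul_pos (pochInf_pos hr0 hr1 h1) (pochInf_pos hr0 hr1 h2)).ne'
    rw [hρ] at h3
    have h4 := left_ne_zero_of_mul h3
    have h5 := right_ne_zero_of_mul h3
    have h6 := hα.ne
    rw [hf x (hmem x hx), ← eval_pearsonShift, alSalamCarlitz_eval_pearsonShift hq0 hq1, hρ x,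
      div_eq_div_iff h3 (mul_ne_zero (neg_ne_zero.2 h6) h4)]
    ring
  · obtain ⟨h1, h2⟩ := alSalamCarlitz_lt_one hr0 hr1 hα (hmem x hx)
    have h4 := (mul_pos (sub_pos.2 h1) (sub_pos.2 h2)).ne'
    have h6 : 0 < -α := by linarith
    have e1 : (-α) ^ (-(1 : ℝ) / 2) * (-α) ^ (-(1 : ℝ) / 2) = (-α)⁻¹ := by
      rw [← Real.rpow_add h6, ← Real.rpow_neg_one]; norm_num
    have e2 := pochInf_mul_pochInf hq0 hq1 (q * x)
    have e3 := pochInf_mul_pochInf hq0 hq1 (q * x / α)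
    rw [hf x (hmem x hx), hρ x, mul_comm (-α), mul_div_mul_left _ _ h4]
    simp only [alSalamCarlitz]
    rw [show √q * (√q * x) = q * x by rw [← mul_assoc, hr2], ← e2, ← e3, div_eq_mul_inv _ (-α), ← e1,
      show q * x * √q = q * (√q * x) by ring, show q * x / α * √q = q * (√q * x) / α by ring]
    ring
  · refine ⟨hα.le, one_pos, ?_, ?_, fun _ => ⟨(alSalamCarlitz q α).ω 0,
      hcω.continuousAt.tendsto.mono_left nhdsWithin_le_nhds⟩⟩ <;> simp [alSalamCarlitz]
  · have hc : Continuous fun x => x ^ k * (alSalamCarlitz q α).ρ x := by fun_prop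
    exact integrable_segment hr0 hr1 α 1 hc.continuousAt
  · have hc : Continuous fun x => x ^ k * (alSalamCarlitz q α).ω x := by fun_prop
    exact integrable_segment hr0 hr1 α 1 hc.continuousAt

theorem alSalamCarlitz_exists_isMonicOP (hq0 : 0 < q) (hq1 : q < 1) (hα : α < 0) :
    ∃ p, (alSalamCarlitz q α).IsMonicOP q p := by
  obtain ⟨hr0, hr1, hr2⟩ := sqrt_facts hq0 hq1
  refine (alSalamCarlitz_isClassical hq0 hq1 hα).exists_isMonicOP fun P hP =>
    IsClassical.functional_mul_self_pos _ hq0 hq1 (fun x hx => ?_) hP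
  obtain ⟨h1, h2⟩ := alSalamCarlitz_lt_one hr0 hr1 hα
    (mem_segment_lattice hq0 hq1 hα.le one_pos hx)
  exact mul_pos (pochInf_pos hr0 hr1 h1) (pochInf_pos hr0 hr1 h2)

lemma alSalamCarlitz_pearsonLead (hq0 : 0 < q) (hq1 : q < 1) (n : ℕ) :
    -((1 - √q) * pearsonLead (alSalamCarlitz q α).f (alSalamCarlitz q α).g √q n) = 1 := by
  have h1 : √q - 1 ≠ 0 := (sub_neg.2 (sqrt_facts hq0 hq1).2.1).ne
  have h2 : 1 - √q ≠ 0 := (sub_pos.2 (sqrt_facts hq0 hq1).2.1).ne'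
  have hf : (alSalamCarlitz q α).f = -X ^ 2 + C (1 + α) * X - C α := by
    simp only [alSalamCarlitz, C_add, C_1]; ring
  have e1 : (alSalamCarlitz q α).f.coeff 2 = -1 := by
    rw [hf]; simp [coeff_one]
  have e2 : (alSalamCarlitz q α).g.coeff 1 = 1 / (√q - 1) := by
    simp [alSalamCarlitz, coeff_one]
  rw [pearsonLead, e1, e2, mul_div_cancel₀ _ h2]
  field_simp
  ring

/-- The recursion is `h_{n+1} = -α r ^ n (1 - r ^ (n+1)) h_n` with `r = √q`, starting from the total
mass. -/
lemma alSalamCarlitz_norm (hq0 : 0 < q) (hq1 : q < 1) (hα : α < 0) (n : ℕ) {P : ℝ[X]}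
    (hP : IsOrth (alSalamCarlitz_isClassical hq0 hq1 hα).functional n P) :
    (alSalamCarlitz_isClassical hq0 hq1 hα).functional (P * P) =
      (-α) ^ n * √q ^ (n.choose 2) * pochFin √q √q n *
        ((1 - √q) * (pochInf √q √q * pochInf α √q * pochInf (√q / α) √q)) := by
  obtain ⟨hr0, hr1, hr2⟩ := sqrt_facts hq0 hq1
  set h := alSalamCarlitz_isClassical hq0 hq1 hα with hh
  induction n generalizing P with
  | zero =>
    rw [IsOrth.zero_iff.1 hP, mul_one, h.functional_apply, ← askeyInt_zero hr0 hr1 hα]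
    have hw : askeyWeight √q 0 0 α = (alSalamCarlitz q α).ρ := by
      ext t; simp [alSalamCarlitz, askeyWeight, pochInf_zero]
    rw [askeyInt, hw]
    simp [alSalamCarlitz, Support.integral, pochFin_zero]
  | succ n ih =>
    obtain ⟨P', hP', e⟩ := hP.exists_lower_pearsonShift (v := h.functional) (κ := -α) hr0 hr1 h.natDegree_f
      h.natDegree_g (h.functional_pearsonOp hq0 hq1) (neg_ne_zero.2 hα.ne)
      (h.functional_shift h hq0 rfl fun x _ => by
        rw [alSalamCarlitz_eval_pearsonShift hq0 hq1])
    rw [ih hP'] at e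
    have e1 := alSalamCarlitz_pearsonLead (α := α) hq0 hq1 n
    have e2 : (√q)⁻¹ ^ n * √q ^ n = 1 := by
      rw [← mul_pow, inv_mul_cancel₀ hr0.ne', one_pow]
    rw [Nat.choose_succ_left n 2 (by norm_num), pochFin_succ, pow_add, Nat.choose_one_right,
      pow_succ (-α)]
    have e3 : √q * √q ^ n = √q ^ (n + 1) := by ring
    rw [e3]
    linear_combination -(√q ^ n * e) - (√q)⁻¹ ^ n * √q ^ n * h.functional (P * P) * e1 -
      h.functional (P * P) * e2

theorem alSalamCarlitz_gamma (hq0 : 0 < q) (hq1 : q < 1) (hα : α < 0) {p : ℕ → ℝ[X]}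
    (hp : (alSalamCarlitz q α).IsMonicOP q p) {n : ℕ} (hn : 1 ≤ n) :
    (alSalamCarlitz q α).gamma q p (2 * n - 2) = alSalamCarlitzConst q α n := by
  obtain ⟨hr0, hr1, hr2⟩ := sqrt_facts hq0 hq1
  obtain ⟨m, rfl⟩ := Nat.exists_eq_add_of_le' hn
  have h := alSalamCarlitz_isClassical hq0 hq1 hα
  have hα' : 0 < -α := by linarith
  have hj : 2 * (m + 1) - 2 = 2 * m := by omega
  rw [hj, h.gamma_eq_of_norm hq0 hq1 hp, alSalamCarlitz_pearsonLead hq0 hq1,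
    alSalamCarlitz_norm hq0 hq1 hα _ ((h.isOP hp).isOrth _), alSalamCarlitzConst, hj]
  have e1 : (-α) ^ (2 - 2 * ((m + 1 : ℕ) : ℝ)) = ((-α) ^ (2 * m))⁻¹ := by
    rw [← Real.rpow_natCast, ← Real.rpow_neg hα'.le]; congr 1; push_cast; ring
  have e2 : q ^ ((-2 * ((m + 1 : ℕ) : ℝ) ^ 2 + 3 * ((m + 1 : ℕ) : ℝ) - 1) / 2) =
      (√q)⁻¹ ^ (2 * m) * (√q ^ ((2 * m).choose 2))⁻¹ := by
    have h1 : (2 * m).choose 2 + 2 * m = (2 * m + 1) * m := by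
      rw [Nat.choose_two_right]
      rcases m with _ | m
      · rfl
      · have : 2 * (m + 1) * (2 * (m + 1) - 1) / 2 = (m + 1) * (2 * m + 1) := by
          rw [mul_assoc, Nat.mul_div_cancel_left _ two_pos]; rfl
        rw [this]; ring
    rw [inv_pow, ← mul_inv, ← pow_add, add_comm (2 * m), h1, rpow_eq_sqrt_rpow hq0,
      ← Real.rpow_natCast √q ((2 * m + 1) * m),
      ← Real.rpow_neg hr0.le]
    congr 1; push_cast; ring
  have h1 : 1 - √q ≠ 0 := (sub_pos.2 hr1).ne'
  rw [e1, e2]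
  field_simp

theorem alSalamCarlitz_ratio (hq0 : 0 < q) (hq1 : q < 1) (hα : α < 0) {x : ℝ}
    (hx : x ∈ (alSalamCarlitz q α).supp.lattice q) :
    (alSalamCarlitz q α).ρ x / (alSalamCarlitz q α).ω x =
      (-α) ^ ((1 : ℝ) / 2) * pochInf (√q * x) q * pochInf (√q * x / α) q := by
  obtain ⟨hr0, hr1, hr2⟩ := sqrt_facts hq0 hq1
  have h6 : 0 < -α := by linarith
  rw [div_eq_iff ((alSalamCarlitz_isClassical hq0 hq1 hα).omega_ne_zero x hx)]
  simp only [alSalamCarlitz]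
  have e1 : (-α) ^ ((1 : ℝ) / 2) * (-α) ^ (-(1 : ℝ) / 2) = 1 := by
    rw [← Real.rpow_add h6]; norm_num
  rw [← pochInf_mul_pochInf hq0 hq1, ← pochInf_mul_pochInf hq0 hq1 (√q * x / α),
    show √q * x * √q = q * x by linear_combination x * hr2,
    show √q * x / α * √q = q * x / α by linear_combination x / α * hr2]
  linear_combination -(pochInf (√q * x) q * pochInf (q * x) q * (pochInf (√q * x / α) q *
    pochInf (q * x / α) q)) * e1

end Weight

end QEnsemble

end

noncomputable section

namespace QEnsemble

open Filter Topology Polynomial Support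

/-- An end point where the integrand vanishes can be dropped. The big `q`-Jacobi supports shrink by
one lattice step under a parameter shift, and this lemma absorbs the step. -/
lemma jackson_mul_of_eq_zero {r b : ℝ} {w : ℝ → ℝ}
    (hs : Summable fun n : ℕ => b * r ^ n * w (b * r ^ n)) (h0 : w b = 0) :
    jackson r (b * r) w = jackson r b w := by
  unfold jackson
  rw [hs.tsum_eq_zero_add]
  simp only [pow_zero, mul_one, h0, mul_zero, zero_add]
  congr 1
  refine tsum_congr fun n => ?_
  rw [pow_succ', mul_assoc b]

lemma jackson_scale (r s b : ℝ) (w : ℝ → ℝ) :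
    jackson r (s * b) w = s * jackson r b fun t => w (s * t) := by
  unfold jackson
  rw [mul_left_comm, ← tsum_mul_left (a := s)]
  congr 1
  refine tsum_congr fun n => ?_
  rw [mul_assoc s b, mul_assoc]

namespace Weight

variable {q a b c : ℝ}

/-! ### The big `q`-Jacobi weight -/

lemma bigJacobi_lt_one (hq0 : 0 < q) (hq1 : q < 1) (ha0 : 0 < a) (ha : a * √q < 1) (hb0 : 0 ≤ b)
    (hb : b * √q < 1) (hc : c < 0) {x : ℝ} (hx : x ∈ (bigJacobi q a b c).supp.lattice q) :
    x / a < 1 ∧ x / c < 1 ∧ x < 1 ∧ b / c * x < 1 ∧ √q * x / a < 1 ∧ √q * x / c < 1 := by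
  obtain ⟨hr0, hr1, -⟩ := sqrt_facts hq0 hq1
  have hx' : (0 < x ∧ x ≤ a * √q) ∨ (c * √q ≤ x ∧ x < 0) :=
    mem_segment_lattice hq0 hq1 (mul_nonpos_of_nonpos_of_nonneg hc.le hr0.le) (mul_pos ha0 hr0) hx
  have h1 : x / a ≤ √q := by
    rw [div_le_iff₀ ha0]
    rcases hx' with h | h
    · linarith
    · exact h.2.le.trans (mul_pos hr0 ha0).le
  have h2 : x / c ≤ √q := by
    rw [div_le_iff_of_neg hc]
    rcases hx' with h | h
    · exact (mul_nonpos_of_nonneg_of_nonpos hr0.le hc.le).trans h.1.le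
    · linarith
  have h3 : x < 1 := by rcases hx' with h | h <;> linarith
  have h4 : b / c * x < 1 := by
    rw [div_mul_eq_mul_div, mul_div_assoc]
    exact (mul_le_mul_of_nonneg_left h2 hb0).trans_lt hb
  refine ⟨h1.trans_lt hr1, h2.trans_lt hr1, h3, h4, ?_, ?_⟩
  · rw [mul_div_assoc]; exact sqrt_mul_lt_one hr0 hr1 h1 hr1.le
  · rw [mul_div_assoc]; exact sqrt_mul_lt_one hr0 hr1 h2 hr1.le

lemma bigJacobi_eval_f (x : ℝ) : (bigJacobi q a b c).f.eval x =
    (1 - x / (a * √q)) * (1 - x / (c * √q)) := by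
  simp [bigJacobi]; ring

lemma bigJacobi_eval_pearsonShift (hq0 : 0 < q) (hq1 : q < 1) (ha : a ≠ 0) (hc : c ≠ 0) (x : ℝ) :
    (pearsonShift (bigJacobi q a b c).f (bigJacobi q a b c).g √q).eval x =
      (1 - x) * (1 - b / c * x) := by
  obtain ⟨hr0, hr1, hr2⟩ := sqrt_facts hq0 hq1
  have h1 : 1 - √q ≠ 0 := (sub_pos.2 hr1).ne'
  have h2 := hr0.ne'
  rw [eval_pearsonShift, bigJacobi_eval_f]
  simp only [bigJacobi, eval_mul, eval_add, eval_X, eval_C]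
  rw [show a * c * q = a * c * (√q * √q) by rw [hr2]]
  field_simp
  ring

lemma bigJacobi_rho_shift (hq0 : 0 < q) (hq1 : q < 1) {x : ℝ} (hx : x < 1) (hbx : b / c * x < 1) :
    (1 - x / a) * (1 - x / c) * (bigJacobi q a b c).ρ (√q * x) =
      (1 - x) * (1 - b / c * x) * (bigJacobi q a b c).ρ x := by
  obtain ⟨hr0, hr1, hr2⟩ := sqrt_facts hq0 hq1
  have h1 := (pochInf_pos hr0 hr1 hx).ne'
  have h2 := (pochInf_pos hr0 hr1 hbx).ne'
  simp only [bigJacobi]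
  rw [pochInf_eq_mul hr0 hr1] at h1 h2
  rw [pochInf_eq_mul hr0 hr1 (x / a), pochInf_eq_mul hr0 hr1 (x / c), pochInf_eq_mul hr0 hr1 x,
    pochInf_eq_mul hr0 hr1 (b / c * x), show √q * x / a = x / a * √q by ring,
    show √q * x / c = x / c * √q by ring, show b / c * (√q * x) = b / c * x * √q by ring,
    mul_comm √q x]
  generalize pochInf (x / a * √q) √q = A
  generalize pochInf (x / c * √q) √q = B
  generalize pochInf (x * √q) √q = E at *
  generalize pochInf (b / c * x * √q) √q = F at *
  have h3 := right_ne_zero_of_mul h1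
  have h4 := right_ne_zero_of_mul h2
  rw [← mul_div_assoc, ← mul_div_assoc, div_eq_div_iff (mul_ne_zero h3 h4) (mul_ne_zero h1 h2)]
  ring

/-- Products with base `√q` split into even and odd factors with base `q`; `ω(x)` and `ω(√q x)` each
supply one half, and `f(√q x)` the first factors of the numerator. -/
lemma bigJacobi_omega_mul (hq0 : 0 < q) (hq1 : q < 1) (x : ℝ) :
    (1 - x / a) * (1 - x / c) * ((bigJacobi q a b c).ω x * (bigJacobi q a b c).ω (√q * x)) =
      (bigJacobi q a b c).ρ x := by
  obtain ⟨hr0, hr1, hr2⟩ := sqrt_facts hq0 hq1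
  have e : ∀ y, pochInf (y * √q) q * pochInf (y * √q * √q) q = pochInf (y * √q) √q :=
    fun y => pochInf_mul_pochInf hq0 hq1 _
  simp only [bigJacobi]
  rw [pochInf_eq_mul hr0 hr1 (x / a), pochInf_eq_mul hr0 hr1 (x / c), ← e, ← e,
    ← pochInf_mul_pochInf hq0 hq1 x, ← pochInf_mul_pochInf hq0 hq1 (b / c * x),
    show √q * x / a = x / a * √q by ring, show √q * x / c = x / c * √q by ring,
    show √q * (√q * x) / a = x / a * √q * √q by ring,
    show √q * (√q * x) / c = x / c * √q * √q by ring,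
    show b / c * (√q * x) = b / c * x * √q by ring, mul_comm √q x]
  rw [div_mul_div_comm, ← mul_div_assoc]
  congr 1 <;> ring

theorem bigJacobi_isClassical (hq0 : 0 < q) (hq1 : q < 1) (ha0 : 0 < a) (ha : a * √q < 1)
    (hb0 : 0 ≤ b) (hb : b * √q < 1) (hc : c < 0) : (bigJacobi q a b c).IsClassical q := by
  obtain ⟨hr0, hr1, hr2⟩ := sqrt_facts hq0 hq1
  have hr := hr0.ne'
  have hcr := continuous_pochInf hr0 hr1
  have hcq := continuous_pochInf hq0 hq1
  have hcρ : ContinuousAt (bigJacobi q a b c).ρ 0 := by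
    unfold bigJacobi; dsimp only
    refine ContinuousAt.div ?_ ?_ (by simp [pochInf_zero])
    · exact ((hcr.comp (by fun_prop : Continuous fun x : ℝ => x / a)).mul
        (hcr.comp (by fun_prop : Continuous fun x : ℝ => x / c))).continuousAt
    · exact (hcr.mul (hcr.comp (by fun_prop : Continuous fun x : ℝ => b / c * x))).continuousAt
  have hcω : ContinuousAt (bigJacobi q a b c).ω 0 := by
    unfold bigJacobi; dsimp only
    refine ContinuousAt.div ?_ ?_ (by simp [pochInf_zero])
    · exact ((hcq.comp (by fun_prop : Continuous fun x : ℝ => √q * x / a)).mul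
        (hcq.comp (by fun_prop : Continuous fun x : ℝ => √q * x / c))).continuousAt
    · exact (hcq.mul (hcq.comp (by fun_prop : Continuous fun x : ℝ => b / c * x))).continuousAt
  have hf : ∀ x, (bigJacobi q a b c).f.eval (√q * x) = (1 - x / a) * (1 - x / c) := by
    intro x
    rw [bigJacobi_eval_f, mul_comm a, mul_comm c, mul_div_mul_left _ _ hr, mul_div_mul_left _ _ hr]
  have hlt := fun x hx => bigJacobi_lt_one (x := x) hq0 hq1 ha0 ha hb0 hb hc hx
  have hρ0 : ∀ x ∈ (bigJacobi q a b c).supp.lattice q, (bigJacobi q a b c).ρ x ≠ 0 := by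
    intro x hx
    obtain ⟨h1, h2, h3, h4, h5, h6⟩ := hlt x hx
    exact (div_pos (mul_pos (pochInf_pos hr0 hr1 h1) (pochInf_pos hr0 hr1 h2))
      (mul_pos (pochInf_pos hr0 hr1 h3) (pochInf_pos hr0 hr1 h4))).ne'
  have hf0 : ∀ x ∈ (bigJacobi q a b c).supp.lattice q, (1 - x / a) * (1 - x / c) ≠ 0 := by
    intro x hx
    obtain ⟨h1, h2, h3, h4, h5, h6⟩ := hlt x hx
    exact (mul_pos (sub_pos.2 h1) (sub_pos.2 h2)).ne'
  refine ⟨?_, ?_, hρ0, fun x hx => ?_, fun x hx => ?_, fun x hx => ?_, fun x hx => ?_, ?_,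
    fun k => ?_, fun k => ?_⟩
  · simp only [bigJacobi]; compute_degree
  · simp only [bigJacobi]; compute_degree
  · obtain ⟨h1, h2, h3, h4, h5, h6⟩ := hlt x hx
    exact (div_pos (mul_pos (pochInf_pos hq0 hq1 h5) (pochInf_pos hq0 hq1 h6))
      (mul_pos (pochInf_pos hq0 hq1 h3) (pochInf_pos hq0 hq1 h4))).ne'
  · rw [hf]; exact hf0 x hx
  · obtain ⟨h1, h2, h3, h4, h5, h6⟩ := hlt x hx
    rw [hf, ← eval_pearsonShift, bigJacobi_eval_pearsonShift hq0 hq1 ha0.ne' hc.ne,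
      div_eq_div_iff (hρ0 x hx) (hf0 x hx), mul_comm, bigJacobi_rho_shift hq0 hq1 h3 h4]
  · rw [hf, eq_div_iff (hf0 x hx), mul_comm, bigJacobi_omega_mul hq0 hq1]
  · refine ⟨mul_nonpos_of_nonpos_of_nonneg hc.le hr0.le, mul_pos ha0 hr0, ?_, ?_,
      fun _ => ⟨_, hcω.tendsto.mono_left nhdsWithin_le_nhds⟩⟩
    · rw [bigJacobi_eval_f, div_self (mul_ne_zero hc.ne hr)]; ring
    · rw [bigJacobi_eval_f, div_self (mul_ne_zero ha0.ne' hr)]; ring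
  · have hcc : ContinuousAt (fun x => x ^ k * (bigJacobi q a b c).ρ x) 0 :=
      (continuous_pow k).continuousAt.mul hcρ
    exact integrable_segment hr0 hr1 (c * √q) (a * √q) hcc
  · have hcc : ContinuousAt (fun x => x ^ k * (bigJacobi q a b c).ω x) 0 :=
      (continuous_pow k).continuousAt.mul hcω
    exact integrable_segment hr0 hr1 (c * √q) (a * √q) hcc

theorem bigJacobi_exists_isMonicOP (hq0 : 0 < q) (hq1 : q < 1) (ha0 : 0 < a) (ha : a * √q < 1)
    (hb0 : 0 ≤ b) (hb : b * √q < 1) (hc : c < 0) : ∃ p, (bigJacobi q a b c).IsMonicOP q p := by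
  obtain ⟨hr0, hr1, hr2⟩ := sqrt_facts hq0 hq1
  refine (bigJacobi_isClassical hq0 hq1 ha0 ha hb0 hb hc).exists_isMonicOP fun P hP =>
    IsClassical.functional_mul_self_pos _ hq0 hq1 (fun x hx => ?_) hP
  obtain ⟨h1, h2, h3, h4, h5, h6⟩ := bigJacobi_lt_one hq0 hq1 ha0 ha hb0 hb hc hx
  exact div_pos (mul_pos (pochInf_pos hr0 hr1 h1) (pochInf_pos hr0 hr1 h2))
      (mul_pos (pochInf_pos hr0 hr1 h3) (pochInf_pos hr0 hr1 h4))

theorem bigJacobi_ratio (hq0 : 0 < q) (hq1 : q < 1) (ha0 : 0 < a) (ha : a * √q < 1)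
    (hb0 : 0 ≤ b) (hb : b * √q < 1) (hc : c < 0) {x : ℝ}
    (hx : x ∈ (bigJacobi q a b c).supp.lattice q) :
    (bigJacobi q a b c).ρ x / (bigJacobi q a b c).ω x =
      pochInf (x / a) q * pochInf (x / c) q /
        (pochInf (√q * x) q * pochInf (b / c * √q * x) q) := by
  obtain ⟨hr0, hr1, hr2⟩ := sqrt_facts hq0 hq1
  rw [div_eq_iff ((bigJacobi_isClassical hq0 hq1 ha0 ha hb0 hb hc).omega_ne_zero x hx)]
  simp only [bigJacobi]
  rw [← pochInf_mul_pochInf hq0 hq1 x, ← pochInf_mul_pochInf hq0 hq1 (b / c * x),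
    ← pochInf_mul_pochInf hq0 hq1 (x / a), ← pochInf_mul_pochInf hq0 hq1 (x / c),
    show √q * x / a = x / a * √q by ring, show √q * x / c = x / c * √q by ring,
    show b / c * √q * x = b / c * x * √q by ring, mul_comm √q x, div_mul_div_comm]
  congr 1 <;> ring

lemma bigJacobi_pearsonLead (hq0 : 0 < q) (hq1 : q < 1) (ha : a ≠ 0) (hc : c ≠ 0) (n : ℕ) :
    -((1 - √q) * pearsonLead (bigJacobi q a b c).f (bigJacobi q a b c).g √q n) * (a * c * q) =
      -(1 - a * b * √q ^ (n + 2)) := by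
  obtain ⟨hr0, hr1, hr2⟩ := sqrt_facts hq0 hq1
  have h2 : 1 - √q ≠ 0 := (sub_pos.2 hr1).ne'
  have hr := hr0.ne'
  have hf : (bigJacobi q a b c).f = C (1 / (a * √q) * (1 / (c * √q))) * X ^ 2 -
      C (1 / (a * √q) + 1 / (c * √q)) * X + 1 := by
    simp only [bigJacobi, C_add, C_mul]; ring
  have e1 : (bigJacobi q a b c).f.coeff 2 = 1 / (a * c * q) := by
    rw [hf]
    simp only [coeff_add, coeff_sub, coeff_C_mul, coeff_X_pow, coeff_X, coeff_one]
    rw [show a * c * q = a * c * (√q * √q) by rw [hr2]]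
    norm_num
    field_simp
  have e2 : (bigJacobi q a b c).g.coeff 1 = 1 / (1 - √q) * (1 / (a * c * q) - b / c) := by
    simp [bigJacobi, coeff_one]
  rw [pearsonLead, e1, e2, mul_div_cancel₀ _ h2]
  have hq : q ≠ 0 := hq0.ne'
  have e3 : √q ^ (n + 2) = √q ^ n * q := by rw [pow_add, ← hr2]; ring_nf; simp
  rw [e3]
  field_simp
  ring

/-- Multiplication by `f` multiplies all three parameters by `√q`. The support changes as well, but
`f` vanishes at the old end points, so the integral does not notice. -/
lemma bigJacobi_functional_shift (hq0 : 0 < q) (hq1 : q < 1) (h : (bigJacobi q a b c).IsClassical q)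
    (h' : (bigJacobi q (a * √q) (b * √q) (c * √q)).IsClassical q) (w : ℝ[X]) :
    h.functional ((bigJacobi q a b c).f * w) = 1 * h'.functional w := by
  obtain ⟨hr0, hr1, hr2⟩ := sqrt_facts hq0 hq1
  have hr := hr0.ne'
  have hρ : ∀ x, (bigJacobi q a b c).f.eval x * (bigJacobi q a b c).ρ x =
      (bigJacobi q (a * √q) (b * √q) (c * √q)).ρ x := by
    intro x
    rw [bigJacobi_eval_f]
    simp only [bigJacobi]
    rw [pochInf_eq_mul hr0 hr1 (x / (a * √q)), pochInf_eq_mul hr0 hr1 (x / (c * √q)),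
      mul_div_mul_right _ _ hr, show x / (a * √q) * √q = x / a by field_simp,
      show x / (c * √q) * √q = x / c by field_simp, ← mul_div_assoc]
    congr 1; ring
  set v : ℝ → ℝ := fun x => ((bigJacobi q a b c).f * w).eval x * (bigJacobi q a b c).ρ x with hv
  have hv' : v = fun x => w.eval x * (bigJacobi q (a * √q) (b * √q) (c * √q)).ρ x := by
    ext x; rw [hv, ← hρ]; simp only [eval_mul]; ring
  have hvb : ∀ s, v ((bigJacobi q a b c).supp.base s) = 0 := fun s => by
    simp only [hv, eval_mul]
    rw [h.f_base (bounded_segment _ _), zero_mul, zero_mul]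
  have hs : ∀ s : Bool, Summable fun n : ℕ => (if s then a * √q else c * √q) * √q ^ n *
      v ((if s then a * √q else c * √q) * √q ^ n) := by
    intro s
    have h1 := (h.summable_rho ((bigJacobi q a b c).f * w) s).comp_injective
      (Nat.cast_injective (R := ℤ))
    have h2 : 1 - √q ≠ 0 := (sub_pos.2 hr1).ne'
    refine (summable_mul_left_iff h2).1 (h1.congr fun n => ?_)
    exact segment_arm_natCast (c * √q) (a * √q) √q s v n
  rw [one_mul, h.functional_apply, h'.functional_apply, ← hv']
  change jackson √q (a * √q) v - jackson √q (c * √q) v =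
    jackson √q (a * √q * √q) v - jackson √q (c * √q * √q) v
  exact congrArg₂ _ (jackson_mul_of_eq_zero (hs true) (hvb true)).symm
    (jackson_mul_of_eq_zero (hs false) (hvb false)).symm

lemma bigJacobi_mass (hq0 : 0 < q) (hq1 : q < 1) (ha0 : 0 < a) (ha : a * √q < 1) (hb0 : 0 ≤ b)
    (hb : b * √q < 1) (hc : c < 0) :
    (bigJacobi q a b c).supp.integral √q (bigJacobi q a b c).ρ = a * √q * ((1 - √q) *
      (pochInf √q √q * pochInf (c / a) √q * pochInf (a / c * √q) √q * pochInf (a * b * √q ^ 2) √q) /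
      (pochInf (a * √q) √q * pochInf (c * √q) √q * pochInf (a * b / c * √q) √q *
        pochInf (b * √q) √q)) := by
  obtain ⟨hr0, hr1, hr2⟩ := sqrt_facts hq0 hq1
  have ha1 := ha0.ne'
  have hc1 := hc.ne
  have hr := hr0.ne'
  have hcr : c * √q < 1 := (mul_neg_of_neg_of_pos hc hr0).trans one_pos
  have e1 : a * √q * (c / a) = c * √q := by field_simp
  have e2 : a * b / c * √q * (c / a) = b * √q := by field_simp
  have e3 : a * √q * (a * b / c * √q) * (c / a) = a * b * √q ^ 2 := by field_simp
  have e4 : √q / (c / a) = a / c * √q := by field_simp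
  have h1 : a * b / c * √q < 1 := by
    refine lt_of_le_of_lt ?_ one_pos
    exact mul_nonpos_of_nonpos_of_nonneg
      (div_nonpos_of_nonneg_of_nonpos (mul_nonneg ha0.le hb0) hc.le) hr0.le
  -- The substitution `x = a √q t` carries the support to the segment from `c/a` to `1` and the
  -- weight to the Andrews–Askey weight.
  have key := askeyInt_eq hr0 hr1 (A := a * √q) (B := a * b / c * √q) (α := c / a)
    (div_neg_of_neg_of_pos hc ha0) ha (by rwa [e1]) h1 (by rwa [e2])
  rw [e1, e2, e3, e4] at key
  rw [← key, askeyInt, mul_sub]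
  have hw : askeyWeight √q (a * √q) (a * b / c * √q) (c / a) =
      fun t => (bigJacobi q a b c).ρ (a * √q * t) := by
    ext t
    simp only [askeyWeight, bigJacobi]
    rw [show a * √q * t / a = √q * t by field_simp,
      show a * √q * t / c = √q * t / (c / a) by field_simp,
      show b / c * (a * √q * t) = a * b / c * √q * t by ring]
  rw [hw, ← jackson_scale, ← jackson_scale, mul_one, e1]
  rfl

/-- Lowering the degree changes all parameters, so the induction runs over `a, b, c` simultaneously.
The ratios `c/a`, `a/c` are invariant, which is why two factors do not depend on `n`. -/
lemma bigJacobi_norm (hq0 : 0 < q) (hq1 : q < 1) (n : ℕ) : ∀ {a b c : ℝ} (ha0 : 0 < a)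
    (ha : a * √q < 1) (hb0 : 0 ≤ b) (hb : b * √q < 1) (hc : c < 0) {P : ℝ[X]}
    (_ : IsOrth (bigJacobi_isClassical hq0 hq1 ha0 ha hb0 hb hc).functional n P),
    (bigJacobi_isClassical hq0 hq1 ha0 ha hb0 hb hc).functional (P * P) =
      (-(a * c)) ^ n * √q ^ (n.choose 2 + 2 * n + 1) * pochFin √q √q n /
        pochFin (a * b * √q ^ (n + 1)) √q n * (a * (1 - √q) *
      (pochInf √q √q * pochInf (c / a) √q * pochInf (a / c * √q) √q *
        pochInf (a * b * √q ^ (2 * n + 2)) √q) /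
      (pochInf (a * √q ^ (n + 1)) √q * pochInf (c * √q ^ (n + 1)) √q *
        pochInf (a * b / c * √q ^ (n + 1)) √q * pochInf (b * √q ^ (n + 1)) √q)) := by
  obtain ⟨hr0, hr1, hr2⟩ := sqrt_facts hq0 hq1
  have hr := hr0.ne'
  induction n with
  | zero =>
    intro a b c ha0 ha hb0 hb hc P hP
    rw [IsOrth.zero_iff.1 hP, mul_one, IsClassical.functional_apply]
    simp only [eval_one, one_mul]
    rw [bigJacobi_mass hq0 hq1 ha0 ha hb0 hb hc]
    simp only [pochFin_zero, pow_zero, Nat.choose_zero_succ, mul_zero, zero_add, pow_one, div_one,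
      one_mul, mul_one]
    ring
  | succ n ih =>
    intro a b c ha0 ha hb0 hb hc P hP
    have h := bigJacobi_isClassical hq0 hq1 ha0 ha hb0 hb hc
    have hsm : ∀ {z : ℝ}, 0 ≤ z → z * √q < 1 → z * √q * √q < 1 := fun hz hz1 => by
      have := mul_pow_lt_one hr0 hr1 hz1 1; rwa [pow_one] at this
    have h' := bigJacobi_isClassical hq0 hq1 (mul_pos ha0 hr0) (hsm ha0.le ha)
      (mul_nonneg hb0 hr0.le) (hsm hb0 hb) (mul_neg_of_neg_of_pos hc hr0)
    obtain ⟨P', hP', e⟩ := hP.exists_lower_mul (v := h'.functional) (κ := 1) hr0 hr1 h.natDegree_f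
      h.natDegree_g (h.functional_pearsonOp hq0 hq1) one_ne_zero
      (bigJacobi_functional_shift hq0 hq1 h h')
    rw [ih (mul_pos ha0 hr0) (hsm ha0.le ha) (mul_nonneg hb0 hr0.le) (hsm hb0 hb)
      (mul_neg_of_neg_of_pos hc hr0) hP', mul_one] at e
    have e1 := bigJacobi_pearsonLead (b := b) hq0 hq1 ha0.ne' hc.ne n
    have hab : a * b * √q ^ (n + 2) < 1 := by
      have h1 : a * √q * (b * √q) < 1 := mul_lt_one_of_nonneg_of_lt_one_left (mul_pos ha0 hr0).le ha hb.le
      have := mul_pow_lt_one hr0 hr1 h1 n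
      rwa [show a * √q * (b * √q) * √q ^ n = a * b * √q ^ (n + 2) by ring] at this
    have e2 : -((1 - √q) * pearsonLead (bigJacobi q a b c).f (bigJacobi q a b c).g √q n) *
        (a * c * (√q * √q)) = -(1 - a * b * √q ^ (n + 2)) := by rw [hr2]; exact e1
    have hI : (√q)⁻¹ ^ (n + 1) * √q ^ (n + 1) = 1 := by
      rw [← mul_pow, inv_mul_cancel₀ hr, one_pow]
    rw [mul_div_mul_right _ _ hr, mul_div_mul_right _ _ hr,
      show a * √q * (b * √q) * √q ^ (n + 1) = a * b * √q ^ (n + 1 + 1) * √q by ring,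
      show a * √q * (b * √q) * √q ^ (2 * n + 2) = a * b * √q ^ (2 * (n + 1) + 2) by ring,
      show a * √q * (b * √q) / (c * √q) * √q ^ (n + 1) = a * b / c * √q ^ (n + 1 + 1) by
        field_simp; ring,
      show a * √q * √q ^ (n + 1) = a * √q ^ (n + 1 + 1) by ring,
      show b * √q * √q ^ (n + 1) = b * √q ^ (n + 1 + 1) by ring,
      show c * √q * √q ^ (n + 1) = c * √q ^ (n + 1 + 1) by ring] at e
    rw [pochFin_succ' (a * b * _), pochFin_succ, Nat.choose_succ_left n 2 (by norm_num),
      Nat.choose_one_right, mul_comm (1 - _) (pochFin (_ * √q) √q n), ← div_div, ← pow_succ' √q n,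
      div_mul_eq_mul_div, eq_div_iff (sub_pos.2 hab).ne']
    generalize pochFin (a * b * √q ^ (n + 1 + 1) * √q) √q n = G at *
    generalize (√q)⁻¹ ^ (n + 1) = I at *
    generalize pearsonLead (bigJacobi q a b c).f (bigJacobi q a b c).g √q n = L at *
    generalize pochInf √q √q * pochInf (c / a) √q * pochInf (a / c * √q) √q *
        pochInf (a * b * √q ^ (2 * (n + 1) + 2)) √q = N at *
    generalize pochInf (a * √q ^ (n + 1 + 1)) √q * pochInf (c * √q ^ (n + 1 + 1)) √q *
        pochInf (a * b / c * √q ^ (n + 1 + 1)) √q * pochInf (b * √q ^ (n + 1 + 1)) √q = D at *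
    generalize pochFin √q √q n = F at *
    change h.functional (P * P) * _ = _
    generalize h.functional (P * P) = H at *
    have e3 : (-(a * c)) ^ n * √q ^ (n.choose 2 + 2 * n + 1) * √q ^ (2 * n) =
        (-(a * √q * (c * √q))) ^ n * √q ^ (n.choose 2 + 2 * n + 1) := by
      rw [pow_mul √q 2 n, mul_right_comm, ← mul_pow]; congr 2; ring
    rw [← e3] at e
    have e4 : √q ^ (n + n.choose 2 + 2 * (n + 1) + 1) * √q ^ (n + 1) =
        √q ^ (n.choose 2 + 2 * n + 1) * √q ^ (2 * n) * √q ^ 3 := by ring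
    have e5 : √q ^ (n + n.choose 2 + 2 * (n + 1) + 1) =
        I * (√q ^ (n.choose 2 + 2 * n + 1) * √q ^ (2 * n) * √q ^ 3) := by
      rw [← e4]; linear_combination -(√q ^ (n + n.choose 2 + 2 * (n + 1) + 1)) * hI
    rw [e5]
    linear_combination H * e2 + a * c * √q ^ 2 * e

theorem bigJacobi_gamma (hq0 : 0 < q) (hq1 : q < 1) (ha0 : 0 < a) (ha : a * √q < 1)
    (hb0 : 0 ≤ b) (hb : b * √q < 1) (hc : c < 0) {p : ℕ → ℝ[X]}
    (hp : (bigJacobi q a b c).IsMonicOP q p) {n : ℕ} (hn : 1 ≤ n) :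
    (bigJacobi q a b c).gamma q p (2 * n - 2) = bigJacobiConst q a b c n := by
  obtain ⟨hr0, hr1, hr2⟩ := sqrt_facts hq0 hq1
  obtain ⟨m, rfl⟩ := Nat.exists_eq_add_of_le' hn
  have hr := hr0.ne'
  have h := bigJacobi_isClassical hq0 hq1 ha0 ha hb0 hb hc
  have hj : 2 * (m + 1) - 2 = 2 * m := by omega
  have hj' : 2 * (m + 1) - 1 = 2 * m + 1 := by omega
  rw [hj, h.gamma_eq_of_norm hq0 hq1 hp,
    bigJacobi_norm hq0 hq1 _ ha0 ha hb0 hb hc ((h.isOP hp).isOrth _), bigJacobiConst, hj, hj']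
  have e1 := bigJacobi_pearsonLead (b := b) hq0 hq1 ha0.ne' hc.ne (2 * (2 * m))
  have hch : (2 * m).choose 2 + m = 2 * m * m := by
    rw [Nat.choose_two_right]
    rcases m with _ | m
    · rfl
    · have : 2 * (m + 1) * (2 * (m + 1) - 1) / 2 = (m + 1) * (2 * m + 1) := by
        rw [mul_assoc, Nat.mul_div_cancel_left _ two_pos]; rfl
      rw [this]; ring
  have f1 : q ^ (-((m + 1 : ℕ) : ℝ) ^ 2 - ((m + 1 : ℕ) : ℝ) / 2) =
      (√q ^ ((m + 1) * (2 * m + 3)))⁻¹ := by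
    rw [rpow_eq_sqrt_rpow hq0, ← Real.rpow_natCast √q ((m + 1) * (2 * m + 3)),
      ← Real.rpow_neg hr0.le]
    congr 1; push_cast; ring
  have f2 : q ^ ((2 * ((m + 1 : ℕ) : ℝ) - 1) / 2) = √q ^ (2 * m + 1) := by
    rw [rpow_eq_sqrt_rpow hq0, ← Real.rpow_natCast √q (2 * m + 1)]
    congr 1; push_cast; ring
  have f3 : q ^ (2 * ((m + 1 : ℕ) : ℝ) - 1 / 2) = √q ^ (4 * m + 3) := by
    rw [rpow_eq_sqrt_rpow hq0, ← Real.rpow_natCast √q (4 * m + 3)]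
    congr 1; push_cast; ring
  have f4 : √q ^ ((m + 1) * (2 * m + 3)) =
      √q ^ ((2 * m).choose 2 + 2 * (2 * m) + 1) * √q ^ (2 * m) * √q ^ 2 := by
    rw [← pow_add, ← pow_add]
    congr 1
    nlinarith
  -- The stated constant uses infinite products at `z √q`, the norm formula uses them at `z √q ^ (2m
  -- + 1)`; the quotient is the finite product in the denominator of the constant.
  have g : ∀ z, pochInf (z * √q) √q = pochFin (z * √q) √q (2 * m) *
      pochInf (z * √q ^ (2 * m + 1)) √q := fun z => by
    rw [pochInf_eq_pochFin_mul hr0 hr1 (z * √q) (2 * m)]; congr 2; ring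
  have g1 : pochInf (a * b * √q ^ (2 * (2 * m) + 2)) √q =
      (1 - a * b * √q ^ (2 * (2 * m) + 2)) * pochInf (a * b * √q ^ (4 * m + 3)) √q := by
    rw [pochInf_eq_mul hr0 hr1]; congr 2; ring
  have hneg : ∀ z, z ≤ 0 → z * √q < 1 := fun z hz =>
    (mul_nonpos_of_nonpos_of_nonneg hz hr0.le).trans_lt one_pos
  have hbc : a * b / c ≤ 0 := div_nonpos_of_nonneg_of_nonpos (mul_nonneg ha0.le hb0) hc.le
  have key : ∀ z, z * √q < 1 → pochFin (z * √q) √q (2 * m) ≠ 0 ∧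
      pochInf (z * √q ^ (2 * m + 1)) √q ≠ 0 := fun z hz => by
    have := (pochInf_pos hr0 hr1 hz).ne'
    rw [g] at this
    exact ⟨left_ne_zero_of_mul this, right_ne_zero_of_mul this⟩
  obtain ⟨k1, k2⟩ := key a ha
  obtain ⟨k3, k4⟩ := key b hb
  obtain ⟨k5, k6⟩ := key c (hneg c hc.le)
  obtain ⟨k7, k8⟩ := key (a * b / c) (hneg _ hbc)
  have hab : a * √q * (b * √q) < 1 :=
    mul_lt_one_of_nonneg_of_lt_one_left (mul_pos ha0 hr0).le ha hb.le
  have hab' : ∀ k, a * b * √q ^ (k + 2) < 1 := fun k => by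
    have := mul_pow_lt_one hr0 hr1 hab k
    rwa [show a * √q * (b * √q) * √q ^ k = a * b * √q ^ (k + 2) by ring] at this
  have hΔ := (sub_pos.2 (hab' (2 * (2 * m)))).ne'
  rw [f1, f2, f3, f4, g a, g b, g c, g (a * b / c), g1, inv_pow]
  have e2 : -((1 - √q) * pearsonLead (bigJacobi q a b c).f (bigJacobi q a b c).g √q (2 * (2 * m)))
      = -(1 - a * b * √q ^ (2 * (2 * m) + 2)) / (a * c * √q ^ 2) := by
    rw [eq_div_iff (mul_ne_zero (mul_ne_zero ha0.ne' hc.ne) (pow_ne_zero 2 hr)), ← e1, sq, hr2]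
  rw [e2]
  have e3 : (-(a * c)) ^ (2 * m) = a ^ (2 * m) * c ^ (2 * m) := by
    rw [Even.neg_pow (even_two_mul m), mul_pow]
  rw [e3, show a ^ (2 * (m + 1)) = a ^ (2 * m) * a ^ 2 by ring, pow_succ c (2 * m)]
  have k9 : 1 - √q ≠ 0 := (sub_pos.2 hr1).ne'
  have k10 : 1 - q ≠ 0 := (sub_pos.2 hq1).ne'
  have k11 := hc.ne
  have k12 := ha0.ne'
  generalize pochFin (a * √q) √q (2 * m) = A at *
  generalize pochFin (b * √q) √q (2 * m) = B at *
  generalize pochFin (c * √q) √q (2 * m) = C at *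
  generalize pochFin (a * b / c * √q) √q (2 * m) = E at *
  generalize pochInf (a * √q ^ (2 * m + 1)) √q = A' at *
  generalize pochInf (b * √q ^ (2 * m + 1)) √q = B' at *
  generalize pochInf (c * √q ^ (2 * m + 1)) √q = C' at *
  generalize pochInf (a * b / c * √q ^ (2 * m + 1)) √q = E' at *
  generalize pochInf (a * b * √q ^ (4 * m + 3)) √q = F at *
  generalize pochFin (a * b * √q ^ (2 * m + 1)) √q (2 * m) = G
  generalize pochFin √q √q (2 * m) = H
  generalize pochInf √q √q = R
  generalize pochInf (c / a) √q = S
  generalize pochInf (a / c * √q) √q = T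
  generalize 1 - a * b * √q ^ (2 * (2 * m) + 2) = Δ at *
  generalize 1 - √q = δ at *
  generalize 1 - q = ε at *
  field_simp

end Weight

end QEnsemble

end

noncomputable section

namespace QEnsemble

open Filter Topology Polynomial Support

/-- The terms are of order `(r ^ (s + 1)) ^ n`, a convergent geometric series for `s > -1`. -/
lemma integrable_segment_rpow {r s : ℝ} (hr0 : 0 < r) (hr1 : r < 1) (hs : -1 < s) {V : ℝ → ℝ}
    (hV : ContinuousAt V 0) : (segment 0 1).Integrable r fun x => x ^ s * V x := by
  refine ⟨?_, by simp⟩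
  have h1 : r ^ (s + 1) < 1 := Real.rpow_lt_one hr0.le hr1 (by linarith)
  refine summable_of_isBigO_nat
    (summable_geometric_of_lt_one (Real.rpow_pos_of_pos hr0 (s + 1)).le h1) ?_
  have h2 : (fun n : ℕ => V (1 * r ^ n)) =O[atTop] fun _ => (1 : ℝ) :=
    (hV.tendsto.comp (tendsto_mul_pow hr0 hr1 1)).isBigO_one ℝ
  have h3 := (Asymptotics.isBigO_refl (fun n : ℕ => (r ^ (s + 1)) ^ n) atTop).mul h2
  simp only [mul_one] at h3
  refine h3.congr_left fun n => ?_
  rw [one_mul, ← mul_assoc]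
  congr 1
  rw [← Real.rpow_natCast, ← Real.rpow_natCast, ← Real.rpow_mul hr0.le, ← Real.rpow_mul hr0.le,
    ← Real.rpow_add hr0]
  congr 1; ring

namespace Weight

variable {q α β : ℝ}

/-! ### The little `q`-Jacobi weight -/

lemma littleJacobi_rho (hq0 : 0 < q) (x : ℝ) : (littleJacobi q α β).ρ x =
    x ^ α * (pochInf (√q * x) √q / pochInf (√q ^ (β + 1) * x) √q) := by
  simp only [littleJacobi, pochReal]
  rw [Real.rpow_add_one (Real.sqrt_pos.2 hq0).ne',
    show √q * x * √q ^ β = √q ^ β * √q * x by ring]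

/-- The order `(β - 1)/2` with base `q` gives the same denominator parameter `√q ^ (β + 1)` as in
`ρ`, since `q ^ ((β - 1)/2) * q = √q ^ (β + 1)`. Even-odd splitting can then match the two weights.
-/
lemma littleJacobi_omega (hq0 : 0 < q) (x : ℝ) : (littleJacobi q α β).ω x =
    q ^ (-(α + 1) / 8) * x ^ ((α - 1) / 2) *
      (pochInf (q * x) q / pochInf (√q ^ (β + 1) * x) q) := by
  simp only [littleJacobi, pochReal]
  have e : q ^ ((β - 1) / 2) * q = √q ^ (β + 1) := by
    rw [← Real.rpow_add_one hq0.ne', rpow_eq_sqrt_rpow hq0]; congr 1; ring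
  rw [← e, show q * x * q ^ ((β - 1) / 2) = q ^ ((β - 1) / 2) * q * x by ring]

lemma littleJacobi_eval_f (x : ℝ) : (littleJacobi q α β).f.eval x = x * (1 - x) := by
  simp [littleJacobi]

lemma littleJacobi_eval_pearsonShift (hq0 : 0 < q) (hq1 : q < 1) (x : ℝ) :
    (pearsonShift (littleJacobi q α β).f (littleJacobi q α β).g √q).eval x =
      √q ^ (α + 1) * x * (1 - √q ^ (β + 1) * x) := by
  obtain ⟨hr0, hr1, hr2⟩ := sqrt_facts hq0 hq1
  have h1 : 1 - √q ≠ 0 := (sub_pos.2 hr1).ne'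
  have e : √q ^ (α + β + 2) = √q ^ (α + 1) * √q ^ (β + 1) := by
    rw [← Real.rpow_add hr0]; congr 1; ring
  rw [eval_pearsonShift, littleJacobi_eval_f]
  simp only [littleJacobi, eval_mul, eval_neg, eval_sub, eval_X, eval_C, qNumber]
  rw [e]
  field_simp
  ring

lemma littleJacobi_lt_one (hq0 : 0 < q) (hq1 : q < 1) (hβ : -1 < β) {x : ℝ} (hx : 0 < x ∧ x ≤ 1) :
    √q * x < 1 ∧ q * x < 1 ∧ √q ^ (β + 1) * x < 1 := by
  obtain ⟨hr0, hr1, hr2⟩ := sqrt_facts hq0 hq1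
  exact ⟨sqrt_mul_lt_one hr0 hr1 hx.2 le_rfl, sqrt_mul_lt_one hq0 hq1 hx.2 le_rfl,
    sqrt_mul_lt_one (Real.rpow_pos_of_pos hr0 _) (Real.rpow_lt_one hr0.le hr1 (by linarith))
      hx.2 le_rfl⟩

lemma littleJacobi_mem {x : ℝ} (hq0 : 0 < q) (hq1 : q < 1)
    (hx : x ∈ (littleJacobi q α β).supp.lattice q) : 0 < x ∧ x ≤ 1 := by
  have : (0 < x ∧ x ≤ 1) ∨ (0 ≤ x ∧ x < 0) := mem_segment_lattice hq0 hq1 le_rfl one_pos hx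
  exact this.resolve_right fun h => absurd h.1 (not_le.2 h.2)

lemma littleJacobi_rho_pos (hq0 : 0 < q) (hq1 : q < 1) (hβ : -1 < β) {x : ℝ}
    (hx : 0 < x ∧ x ≤ 1) : 0 < (littleJacobi q α β).ρ x := by
  obtain ⟨hr0, hr1, hr2⟩ := sqrt_facts hq0 hq1
  obtain ⟨h1, h2, h3⟩ := littleJacobi_lt_one hq0 hq1 hβ hx
  rw [littleJacobi_rho hq0]
  exact mul_pos (Real.rpow_pos_of_pos hx.1 _)
    (div_pos (pochInf_pos hr0 hr1 h1) (pochInf_pos hr0 hr1 h3))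

lemma littleJacobi_omega_pos (hq0 : 0 < q) (hq1 : q < 1) (hβ : -1 < β) {x : ℝ}
    (hx : 0 < x ∧ x ≤ 1) : 0 < (littleJacobi q α β).ω x := by
  obtain ⟨h1, h2, h3⟩ := littleJacobi_lt_one hq0 hq1 hβ hx
  rw [littleJacobi_omega hq0]
  exact mul_pos (mul_pos (Real.rpow_pos_of_pos hq0 _) (Real.rpow_pos_of_pos hx.1 _))
    (div_pos (pochInf_pos hq0 hq1 h2) (pochInf_pos hq0 hq1 h3))

lemma littleJacobi_rho_shift (hq0 : 0 < q) (hq1 : q < 1) (hβ : -1 < β) {x : ℝ}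
    (hx : 0 < x ∧ x ≤ 1) : √q * x * (1 - √q * x) * (littleJacobi q α β).ρ (√q * x) =
      √q ^ (α + 1) * x * (1 - √q ^ (β + 1) * x) * (littleJacobi q α β).ρ x := by
  obtain ⟨hr0, hr1, hr2⟩ := sqrt_facts hq0 hq1
  obtain ⟨h1, h2, h3⟩ := littleJacobi_lt_one hq0 hq1 hβ hx
  have h4 := (pochInf_pos hr0 hr1 h3).ne'
  rw [littleJacobi_rho hq0, littleJacobi_rho hq0, Real.mul_rpow hr0.le hx.1.le,
    Real.rpow_add_one hr0.ne' α, pochInf_eq_mul hr0 hr1 (√q * x),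
    pochInf_eq_mul hr0 hr1 (√q ^ (β + 1) * x), mul_comm √q (√q * x), ← mul_assoc (√q ^ (β + 1)),
    mul_right_comm (√q ^ (β + 1)) √q x]
  rw [pochInf_eq_mul hr0 hr1] at h4
  have h5 := left_ne_zero_of_mul h4
  generalize pochInf (√q ^ (β + 1) * x * √q) √q = A at *
  generalize pochInf (√q * x * √q) √q = B
  generalize 1 - √q ^ (β + 1) * x = D at *
  have e : D * ((1 - √q * x) * B / (D * A)) = (1 - √q * x) * B / A := by
    rw [← mul_div_assoc, mul_div_mul_left _ _ h5]
  linear_combination -(√q ^ α * √q * x * x ^ α) * e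

lemma littleJacobi_omega_mul (hq0 : 0 < q) (hq1 : q < 1) {x : ℝ}
    (hx : 0 < x ∧ x ≤ 1) : √q * x * (1 - √q * x) *
      ((littleJacobi q α β).ω x * (littleJacobi q α β).ω (√q * x)) =
      (littleJacobi q α β).ρ x := by
  obtain ⟨hr0, hr1, hr2⟩ := sqrt_facts hq0 hq1
  rw [littleJacobi_rho hq0, littleJacobi_omega hq0, littleJacobi_omega hq0,
    Real.mul_rpow hr0.le hx.1.le, pochInf_eq_mul hr0 hr1 (√q * x),
    show √q * x * √q = q * x by linear_combination x * hr2,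
    ← pochInf_mul_pochInf hq0 hq1 (q * x), ← pochInf_mul_pochInf hq0 hq1 (√q ^ (β + 1) * x),
    show q * (√q * x) = q * x * √q by ring,
    show √q ^ (β + 1) * (√q * x) = √q ^ (β + 1) * x * √q by ring]
  have e1 : x ^ ((α - 1) / 2) * x ^ ((α - 1) / 2) * x = x ^ α := by
    rw [← Real.rpow_add hx.1, ← Real.rpow_add_one hx.1.ne']; congr 1; ring
  have e2 : q ^ (-(α + 1) / 8) * q ^ (-(α + 1) / 8) * √q ^ ((α - 1) / 2) * √q = 1 := by
    rw [rpow_eq_sqrt_rpow hq0, ← Real.rpow_add hr0, ← Real.rpow_add hr0,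
      ← Real.rpow_add_one hr0.ne', ← Real.rpow_zero √q]
    congr 1; ring
  rw [← e1, mul_div_assoc (1 - √q * x), mul_div_mul_comm (pochInf (q * x) q)]
  generalize pochInf (q * x) q / pochInf (√q ^ (β + 1) * x) q = A
  generalize pochInf (q * x * √q) q / pochInf (√q ^ (β + 1) * x * √q) q = B
  linear_combination (x ^ ((α - 1) / 2) * x ^ ((α - 1) / 2) * x * (1 - √q * x) * A * B) * e2

theorem littleJacobi_isClassical (hq0 : 0 < q) (hq1 : q < 1) (hα : -1 < α) (hβ : -1 < β) :
    (littleJacobi q α β).IsClassical q := by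
  obtain ⟨hr0, hr1, hr2⟩ := sqrt_facts hq0 hq1
  have hcr := continuous_pochInf hr0 hr1
  have hcq := continuous_pochInf hq0 hq1
  have hf0 : ∀ x ∈ (littleJacobi q α β).supp.lattice q,
      (littleJacobi q α β).f.eval (√q * x) ≠ 0 := by
    intro x hx
    rw [littleJacobi_eval_f]
    have hx' := littleJacobi_mem hq0 hq1 hx
    exact (mul_pos (mul_pos hr0 hx'.1) (sub_pos.2 (littleJacobi_lt_one hq0 hq1 hβ hx').1)).ne'
  refine ⟨?_, ?_, fun x hx => (littleJacobi_rho_pos hq0 hq1 hβ (littleJacobi_mem hq0 hq1 hx)).ne',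
    fun x hx => (littleJacobi_omega_pos hq0 hq1 hβ (littleJacobi_mem hq0 hq1 hx)).ne', hf0,
    fun x hx => ?_, fun x hx => ?_, ?_, fun k => ?_, fun k => ?_⟩
  · simp only [littleJacobi]; compute_degree
  · simp only [littleJacobi]; compute_degree
  · have hx' := littleJacobi_mem hq0 hq1 hx
    rw [div_eq_div_iff (littleJacobi_rho_pos hq0 hq1 hβ hx').ne' (hf0 x hx), ← eval_pearsonShift,
      littleJacobi_eval_pearsonShift hq0 hq1, littleJacobi_eval_f, mul_comm,
      littleJacobi_rho_shift hq0 hq1 hβ hx']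
  · have hx' := littleJacobi_mem hq0 hq1 hx
    rw [eq_div_iff (hf0 x hx), littleJacobi_eval_f, mul_comm, littleJacobi_omega_mul hq0 hq1 hx']
  · refine ⟨le_rfl, one_pos, ?_, ?_, fun h => absurd h (lt_irrefl _)⟩ <;> simp [littleJacobi]
  · have hc : ContinuousAt (fun x : ℝ => x ^ k * (pochInf (√q * x) √q /
        pochInf (√q ^ (β + 1) * x) √q)) 0 := by
      refine (continuous_pow k).continuousAt.mul (ContinuousAt.div ?_ ?_ (by simp [pochInf_zero]))
      · exact (hcr.comp (by fun_prop : Continuous fun x : ℝ => √q * x)).continuousAt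
      · exact (hcr.comp (by fun_prop : Continuous fun x : ℝ => √q ^ (β + 1) * x)).continuousAt
    have := integrable_segment_rpow hr0 hr1 hα hc
    have e : (fun x => x ^ k * (littleJacobi q α β).ρ x) = fun x => x ^ α *
        (x ^ k * (pochInf (√q * x) √q / pochInf (√q ^ (β + 1) * x) √q)) := by
      ext x; rw [littleJacobi_rho hq0]; ring
    rw [e]; exact this
  · have hc : ContinuousAt (fun x : ℝ => x ^ k * (q ^ (-(α + 1) / 8) * (pochInf (q * x) q /
        pochInf (√q ^ (β + 1) * x) q))) 0 := by
      refine (continuous_pow k).continuousAt.mul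
        (continuousAt_const.mul (ContinuousAt.div ?_ ?_ (by simp [pochInf_zero])))
      · exact (hcq.comp (by fun_prop : Continuous fun x : ℝ => q * x)).continuousAt
      · exact (hcq.comp (by fun_prop : Continuous fun x : ℝ => √q ^ (β + 1) * x)).continuousAt
    have := integrable_segment_rpow hr0 hr1 (s := (α - 1) / 2) (by linarith) hc
    have e : (fun x => x ^ k * (littleJacobi q α β).ω x) = fun x => x ^ ((α - 1) / 2) *
        (x ^ k * (q ^ (-(α + 1) / 8) * (pochInf (q * x) q / pochInf (√q ^ (β + 1) * x) q))) := by
      ext x; rw [littleJacobi_omega hq0]; ring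
    rw [e]; exact this

theorem littleJacobi_exists_isMonicOP (hq0 : 0 < q) (hq1 : q < 1) (hα : -1 < α) (hβ : -1 < β) :
    ∃ p, (littleJacobi q α β).IsMonicOP q p :=
  (littleJacobi_isClassical hq0 hq1 hα hβ).exists_isMonicOP fun _ hP =>
    IsClassical.functional_mul_self_pos _ hq0 hq1 (fun _ hx =>
      littleJacobi_rho_pos hq0 hq1 hβ (littleJacobi_mem hq0 hq1 hx)) hP

theorem littleJacobi_ratio (hq0 : 0 < q) (hq1 : q < 1) (hβ : -1 < β) {x : ℝ}
    (hx : x ∈ (littleJacobi q α β).supp.lattice q) :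
    (littleJacobi q α β).ρ x / (littleJacobi q α β).ω x =
      q ^ ((α + 1) / 8) * x ^ ((α + 1) / 2) * pochReal (√q * x) q ((β + 1) / 2) := by
  obtain ⟨hr0, hr1, hr2⟩ := sqrt_facts hq0 hq1
  have hx' := littleJacobi_mem hq0 hq1 hx
  rw [div_eq_iff (littleJacobi_omega_pos hq0 hq1 hβ hx').ne', littleJacobi_rho hq0,
    littleJacobi_omega hq0, pochReal, ← pochInf_mul_pochInf hq0 hq1 (√q * x),
    ← pochInf_mul_pochInf hq0 hq1 (√q ^ (β + 1) * x),
    show √q * x * √q = q * x by linear_combination x * hr2]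
  have e0 : √q * x * q ^ ((β + 1) / 2) = √q ^ (β + 1) * x * √q := by
    rw [rpow_eq_sqrt_rpow hq0, show 2 * ((β + 1) / 2) = β + 1 by ring]; ring
  have e1 : x ^ ((α + 1) / 2) * x ^ ((α - 1) / 2) = x ^ α := by
    rw [← Real.rpow_add hx'.1]; congr 1; ring
  have e2 : q ^ ((α + 1) / 8) * q ^ (-(α + 1) / 8) = 1 := by
    rw [← Real.rpow_add hq0, ← Real.rpow_zero q]; congr 1; ring
  rw [e0, ← e1, mul_comm (pochInf (√q ^ (β + 1) * x) q), mul_div_mul_comm]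
  generalize pochInf (√q * x) q / pochInf (√q ^ (β + 1) * x * √q) q = A
  generalize pochInf (q * x) q / pochInf (√q ^ (β + 1) * x) q = B
  linear_combination -(x ^ ((α + 1) / 2) * x ^ ((α - 1) / 2) * A * B) * e2

lemma littleJacobi_pearsonLead (hq0 : 0 < q) (hq1 : q < 1) (n : ℕ) :
    -((1 - √q) * pearsonLead (littleJacobi q α β).f (littleJacobi q α β).g √q n) =
      1 - √q ^ (α + β + 1) * √q ^ (n + 1) := by
  obtain ⟨hr0, hr1, hr2⟩ := sqrt_facts hq0 hq1
  have h2 : 1 - √q ≠ 0 := (sub_pos.2 hr1).ne'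
  have e : √q ^ (α + β + 2) = √q ^ (α + β + 1) * √q := by
    rw [← Real.rpow_add_one hr0.ne']; congr 1; ring
  have hf : (littleJacobi q α β).f = -X ^ 2 + X := by
    simp only [littleJacobi]; ring
  have e1 : (littleJacobi q α β).f.coeff 2 = -1 := by
    rw [hf]; simp [coeff_X]
  have e2 : (littleJacobi q α β).g.coeff 1 = -qNumber √q (α + β + 2) := by
    simp [littleJacobi, coeff_C]
  rw [pearsonLead, e1, e2, mul_div_cancel₀ _ h2, qNumber, e]
  field_simp
  ring

lemma littleJacobi_mass (hq0 : 0 < q) (hq1 : q < 1) (hα : -1 < α) (hβ : -1 < β) :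
    (littleJacobi q α β).supp.integral √q (littleJacobi q α β).ρ = (1 - √q) *
      (pochInf √q √q * pochInf (√q ^ (α + β + 1) * √q) √q /
        (pochInf (√q ^ (α + 1)) √q * pochInf (√q ^ (β + 1)) √q)) := by
  obtain ⟨hr0, hr1, hr2⟩ := sqrt_facts hq0 hq1
  have hz0 := Real.rpow_pos_of_pos hr0 (α + 1)
  have hz1 : √q ^ (α + 1) < 1 := Real.rpow_lt_one hr0.le hr1 (by linarith)
  have ht1 : √q ^ (β + 1) < 1 := Real.rpow_lt_one hr0.le hr1 (by linarith)
  -- At `x = √q ^ n` the infinite products become `(√q^{β+1}; √q)_n / (√q; √q)_n` up to a constant,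
  -- and `x ^ (α + 1)` is the `n`-th power of `z = √q ^ (α + 1)`.
  have key := qBinomial hr0 hr1 (√q ^ (β + 1)) hz0.le hz1
  rw [← Real.rpow_add hr0, show β + 1 + (α + 1) = α + β + 1 + 1 by ring,
    Real.rpow_add_one hr0.ne' (α + β + 1)] at key
  have h1 := (pochInf_pos hr0 hr1 ht1).ne'
  have h0 : jackson √q 0 (littleJacobi q α β).ρ = 0 := by simp [jackson]
  change jackson √q 1 (littleJacobi q α β).ρ - jackson √q 0 (littleJacobi q α β).ρ = _
  rw [h0, sub_zero, jackson]
  congr 1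
  have e : ∀ n : ℕ, 1 * √q ^ n * (littleJacobi q α β).ρ (1 * √q ^ n) =
      pochInf √q √q / pochInf (√q ^ (β + 1)) √q *
        (pochFin (√q ^ (β + 1)) √q n / pochFin √q √q n * (√q ^ (α + 1)) ^ n) := by
    intro n
    rw [one_mul, littleJacobi_rho hq0, pochInf_eq_pochFin_mul hr0 hr1 √q n,
      pochInf_eq_pochFin_mul hr0 hr1 (√q ^ (β + 1)) n]
    have k1 := (pochFin_pos hr0 hr1 hr1 n).ne'
    have k2 := (pochFin_pos hr0 hr1 ht1 n).ne'
    have e3 : √q ^ n * (√q ^ n) ^ α = (√q ^ (α + 1)) ^ n := by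
      rw [← Real.rpow_natCast, ← Real.rpow_natCast, ← Real.rpow_mul hr0.le, ← Real.rpow_mul hr0.le,
        ← Real.rpow_add hr0]
      congr 1; ring
    rw [← mul_assoc, e3]
    field_simp
  rw [tsum_congr e, tsum_mul_left, key]
  field_simp

lemma littleJacobi_norm (hq0 : 0 < q) (hq1 : q < 1) (n : ℕ) : ∀ {α β : ℝ} (hα : -1 < α)
    (hβ : -1 < β) {P : ℝ[X]}
    (_ : IsOrth (littleJacobi_isClassical hq0 hq1 hα hβ).functional n P),
    (littleJacobi_isClassical hq0 hq1 hα hβ).functional (P * P) =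
      (√q ^ (α + 1)) ^ n * √q ^ (2 * n.choose 2) * pochFin √q √q n /
        pochFin (√q ^ (α + β + 1) * √q ^ n) √q n * ((1 - √q) *
      (pochInf √q √q * pochInf (√q ^ (α + β + 1) * √q ^ (2 * n + 1)) √q /
        (pochInf (√q ^ (α + 1) * √q ^ n) √q * pochInf (√q ^ (β + 1) * √q ^ n) √q))) := by
  obtain ⟨hr0, hr1, hr2⟩ := sqrt_facts hq0 hq1
  have hr := hr0.ne'
  induction n with
  | zero =>
    intro α β hα hβ P hP
    rw [IsOrth.zero_iff.1 hP, mul_one, IsClassical.functional_apply]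
    simp only [eval_one, one_mul]
    rw [littleJacobi_mass hq0 hq1 hα hβ]
    simp [pochFin_zero]
  | succ n ih =>
    intro α β hα hβ P hP
    have h := littleJacobi_isClassical hq0 hq1 hα hβ
    have hα' : -1 < α + 1 := by linarith
    have hβ' : -1 < β + 1 := by linarith
    have h' := littleJacobi_isClassical hq0 hq1 hα' hβ'
    -- Multiplication by `√q ^ (α+1) x (1 - √q ^ (β+1) x)` raises `α` and `β` by one and leaves the
    -- constant `κ = √q ^ (α+1)`; the support is unchanged.
    obtain ⟨P', hP', e⟩ := hP.exists_lower_pearsonShift (v := h'.functional) (κ := √q ^ (α + 1)) hr0 hr1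
      h.natDegree_f h.natDegree_g (h.functional_pearsonOp hq0 hq1)
      (Real.rpow_pos_of_pos hr0 _).ne'
      (h.functional_shift h' hq0 rfl fun x hx => by
        have hx' := littleJacobi_mem hq0 hq1 hx
        have h3 := (littleJacobi_lt_one hq0 hq1 hβ hx').2.2
        have h4 := (pochInf_pos hr0 hr1 h3).ne'
        rw [pochInf_eq_mul hr0 hr1] at h4
        have h5 := left_ne_zero_of_mul h4
        rw [littleJacobi_eval_pearsonShift hq0 hq1, littleJacobi_rho hq0, littleJacobi_rho hq0,
          Real.rpow_add_one hx'.1.ne', Real.rpow_add_one hr (β + 1),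
          pochInf_eq_mul hr0 hr1 (√q ^ (β + 1) * x), mul_right_comm (√q ^ (β + 1)) √q x]
        generalize pochInf (√q ^ (β + 1) * x * √q) √q = A at *
        generalize pochInf (√q * x) √q = B
        generalize 1 - √q ^ (β + 1) * x = D at *
        have e : D * (B / (D * A)) = B / A := by
          rw [← mul_div_assoc, mul_div_mul_left _ _ h5]
        linear_combination √q ^ (α + 1) * x * x ^ α * e)
    rw [ih hα' hβ' hP'] at e
    have hI : (√q)⁻¹ ^ n * √q ^ n = 1 := by
      rw [← mul_pow, inv_mul_cancel₀ hr, one_pow]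
    have hD : √q ^ (α + β + 1) * √q ^ (n + 1) < 1 := by
      rw [pow_succ', ← mul_assoc, ← Real.rpow_add_one hr]
      exact mul_pow_lt_one hr0 hr1 (Real.rpow_lt_one hr0.le hr1 (by linarith)) n
    have hD2 : √q ^ (α + 1 + (β + 1) + 1) = √q ^ (α + β + 1) * √q * √q := by
      rw [← Real.rpow_add_one hr, ← Real.rpow_add_one hr]; congr 1; ring
    have e1 := littleJacobi_pearsonLead (α := α) (β := β) hq0 hq1 n
    rw [hD2, Real.rpow_add_one hr (α + 1), Real.rpow_add_one hr (β + 1),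
      show √q ^ (α + β + 1) * √q * √q * √q ^ n = √q ^ (α + β + 1) * √q ^ (n + 1) * √q by ring,
      show √q ^ (α + β + 1) * √q * √q * √q ^ (2 * n + 1) =
        √q ^ (α + β + 1) * √q ^ (2 * (n + 1) + 1) by ring,
      show √q ^ (α + 1) * √q * √q ^ n = √q ^ (α + 1) * √q ^ (n + 1) by ring,
      show √q ^ (β + 1) * √q * √q ^ n = √q ^ (β + 1) * √q ^ (n + 1) by ring] at e
    rw [pochFin_succ' (√q ^ (α + β + 1) * _), pochFin_succ, Nat.choose_succ_left n 2 (by norm_num),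
      Nat.choose_one_right, mul_comm (1 - _) (pochFin (_ * √q) √q n), ← div_div, ← pow_succ' √q n,
      div_mul_eq_mul_div, eq_div_iff (sub_pos.2 hD).ne']
    generalize pochFin (√q ^ (α + β + 1) * √q ^ (n + 1) * √q) √q n = G at *
    generalize pearsonLead (littleJacobi q α β).f (littleJacobi q α β).g √q n = L at *
    generalize pochInf √q √q * pochInf (√q ^ (α + β + 1) * √q ^ (2 * (n + 1) + 1)) √q /
      (pochInf (√q ^ (α + 1) * √q ^ (n + 1)) √q *
        pochInf (√q ^ (β + 1) * √q ^ (n + 1)) √q) = N at *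
    generalize pochFin √q √q n = F at *
    change h.functional (P * P) * _ = _
    generalize h.functional (P * P) = H at *
    generalize √q ^ (α + β + 1) * √q ^ (n + 1) = E at *
    generalize √q ^ (α + 1) = A at *
    have e3 : √q ^ (2 * (n + n.choose 2)) = √q ^ n * √q ^ n * √q ^ (2 * n.choose 2) := by ring
    rw [e3]
    rw [mul_pow] at e
    generalize √q ^ (2 * n.choose 2) = K at *
    generalize (√q)⁻¹ ^ n = I at *
    linear_combination -H * e1 * (I * √q ^ n) - √q ^ n * e - H * (1 - E) * hI

theorem littleJacobi_gamma (hq0 : 0 < q) (hq1 : q < 1) (hα : -1 < α) (hβ : -1 < β) {p : ℕ → ℝ[X]}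
    (hp : (littleJacobi q α β).IsMonicOP q p) {n : ℕ} (hn : 1 ≤ n) :
    (littleJacobi q α β).gamma q p (2 * n - 2) = littleJacobiConst q α β n := by
  obtain ⟨hr0, hr1, hr2⟩ := sqrt_facts hq0 hq1
  obtain ⟨m, rfl⟩ := Nat.exists_eq_add_of_le' hn
  have hr := hr0.ne'
  have h := littleJacobi_isClassical hq0 hq1 hα hβ
  have hj : 2 * (m + 1) - 2 = 2 * m := by omega
  rw [hj, h.gamma_eq_of_norm hq0 hq1 hp, littleJacobi_pearsonLead hq0 hq1,
    littleJacobi_norm hq0 hq1 _ hα hβ ((h.isOP hp).isOrth _), littleJacobiConst, hj]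
  have hch : 2 * (2 * m).choose 2 + 2 * m = 4 * m * m := by
    rw [Nat.choose_two_right]
    rcases m with _ | m
    · rfl
    · have : 2 * (m + 1) * (2 * (m + 1) - 1) / 2 = (m + 1) * (2 * m + 1) := by
        rw [mul_assoc, Nat.mul_div_cancel_left _ two_pos]; rfl
      rw [this]; ring
  have f1 : q ^ (-2 * ((m + 1 : ℕ) : ℝ) ^ 2 + 3 * ((m + 1 : ℕ) : ℝ) - 1 -
      α * (((m + 1 : ℕ) : ℝ) - 1)) =
      ((√q ^ (α + 1)) ^ (2 * m) * √q ^ (2 * (2 * m).choose 2) * √q ^ (2 * m))⁻¹ := by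
    rw [mul_assoc, ← pow_add, hch, rpow_eq_sqrt_rpow hq0, ← Real.rpow_natCast √q (4 * m * m),
      ← Real.rpow_natCast (√q ^ (α + 1)), ← Real.rpow_mul hr0.le, ← Real.rpow_add hr0,
      ← Real.rpow_neg hr0.le]
    congr 1; push_cast; ring
  have f2 : q ^ ((α + β - 1) / 2 + ((m + 1 : ℕ) : ℝ)) = √q ^ (α + β + 1) * √q ^ (2 * m) := by
    rw [rpow_eq_sqrt_rpow hq0, ← Real.rpow_natCast √q (2 * m), ← Real.rpow_add hr0]
    congr 1; push_cast; ring
  have f3 : √q * √q ^ (4 * ((m + 1 : ℕ) : ℝ) - 2 + α + β) =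
      √q ^ (α + β + 1) * √q ^ (2 * (2 * m) + 2) := by
    rw [← Real.rpow_natCast √q (2 * (2 * m) + 2), ← Real.rpow_add hr0, mul_comm,
      ← Real.rpow_add_one hr]
    congr 1; push_cast; ring
  have f4 : ∀ γ : ℝ, √q * √q ^ (2 * ((m + 1 : ℕ) : ℝ) - 2 + γ) = √q ^ (γ + 1) * √q ^ (2 * m) := by
    intro γ
    rw [← Real.rpow_natCast √q (2 * m), ← Real.rpow_add hr0, mul_comm, ← Real.rpow_add_one hr]
    congr 1; push_cast; ring
  have hlt : ∀ γ : ℝ, 0 < γ → ∀ k : ℕ, √q ^ γ * √q ^ k < 1 := fun γ hγ k =>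
    mul_pow_lt_one hr0 hr1 (Real.rpow_lt_one hr0.le hr1 hγ) k
  have hD := hlt (α + β + 2) (by linarith) (2 * (2 * m))
  rw [show α + β + 2 = α + β + 1 + 1 by ring, Real.rpow_add_one hr, mul_assoc, ← pow_succ'] at hD
  have k1 := (sub_pos.2 hD).ne'
  have k2 := (pochInf_pos hr0 hr1 (hlt (α + 1) (by linarith) (2 * m))).ne'
  have k3 := (pochInf_pos hr0 hr1 (hlt (β + 1) (by linarith) (2 * m))).ne'
  have k4 := (pochInf_pos hr0 hr1 hr1).ne'
  have k5 : 1 - √q ≠ 0 := (sub_pos.2 hr1).ne'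
  have k6 : 1 - q ≠ 0 := (sub_pos.2 hq1).ne'
  simp only [pochReal]
  rw [f1, f2, f3, f4, f4, pochInf_eq_mul hr0 hr1 (√q ^ (α + β + 1) * √q ^ (2 * (2 * m) + 1)),
    show √q ^ (α + β + 1) * √q ^ (2 * (2 * m) + 1) * √q =
      √q ^ (α + β + 1) * √q ^ (2 * (2 * m) + 2) by ring, inv_pow]
  generalize pochInf (√q ^ (α + β + 1) * √q ^ (2 * (2 * m) + 2)) √q = A
  generalize pochInf (√q ^ (α + 1) * √q ^ (2 * m)) √q = B at *
  generalize pochInf (√q ^ (β + 1) * √q ^ (2 * m)) √q = C at *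
  generalize pochInf √q √q = R at *
  generalize 1 - √q ^ (α + β + 1) * √q ^ (2 * (2 * m) + 1) = Δ at *
  generalize pochFin (√q ^ (α + β + 1) * √q ^ (2 * m)) √q (2 * m) = G
  generalize 1 - √q = δ at *
  generalize 1 - q = ε at *
  generalize (√q ^ (α + 1)) ^ (2 * m) = E
  field_simp

end Weight

end QEnsemble

end

noncomputable section

namespace QEnsemble

open Filter Topology Polynomial Support

lemma zpow_rpow {r : ℝ} (hr0 : 0 < r) (n : ℤ) (s : ℝ) : (r ^ n) ^ s = (r ^ s) ^ n := by
  rw [← Real.rpow_intCast, ← Real.rpow_intCast, ← Real.rpow_mul hr0.le, ← Real.rpow_mul hr0.le,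
    mul_comm]

/-- The moment is the bilateral series with `z = t ^ (s + k + 1)`, which is below `1` because `s >
-1`. -/
lemma integrable_halfLine_rpow {r t s : ℝ} (hr0 : 0 < r) (hr1 : r < 1) (ht0 : 0 < t) (ht1 : t < 1)
    (hs : -1 < s) (k : ℕ) :
    halfLine.Integrable t fun x => x ^ k * (x ^ s / pochInf (-x) r) := by
  have hz0 := Real.rpow_pos_of_pos ht0 (s + k + 1)
  have hz1 : t ^ (s + k + 1) < 1 := Real.rpow_lt_one ht0.le ht1 (by have := Nat.cast_nonneg (α := ℝ) k; linarith)
  refine (summable_bilateral hr0 hr1 ht0 ht1 hz0 hz1).congr fun n => ?_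
  have hp : 0 < t ^ n := zpow_pos ht0 n
  rw [← zpow_rpow ht0, Real.rpow_add_one hp.ne', Real.rpow_add hp, Real.rpow_natCast]
  ring

namespace Weight

variable {q α : ℝ}

/-! ### The `q`-Laguerre weight -/

lemma laguerre_eval_pearsonShift (hq0 : 0 < q) (hq1 : q < 1) (x : ℝ) :
    (pearsonShift (laguerre q α).f (laguerre q α).g √q).eval x = √q ^ (α + 1) * x * (1 + x) := by
  have h1 : 1 - √q ≠ 0 := (sub_pos.2 (sqrt_facts hq0 hq1).2.1).ne'
  rw [eval_pearsonShift]
  simp only [laguerre, eval_mul, eval_sub, eval_X, eval_C]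
  field_simp
  ring

lemma laguerre_pochInf_pos {r x : ℝ} (hr0 : 0 < r) (hr1 : r < 1) (hx : 0 < x) :
    0 < pochInf (-x) r := pochInf_pos hr0 hr1 (by linarith)

lemma laguerre_rho_pos (hq0 : 0 < q) (hq1 : q < 1) {x : ℝ} (hx : 0 < x) :
    0 < (laguerre q α).ρ x := by
  obtain ⟨hr0, hr1, hr2⟩ := sqrt_facts hq0 hq1
  exact div_pos (Real.rpow_pos_of_pos hx _) (laguerre_pochInf_pos hr0 hr1 hx)

lemma laguerre_omega_pos (hq0 : 0 < q) (hq1 : q < 1) {x : ℝ} (hx : 0 < x) :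
    0 < (laguerre q α).ω x :=
  div_pos (mul_pos (Real.rpow_pos_of_pos hq0 _) (Real.rpow_pos_of_pos hx _))
    (laguerre_pochInf_pos hq0 hq1 hx)

theorem laguerre_isClassical (hq0 : 0 < q) (hq1 : q < 1) (hα : -1 < α) :
    (laguerre q α).IsClassical q := by
  obtain ⟨hr0, hr1, hr2⟩ := sqrt_facts hq0 hq1
  have hmem : ∀ x ∈ (laguerre q α).supp.lattice q, 0 < x := fun x hx =>
    mem_halfLine_lattice hq0 hq1 hx
  have hf : ∀ x, (laguerre q α).f.eval x = x := fun x => by simp [laguerre]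
  refine ⟨?_, ?_, fun x hx => (laguerre_rho_pos hq0 hq1 (hmem x hx)).ne',
    fun x hx => (laguerre_omega_pos hq0 hq1 (hmem x hx)).ne', fun x hx => ?_, fun x hx => ?_,
    fun x hx => ?_, ?_, fun k => ?_, fun k => ?_⟩
  · simp only [laguerre]; compute_degree; norm_num
  · simp only [laguerre]; compute_degree
  · rw [hf]; exact (mul_pos hr0 (hmem x hx)).ne'
  · have hx' := hmem x hx
    rw [← eval_pearsonShift, laguerre_eval_pearsonShift hq0 hq1, hf,
      div_eq_div_iff (laguerre_rho_pos hq0 hq1 hx').ne' (mul_pos hr0 hx').ne']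
    have h1 := (laguerre_pochInf_pos hr0 hr1 hx').ne'
    simp only [laguerre]
    rw [pochInf_eq_mul hr0 hr1] at h1
    rw [Real.mul_rpow hr0.le hx'.le, Real.rpow_add_one hr0.ne', pochInf_eq_mul hr0 hr1 (-x),
      show -(√q * x) = -x * √q by ring, sub_neg_eq_add]
    rw [sub_neg_eq_add] at h1
    have e : (1 + x) * (x ^ α / ((1 + x) * pochInf (-x * √q) √q)) =
        x ^ α / pochInf (-x * √q) √q := by
      rw [← mul_div_assoc, mul_div_mul_left _ _ (left_ne_zero_of_mul h1)]
    linear_combination -(√q ^ α * √q * x) * e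
  · have hx' := hmem x hx
    rw [eq_div_iff (by rw [hf]; exact (mul_pos hr0 hx').ne'), hf]
    simp only [laguerre]
    rw [Real.mul_rpow hr0.le hx'.le, ← pochInf_mul_pochInf hq0 hq1 (-x),
      show -(√q * x) = -x * √q by ring]
    have e1 : x ^ ((α - 1) / 2) * x ^ ((α - 1) / 2) * x = x ^ α := by
      rw [← Real.rpow_add hx', ← Real.rpow_add_one hx'.ne']; congr 1; ring
    have e2 : q ^ (-(α + 1) / 8) * q ^ (-(α + 1) / 8) * √q ^ ((α - 1) / 2) * √q = 1 := by
      rw [rpow_eq_sqrt_rpow hq0, ← Real.rpow_add hr0, ← Real.rpow_add hr0,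
        ← Real.rpow_add_one hr0.ne', ← Real.rpow_zero √q]
      congr 1; ring
    rw [div_mul_div_comm, div_mul_eq_mul_div, ← e1]
    congr 1
    linear_combination (x ^ ((α - 1) / 2) * x ^ ((α - 1) / 2) * x) * e2
  · exact hf 0
  · exact integrable_halfLine_rpow hr0 hr1 hr0 hr1 hα k
  · have := (integrable_halfLine_rpow hq0 hq1 hr0 hr1 (s := (α - 1) / 2) (by linarith) k)
    refine (Summable.mul_left (q ^ (-(α + 1) / 8)) this).congr fun n => ?_
    simp only [laguerre]
    ring

theorem laguerre_exists_isMonicOP (hq0 : 0 < q) (hq1 : q < 1) (hα : -1 < α) :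
    ∃ p, (laguerre q α).IsMonicOP q p :=
  (laguerre_isClassical hq0 hq1 hα).exists_isMonicOP fun _ hP =>
    IsClassical.functional_mul_self_pos _ hq0 hq1 (fun _ hx =>
      laguerre_rho_pos hq0 hq1 (mem_halfLine_lattice hq0 hq1 hx)) hP

theorem laguerre_ratio (hq0 : 0 < q) (hq1 : q < 1) {x : ℝ}
    (hx : x ∈ (laguerre q α).supp.lattice q) :
    (laguerre q α).ρ x / (laguerre q α).ω x =
      q ^ ((α + 1) / 8) * x ^ ((α + 1) / 2) / pochInf (-√q * x) q := by
  obtain ⟨hr0, hr1, hr2⟩ := sqrt_facts hq0 hq1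
  have hx' : 0 < x := mem_halfLine_lattice hq0 hq1 hx
  rw [div_eq_iff (laguerre_omega_pos hq0 hq1 hx').ne']
  simp only [laguerre]
  have e1 : x ^ ((α + 1) / 2) * x ^ ((α - 1) / 2) = x ^ α := by
    rw [← Real.rpow_add hx']; congr 1; ring
  have e2 : q ^ ((α + 1) / 8) * q ^ (-(α + 1) / 8) = 1 := by
    rw [← Real.rpow_add hq0, ← Real.rpow_zero q]; congr 1; ring
  rw [← pochInf_mul_pochInf hq0 hq1 (-x), show -√q * x = -x * √q by ring, div_mul_div_comm, ← e1,
    mul_comm (pochInf (-x) q)]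
  congr 1
  linear_combination -(x ^ ((α + 1) / 2) * x ^ ((α - 1) / 2)) * e2

lemma laguerre_pearsonLead (hq0 : 0 < q) (hq1 : q < 1) (n : ℕ) :
    -((1 - √q) * pearsonLead (laguerre q α).f (laguerre q α).g √q n) =
      √q ^ (α + 1) * √q ^ n := by
  have h2 : 1 - √q ≠ 0 := (sub_pos.2 (sqrt_facts hq0 hq1).2.1).ne'
  have e1 : (laguerre q α).f.coeff 2 = 0 := by
    simp [laguerre, coeff_X]
  have e2 : (laguerre q α).g.coeff 1 = -(1 / (1 - √q) * √q ^ (α + 1)) := by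
    simp only [laguerre, coeff_C_mul, coeff_sub, coeff_X, coeff_C]
    norm_num
  rw [pearsonLead, e1, e2, mul_div_cancel₀ _ h2]
  field_simp
  ring

/-- The total mass of the `q`-Laguerre weight, `A = r ^ (α + 1)`. -/
def laguerreMass (r A : ℝ) : ℝ :=
  (1 - r) * (pochInf r r * pochInf (-(r / A)) r * pochInf (-A) r /
    (2 * (pochInf (-r) r * pochInf (-r) r) * pochInf A r))

/-- Quasi-periodicity of `(-A, -r/A; r)_∞` under `A ↦ A r`. It lets the norm be stated with the mass
of the original parameter although lowering the degree shifts `α`. -/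
lemma laguerreMass_mul {r A : ℝ} (hr0 : 0 < r) (hr1 : r < 1) (hA0 : 0 < A) (hA1 : A < 1) :
    A * laguerreMass r (A * r) = (1 - A) * laguerreMass r A := by
  have hr := hr0.ne'
  have hA := hA0.ne'
  have e1 := pochInf_eq_mul hr0 hr1 (-(1 / A))
  have e2 := pochInf_eq_mul hr0 hr1 (-A)
  have e3 := pochInf_eq_mul hr0 hr1 A
  have h1 : 1 - A ≠ 0 := (sub_pos.2 hA1).ne'
  have h2 : pochInf A r ≠ 0 := (pochInf_pos hr0 hr1 hA1).ne'
  have h3 : pochInf (-r) r ≠ 0 := (pochInf_pos hr0 hr1 (by linarith)).ne'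
  unfold laguerreMass
  rw [show r / (A * r) = 1 / A by field_simp, e1, e2, show -(1 / A) * r = -(r / A) by ring,
    show -(A * r) = -A * r by ring]
  rw [e3] at h2 ⊢
  have h4 := right_ne_zero_of_mul h2
  generalize pochInf (A * r) r = C at *
  generalize pochInf (-A * r) r = D
  generalize pochInf (-(r / A)) r = E
  generalize pochInf (-r) r = F at *
  field_simp
  ring

lemma laguerre_mass (hq0 : 0 < q) (hq1 : q < 1) (hα : -1 < α) :
    (laguerre q α).supp.integral √q (laguerre q α).ρ = laguerreMass √q (√q ^ (α + 1)) := by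
  obtain ⟨hr0, hr1, hr2⟩ := sqrt_facts hq0 hq1
  have hz0 := Real.rpow_pos_of_pos hr0 (α + 1)
  have hz1 : √q ^ (α + 1) < 1 := Real.rpow_lt_one hr0.le hr1 (by linarith)
  have e : ∀ n : ℤ, √q ^ n * (laguerre q α).ρ (√q ^ n) =
      (√q ^ (α + 1)) ^ n / pochInf (-√q ^ n) √q := by
    intro n
    have hp : 0 < √q ^ n := zpow_pos hr0 n
    rw [← zpow_rpow hr0, Real.rpow_add_one hp.ne']
    simp only [laguerre]
    ring
  change (1 - √q) * ∑' n : ℤ, √q ^ n * (laguerre q α).ρ (√q ^ n) = _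
  -- The factor `2` in the mass, and hence in the final constant, is the first factor of `(-1;
  -- r)_∞`.
  rw [tsum_congr e, tsum_bilateral hr0 hr1 hz0 hz1, laguerreMass,
    pochInf_eq_mul hr0 hr1 (-1), neg_one_mul]
  congr 2
  ring

lemma laguerre_norm (hq0 : 0 < q) (hq1 : q < 1) (n : ℕ) : ∀ {α : ℝ} (hα : -1 < α) {P : ℝ[X]}
    (_ : IsOrth (laguerre_isClassical hq0 hq1 hα).functional n P),
    (laguerre_isClassical hq0 hq1 hα).functional (P * P) =
      pochFin √q √q n * pochFin (√q ^ (α + 1)) √q n /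
        ((√q ^ (α + 1)) ^ (2 * n) * √q ^ (4 * n.choose 2 + n)) *
          laguerreMass √q (√q ^ (α + 1)) := by
  obtain ⟨hr0, hr1, hr2⟩ := sqrt_facts hq0 hq1
  have hr := hr0.ne'
  induction n with
  | zero =>
    intro α hα P hP
    rw [IsOrth.zero_iff.1 hP, mul_one, IsClassical.functional_apply]
    simp only [eval_one, one_mul]
    rw [laguerre_mass hq0 hq1 hα]
    simp [pochFin_zero]
  | succ n ih =>
    intro α hα P hP
    have h := laguerre_isClassical hq0 hq1 hα
    have hα' : -1 < α + 1 := by linarith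
    have h' := laguerre_isClassical hq0 hq1 hα'
    have hA0 := Real.rpow_pos_of_pos hr0 (α + 1)
    have hA1 : √q ^ (α + 1) < 1 := Real.rpow_lt_one hr0.le hr1 (by linarith)
    -- As `f = x`, multiplication by `f` raises `α` by one with constant `1`.
    obtain ⟨P', hP', e⟩ := hP.exists_lower_mul (v := h'.functional) (κ := 1) hr0 hr1 h.natDegree_f
      h.natDegree_g (h.functional_pearsonOp hq0 hq1) one_ne_zero
      (h.functional_shift h' hq0 rfl fun x hx => by
        have hx' : 0 < x := mem_halfLine_lattice hq0 hq1 hx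
        simp only [laguerre, eval_X]
        rw [Real.rpow_add_one hx'.ne']
        ring)
    rw [ih hα' hP', mul_one] at e
    have hI : (√q)⁻¹ ^ (n + 1) * √q ^ (n + 1) = 1 := by
      rw [← mul_pow, inv_mul_cancel₀ hr, one_pow]
    have e1 := laguerre_pearsonLead (α := α) hq0 hq1 n
    have e2 := laguerreMass_mul hr0 hr1 hA0 hA1
    rw [e1, Real.rpow_add_one hr (α + 1)] at e
    rw [pochFin_succ' (√q ^ (α + 1)), pochFin_succ, Nat.choose_succ_left n 2 (by norm_num),
      Nat.choose_one_right, ← pow_succ' √q n]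
    generalize laguerreMass √q (√q ^ (α + 1) * √q) = M' at *
    generalize laguerreMass √q (√q ^ (α + 1)) = M at *
    generalize pochFin (√q ^ (α + 1) * √q) √q n = G at *
    generalize pochFin √q √q n = F at *
    change h.functional (P * P) = _
    generalize h.functional (P * P) = H at *
    generalize √q ^ (α + 1) = A at *
    have hA := hA0.ne'
    have e3 : √q ^ (4 * (n + n.choose 2) + (n + 1)) =
      √q ^ (4 * n.choose 2 + n) * √q ^ n * √q ^ n * √q ^ n * √q ^ (n + 1) := by ring
    have e4 : (A * √q) ^ (2 * n) = A ^ (2 * n) * √q ^ n * √q ^ n := by ring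
    rw [e3, show A ^ (2 * (n + 1)) = A ^ (2 * n) * A * A by ring]
    rw [e4] at e
    have k1 := pow_ne_zero (4 * n.choose 2 + n) hr
    have k2 := pow_ne_zero n hr
    have k3 := pow_ne_zero (2 * n) hA
    have k4 := pow_ne_zero (n + 1) hr
    generalize √q ^ (4 * n.choose 2 + n) = K at *
    generalize A ^ (2 * n) = B at *
    generalize √q ^ (n + 1) = S at *
    generalize √q ^ n = T at *
    rw [eq_inv_of_mul_eq_one_left hI] at e
    have e5 : M' = (1 - A) * M / A := by rw [eq_div_iff hA]; linear_combination e2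
    have e6 : H = (1 - S) * S⁻¹ * (F * G / (B * T * T * K) * M') / (A * T) := by
      rw [eq_div_iff (mul_ne_zero hA k2)]; linear_combination -e
    rw [e6, e5]
    field_simp

theorem laguerre_gamma (hq0 : 0 < q) (hq1 : q < 1) (hα : -1 < α) {p : ℕ → ℝ[X]}
    (hp : (laguerre q α).IsMonicOP q p) {n : ℕ} (hn : 1 ≤ n) :
    (laguerre q α).gamma q p (2 * n - 2) = laguerreConst q α n := by
  obtain ⟨hr0, hr1, hr2⟩ := sqrt_facts hq0 hq1
  obtain ⟨m, rfl⟩ := Nat.exists_eq_add_of_le' hn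
  have hr := hr0.ne'
  have h := laguerre_isClassical hq0 hq1 hα
  have hj : 2 * (m + 1) - 2 = 2 * m := by omega
  rw [hj, h.gamma_eq_of_norm hq0 hq1 hp, laguerre_pearsonLead hq0 hq1,
    laguerre_norm hq0 hq1 _ hα ((h.isOP hp).isOrth _), laguerreConst, hj]
  have hch : 4 * (2 * m).choose 2 + 4 * m = 8 * m * m := by
    rw [Nat.choose_two_right]
    rcases m with _ | m
    · rfl
    · have : 2 * (m + 1) * (2 * (m + 1) - 1) / 2 = (m + 1) * (2 * m + 1) := by
        rw [mul_assoc, Nat.mul_div_cancel_left _ two_pos]; rfl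
      rw [this]; ring
  have hA0 := Real.rpow_pos_of_pos hr0 (α + 1)
  have hA1 : √q ^ (α + 1) < 1 := Real.rpow_lt_one hr0.le hr1 (by linarith)
  -- The power of `q` in the constant collects `√q ^ (α+1) √q ^ (4m)` from the Pearson coefficient,
  -- the power in the denominator of the norm, and `√q ^ (-2m)` from `γ`. The last is written on the
  -- left to avoid a negative exponent.
  have f1 : q ^ (4 * ((m + 1 : ℕ) : ℝ) ^ 2 + 2 * (α - 3) * ((m + 1 : ℕ) : ℝ) +
      (5 - 3 * α) / 2) * √q ^ (2 * m) = √q ^ (α + 1) * √q ^ (2 * (2 * m)) *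
        ((√q ^ (α + 1)) ^ (2 * (2 * m)) * √q ^ (4 * (2 * m).choose 2 + 2 * m)) := by
    have e : √q ^ (2 * (2 * m)) * √q ^ (4 * (2 * m).choose 2 + 2 * m) =
        √q ^ (8 * m * m + 2 * m) := by
      rw [← pow_add]; congr 1; omega
    rw [mul_mul_mul_comm, e, rpow_eq_sqrt_rpow hq0, ← pow_succ',
      ← Real.rpow_natCast (√q ^ (α + 1)), ← Real.rpow_mul hr0.le,
      ← Real.rpow_natCast √q (2 * m), ← Real.rpow_natCast √q (8 * m * m + 2 * m),
      ← Real.rpow_add hr0, ← Real.rpow_add hr0]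
    congr 1; push_cast; ring
  have f2 : q ^ ((α + 1) / 2) = √q ^ (α + 1) := by
    rw [rpow_eq_sqrt_rpow hq0]; congr 1; ring
  have f3 : q ^ (-α / 2) = √q / √q ^ (α + 1) := by
    rw [rpow_eq_sqrt_rpow hq0, Real.rpow_add_one hr, show 2 * (-α / 2) = -α by ring,
      Real.rpow_neg hr0.le]
    field_simp
  have k1 := (pochInf_pos hr0 hr1 hA1).ne'
  have k3 : pochInf (-√q) √q ≠ 0 := (pochInf_pos hr0 hr1 (by linarith)).ne'
  have k5 : 1 - √q ≠ 0 := (sub_pos.2 hr1).ne'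
  have k6 : 1 - q ≠ 0 := (sub_pos.2 hq1).ne'
  have k7 := pow_ne_zero (2 * m) hr
  rw [← eq_div_iff k7] at f1
  rw [f1, f2, f3, laguerreMass, inv_pow]
  have hA := hA0.ne'
  generalize pochInf (-(√q / √q ^ (α + 1))) √q = B
  generalize pochInf (-√q ^ (α + 1)) √q = C
  generalize pochInf (√q ^ (α + 1)) √q = D at *
  generalize pochInf (-√q) √q = E at *
  generalize pochInf √q √q = R
  generalize 1 - √q = δ at *
  generalize 1 - q = ε at *
  generalize pochFin (√q ^ (α + 1)) √q (2 * m) = S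
  generalize pochFin √q √q (2 * m) = T
  generalize √q ^ (α + 1) = A at *
  field_simp

end Weight

end QEnsemble

end

/-! ### The general formula and its four specializations -/

theorem mainTheorem4 (q : ℝ) (hq0 : 0 < q) (hq1 : q < 1) :
    -- every classical weight
    (∀ W : QEnsemble.Weight, W.IsClassical q →
      ∀ p : ℕ → Polynomial ℝ, W.IsMonicOP q p →
        (∃ (Q : ℕ → Polynomial ℝ) (u : ℕ → ℝ), W.IsMonicSOP q Q u) ∧
        ∀ (Q : ℕ → Polynomial ℝ) (u : ℕ → ℝ), W.IsMonicSOP q Q u →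
          ∀ n : ℕ, 1 ≤ n → ∀ x ∈ W.supp.lattice q, ∀ y : ℝ,
            W.kernelJ q Q u n x y =
              W.ρ x / W.ω x * W.kernelS q p (2 * n - 1) x y +
                W.gamma q p (2 * n - 2) *
                  W.opS q (fun z => (p (2 * n - 2)).eval z) x * (p (2 * n - 1)).eval y) ∧
    -- little q-Jacobi
    (∀ α β : ℝ, -1 < α → -1 < β →
      (QEnsemble.Weight.littleJacobi q α β).IsClassical q ∧
      (∃ p, (QEnsemble.Weight.littleJacobi q α β).IsMonicOP q p) ∧
      ∀ (p Q : ℕ → Polynomial ℝ) (u : ℕ → ℝ),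
        (QEnsemble.Weight.littleJacobi q α β).IsMonicOP q p →
        (QEnsemble.Weight.littleJacobi q α β).IsMonicSOP q Q u →
        ∀ n : ℕ, 1 ≤ n → ∀ x ∈ (QEnsemble.Weight.littleJacobi q α β).supp.lattice q, ∀ y : ℝ,
          (QEnsemble.Weight.littleJacobi q α β).kernelJ q Q u n x y =
            q ^ ((α + 1) / 8) * x ^ ((α + 1) / 2) *
                QEnsemble.pochReal (√q * x) q ((β + 1) / 2) *
                (QEnsemble.Weight.littleJacobi q α β).kernelS q p (2 * n - 1) x y +
              QEnsemble.littleJacobiConst q α β n *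
                (QEnsemble.Weight.littleJacobi q α β).opS q
                  (fun z => (p (2 * n - 2)).eval z) x * (p (2 * n - 1)).eval y) ∧
    -- Al-Salam–Carlitz
    (∀ α : ℝ, α < 0 →
      (QEnsemble.Weight.alSalamCarlitz q α).IsClassical q ∧
      (∃ p, (QEnsemble.Weight.alSalamCarlitz q α).IsMonicOP q p) ∧
      ∀ (p Q : ℕ → Polynomial ℝ) (u : ℕ → ℝ),
        (QEnsemble.Weight.alSalamCarlitz q α).IsMonicOP q p →
        (QEnsemble.Weight.alSalamCarlitz q α).IsMonicSOP q Q u →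
        ∀ n : ℕ, 1 ≤ n → ∀ x ∈ (QEnsemble.Weight.alSalamCarlitz q α).supp.lattice q, ∀ y : ℝ,
          (QEnsemble.Weight.alSalamCarlitz q α).kernelJ q Q u n x y =
            (-α) ^ ((1 : ℝ) / 2) * QEnsemble.pochInf (√q * x) q *
                QEnsemble.pochInf (√q * x / α) q *
                (QEnsemble.Weight.alSalamCarlitz q α).kernelS q p (2 * n - 1) x y +
              QEnsemble.alSalamCarlitzConst q α n *
                (QEnsemble.Weight.alSalamCarlitz q α).opS q
                  (fun z => (p (2 * n - 2)).eval z) x * (p (2 * n - 1)).eval y) ∧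
    -- q-Laguerre
    (∀ α : ℝ, -1 < α →
      (QEnsemble.Weight.laguerre q α).IsClassical q ∧
      (∃ p, (QEnsemble.Weight.laguerre q α).IsMonicOP q p) ∧
      ∀ (p Q : ℕ → Polynomial ℝ) (u : ℕ → ℝ),
        (QEnsemble.Weight.laguerre q α).IsMonicOP q p →
        (QEnsemble.Weight.laguerre q α).IsMonicSOP q Q u →
        ∀ n : ℕ, 1 ≤ n → ∀ x ∈ (QEnsemble.Weight.laguerre q α).supp.lattice q, ∀ y : ℝ,
          (QEnsemble.Weight.laguerre q α).kernelJ q Q u n x y =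
            q ^ ((α + 1) / 8) * x ^ ((α + 1) / 2) / QEnsemble.pochInf (-√q * x) q *
                (QEnsemble.Weight.laguerre q α).kernelS q p (2 * n - 1) x y +
              QEnsemble.laguerreConst q α n *
                (QEnsemble.Weight.laguerre q α).opS q
                  (fun z => (p (2 * n - 2)).eval z) x * (p (2 * n - 1)).eval y) ∧
    -- big q-Jacobi
    (∀ a b c : ℝ, 0 < a * √q → a * √q < 1 → 0 ≤ b * √q → b * √q < 1 → c < 0 →
      (QEnsemble.Weight.bigJacobi q a b c).IsClassical q ∧
      (∃ p, (QEnsemble.Weight.bigJacobi q a b c).IsMonicOP q p) ∧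
      ∀ (p Q : ℕ → Polynomial ℝ) (u : ℕ → ℝ),
        (QEnsemble.Weight.bigJacobi q a b c).IsMonicOP q p →
        (QEnsemble.Weight.bigJacobi q a b c).IsMonicSOP q Q u →
        ∀ n : ℕ, 1 ≤ n → ∀ x ∈ (QEnsemble.Weight.bigJacobi q a b c).supp.lattice q, ∀ y : ℝ,
          (QEnsemble.Weight.bigJacobi q a b c).kernelJ q Q u n x y =
            QEnsemble.pochInf (x / a) q * QEnsemble.pochInf (x / c) q /
                (QEnsemble.pochInf (√q * x) q * QEnsemble.pochInf (b / c * √q * x) q) *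
                (QEnsemble.Weight.bigJacobi q a b c).kernelS q p (2 * n - 1) x y +
              QEnsemble.bigJacobiConst q a b c n *
                (QEnsemble.Weight.bigJacobi q a b c).opS q
                  (fun z => (p (2 * n - 2)).eval z) x * (p (2 * n - 1)).eval y) := by
  refine ⟨fun W h p hp => ⟨h.exists_isMonicSOP hq0 hq1 hp, fun Q u hQ n hn x hx y =>
    h.kernelJ_eq hq0 hq1 hp hQ hn hx y⟩, ?_, ?_, ?_, ?_⟩
  · intro α β hα hβ
    have h := QEnsemble.Weight.littleJacobi_isClassical hq0 hq1 hα hβ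
    refine ⟨h, QEnsemble.Weight.littleJacobi_exists_isMonicOP hq0 hq1 hα hβ,
      fun p Q u hp hQ n hn x hx y => ?_⟩
    rw [h.kernelJ_eq hq0 hq1 hp hQ hn hx y, QEnsemble.Weight.littleJacobi_ratio hq0 hq1 hβ hx,
      QEnsemble.Weight.littleJacobi_gamma hq0 hq1 hα hβ hp hn]
  · intro α hα
    have h := QEnsemble.Weight.alSalamCarlitz_isClassical hq0 hq1 hα
    refine ⟨h, QEnsemble.Weight.alSalamCarlitz_exists_isMonicOP hq0 hq1 hα,
      fun p Q u hp hQ n hn x hx y => ?_⟩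
    rw [h.kernelJ_eq hq0 hq1 hp hQ hn hx y, QEnsemble.Weight.alSalamCarlitz_ratio hq0 hq1 hα hx,
      QEnsemble.Weight.alSalamCarlitz_gamma hq0 hq1 hα hp hn]
  · intro α hα
    have h := QEnsemble.Weight.laguerre_isClassical hq0 hq1 hα
    refine ⟨h, QEnsemble.Weight.laguerre_exists_isMonicOP hq0 hq1 hα,
      fun p Q u hp hQ n hn x hx y => ?_⟩
    rw [h.kernelJ_eq hq0 hq1 hp hQ hn hx y, QEnsemble.Weight.laguerre_ratio hq0 hq1 hx,
      QEnsemble.Weight.laguerre_gamma hq0 hq1 hα hp hn]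
  · intro a b c ha0 ha hb0 hb hc
    have hr0 : 0 < √q := Real.sqrt_pos.2 hq0
    have ha0' : 0 < a := pos_of_mul_pos_left ha0 hr0.le
    have hb0' : 0 ≤ b := nonneg_of_mul_nonneg_left hb0 hr0
    have h := QEnsemble.Weight.bigJacobi_isClassical hq0 hq1 ha0' ha hb0' hb hc
    refine ⟨h, QEnsemble.Weight.bigJacobi_exists_isMonicOP hq0 hq1 ha0' ha hb0' hb hc,
      fun p Q u hp hQ n hn x hx y => ?_⟩
    rw [h.kernelJ_eq hq0 hq1 hp hQ hn hx y,
      QEnsemble.Weight.bigJacobi_ratio hq0 hq1 ha0' ha hb0' hb hc hx,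
      QEnsemble.Weight.bigJacobi_gamma hq0 hq1 ha0' ha hb0' hb hc hp hn]
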